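/- **Setting.** Let $d\ge 2$, $N\ge 1$, and let $X\in\mathbb R^{d\times N}$ have rank $d$. For $H\in\mathbb R^{d\times N}$ put $M(H)=\frac1N HH^\top$, $\mathrm{BN}(H)=\mathrm{diag}(M(H))^{-1/2}H$, $r(H)=\mathrm{Tr}(M(H))^2/\|M(H)\|_F^2$, and, for $\tau\in[0,1]$, $\mathrm{rank}_\tau(H)=\#\{i\le d:\sigma_i(H)^2/N\ge\tau\}$, where $\sigma_1(H),\dots,\sigma_d(H)$ are the singular values of $H$. Let $\mathcal H$ be the compact set of $d\times N$ matrices all of whose rows have norm $\sqrt N$. Let $B>0$ and let $\mathbb P$ be a probability distribution on $\mathbb R$ with mean zero, unit variance, symmetric around zero, without atoms (for example with a density) and supported in $[-B,B]$. Let all entries of $W_0,W_1,\dots\in\mathbb R^{d\times d}$ be i.i.d. with law $\mathbb P$, let $\mu$ be the law of $W_\ell$, and for $\gamma>0$ let $$H_0=X,\qquad H_{\ell+1}=\mathrm{BN}(H_\ell+\gamma W_\ell H_\ell).$$ A probability measure $\nu$ on $\mathbb R^{d\times N}$ is *invariant* if $\mathrm{BN}(H+\gamma WH)\sim\nu$ whenever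 $H\sim\nu$ and $W\sim\mu$ are independent. Its regularity constant is $$\alpha(\nu)=\frac{\mathbb E_{H\sim\nu}\,\mathrm{Tr}\big(\mathrm{diag}(M(H)^2)^2\big)}{\mathbb E_{H\sim\nu}\,\mathrm{Tr}\big(M(H)^3\big)} .$$ **Assumption on the chain.** There is a set of states $E\subseteq\mathcal H$ such that 1. $\nu$ is the unique invariant distribution carried by $E$; it suffices that it is unique up to the law of $M(H)$, that is, that $M(H)$ has the same law under every invariant distribution carried by $E$ as under $\nu$; 2. the chain started at $X$ stays in $E$ in the long run: almost surely, for every $\varepsilon>0$ there is a compact $K\subseteq E$ such that $\#\{1\le\ell\le L: H_\ell\in K\}\ge(1-\varepsilon)L$ for all large $L$. (If $E$ is compact and contains $H_1,H_2,\dots$ almost surely, in particular if $E=\mathcal H$ and no row of any $H_\ell+\gamma W_\ell H_\ell$ vanishes, this is automatic.) **Theorem.** There is a threshold $\gamma_0=\gamma_0(d,B)>0$ such that for every $0<\gamma<\gamma_0$, under these assumptions, the regularity constant $\alpha=\alpha(\nu)$ satisfies $0<\alpha<1$ and, almost surely, for all $\tau\in[0,1]$ the following limits exist and satisfy $$\lim_{L\to\infty}\frac1L\sum_{\ell=1}^L\mathrm{rank}_\tau(H_\ell)\;\ge\;\lim_{L\to\infty}\frac{(1-\tau)^2}{L}\sum_{\ell=1}^L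 r(H_\ell)\;\ge\;(1-\tau)^2(1-\alpha)^{1/2}\sqrt d .$$ Moreover, if such networks are given for every $d$ in a set $D\subseteq\{2,3,\dots\}$ of widths (same $B$, each with $0<\gamma_d<\gamma_0(d,B)$; the other data may depend on $d$) and the regularity constants $\alpha_d$ are non-increasing in $d\in D$, then the lower bound is $\Omega(\sqrt d)$: there is $c>0$ such that for every $d\in D$, almost surely, for all $\tau\in[0,1]$ both limits are at least $c\,(1-\tau)^2\sqrt d$ (and the first is at least the second). -/

import Mathlib

open MeasureTheory ProbabilityTheory Filter Topology

noncomputable section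

namespace BNNet

variable {d N : ℕ}

/-- The Borel (product) σ-algebra on real matrices. -/
instance matrixMeasurableSpace : MeasurableSpace (Matrix (Fin d) (Fin N) ℝ) :=
  inferInstanceAs (MeasurableSpace (Fin d → Fin N → ℝ))

/-- The second moment matrix `M(H) = H Hᵀ / N` of a `d × N` matrix `H` (`N` samples in `ℝ^d`). -/
def secondMoment (H : Matrix (Fin d) (Fin N) ℝ) : Matrix (Fin d) (Fin d) ℝ :=
  (1 / (N : ℝ)) • (H * H.transpose)

/-- Batch normalization with shift `0` and scale `1`, without mean correction:
`BN(H) = diag(M(H))^(-1/2) H`. -/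
def batchNorm (H : Matrix (Fin d) (Fin N) ℝ) : Matrix (Fin d) (Fin N) ℝ :=
  Matrix.diagonal (fun i => (secondMoment H i i) ^ (-(1 / 2) : ℝ)) * H

/-- One layer: `H ↦ BN(H + γ W H)`. -/
def layer (γ : ℝ) (W : Matrix (Fin d) (Fin d) ℝ) (H : Matrix (Fin d) (Fin N) ℝ) :
    Matrix (Fin d) (Fin N) ℝ :=
  batchNorm (H + γ • (W * H))

/-- The hidden representations: `H_0 = X`, `H_{ℓ+1} = BN(H_ℓ + γ W_ℓ H_ℓ)`. -/
def hidden (γ : ℝ) (X : Matrix (Fin d) (Fin N) ℝ) (W : ℕ → Matrix (Fin d) (Fin d) ℝ) :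
    ℕ → Matrix (Fin d) (Fin N) ℝ
  | 0 => X
  | l + 1 => layer γ (W l) (hidden γ X W l)

/-- The squared Frobenius norm. -/
def frobSq (M : Matrix (Fin d) (Fin d) ℝ) : ℝ := ∑ i, ∑ j, M i j ^ 2

/-- `r(H) = Tr(M(H))² / ‖M(H)‖_F²`. -/
def stableRank (H : Matrix (Fin d) (Fin N) ℝ) : ℝ :=
  (secondMoment H).trace ^ 2 / frobSq (secondMoment H)

/-- The `d` singular values of a `d × N` matrix `H`: the square roots of the eigenvalues of
`H Hᵀ` (over `ℝ` the conjugate transpose is the transpose). -/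
def singularValue (H : Matrix (Fin d) (Fin N) ℝ) (i : Fin d) : ℝ :=
  √((Matrix.isHermitian_mul_conjTranspose_self H).eigenvalues i)

open Classical in
/-- The soft rank: the number of singular values `σ` of `H` with `σ² / N ≥ τ`. -/
def softRank (τ : ℝ) (H : Matrix (Fin d) (Fin N) ℝ) : ℕ :=
  (Finset.univ.filter fun i : Fin d => τ ≤ singularValue H i ^ 2 / (N : ℝ)).card

/-- The matrices all of whose rows have norm `√N`. -/
def normalized (d N : ℕ) : Set (Matrix (Fin d) (Fin N) ℝ) :=
  {H | ∀ i, ∑ j, H i j ^ 2 = (N : ℝ)}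

/-- The element-wise law of the weights: a zero-mean, unit-variance probability measure on the
line, symmetric around zero, without atoms, supported in `[-B, B]`. -/
structure IsWeightLaw (B : ℝ) (p : Measure ℝ) : Prop where
  prob : IsProbabilityMeasure p
  noAtoms : ∀ x, p {x} = 0
  support : ∀ᵐ x ∂p, x ∈ Set.Icc (-B) B
  mean : ∫ x, x ∂p = 0
  variance : ∫ x, x ^ 2 ∂p = 1
  symm : p.map (fun x => -x) = p

/-- The law `μ` of a `d × d` weight matrix with i.i.d. entries of law `p`. -/
def weightMatrixLaw (d : ℕ) (p : Measure ℝ) : Measure (Matrix (Fin d) (Fin d) ℝ) :=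
  (Measure.pi fun _ : Fin d × Fin d => p).map fun w => Matrix.of fun i j => w (i, j)

/-- All entries of all the weight matrices `W_0, W_1, …` are i.i.d. with law `p`. -/
structure IsIIDWeights {Ω : Type*} [MeasurableSpace Ω] (p : Measure ℝ) (P : Measure Ω)
    (W : ℕ → Ω → Matrix (Fin d) (Fin d) ℝ) : Prop where
  hasLaw : ∀ l i j, HasLaw (fun ω => W l ω i j) p P
  indep : iIndepFun (fun (q : ℕ × Fin d × Fin d) ω => W q.1 ω q.2.1 q.2.2) P

/-- `ν` is an invariant distribution of the chain of hidden representations: if `H ∼ ν` and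
`W ∼ μ` are independent then `BN(H + γ W H) ∼ ν`. -/
structure IsInvariant (γ : ℝ) (p : Measure ℝ) (ν : Measure (Matrix (Fin d) (Fin N) ℝ)) :
    Prop where
  prob : IsProbabilityMeasure ν
  invariant : (ν.prod (weightMatrixLaw d p)).map (fun q => layer γ q.2 q.1) = ν

/-- `ν` is the unique invariant distribution on the set of states `E`. Uniqueness is asked for
only up to the law of the second moment matrix, which is weaker than `ν' = ν`. -/
structure IsUniqueInvariantOn (E : Set (Matrix (Fin d) (Fin N) ℝ)) (γ : ℝ) (p : Measure ℝ)
    (ν : Measure (Matrix (Fin d) (Fin N) ℝ)) : Prop where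
  isInvariant : IsInvariant γ p ν
  carried : ∀ᵐ H ∂ν, H ∈ E
  unique : ∀ ν' : Measure (Matrix (Fin d) (Fin N) ℝ), IsInvariant γ p ν' → (∀ᵐ H ∂ν', H ∈ E) →
    ν'.map secondMoment = ν.map secondMoment

open Classical in
/-- The sequence does not lose mass from `E` in the long run: for each `ε > 0` there is a compact
`K ⊆ E` such that, for all large `L`, at least `(1 - ε) L` of the states `H_1, …, H_L` are in `K`.
This is automatic when `E` is compact and contains the sequence from some index on. -/
def StaysIn (E : Set (Matrix (Fin d) (Fin N) ℝ)) (H : ℕ → Matrix (Fin d) (Fin N) ℝ) : Prop :=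
  ∀ ε : ℝ, 0 < ε → ∃ K : Set (Matrix (Fin d) (Fin N) ℝ), IsCompact K ∧ K ⊆ E ∧
    ∀ᶠ L : ℕ in atTop,
      (1 - ε) * (L : ℝ) ≤ (((Finset.Icc 1 L).filter fun l => H l ∈ K).card : ℝ)

/-- The regularity constant `α = E_ν Tr(diag(M(H)²)²) / E_ν Tr(M(H)³)`. -/
def regularity (ν : Measure (Matrix (Fin d) (Fin N) ℝ)) : ℝ :=
  (∫ H, (Matrix.diagonal (Matrix.diag (secondMoment H ^ 2)) ^ 2).trace ∂ν) /
    ∫ H, (secondMoment H ^ 3).trace ∂ν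

/-- The standing assumptions on a network: a full-rank input `X`, i.i.d. weights of law `p`, and
a set `E` of row-normalized states with a unique invariant distribution `ν`, from which the chain
started at `X` almost surely loses no mass. -/
structure IsSetting {Ω : Type*} [MeasurableSpace Ω] (B : ℝ) (p : Measure ℝ) (γ : ℝ)
    (X : Matrix (Fin d) (Fin N) ℝ) (P : Measure Ω) (W : ℕ → Ω → Matrix (Fin d) (Fin d) ℝ)
    (E : Set (Matrix (Fin d) (Fin N) ℝ)) (ν : Measure (Matrix (Fin d) (Fin N) ℝ)) : Prop where
  law : IsWeightLaw B p
  fullRank : X.rank = d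
  weights : IsIIDWeights p P W
  states : E ⊆ normalized d N
  uniqueInvariant : IsUniqueInvariantOn E γ p ν
  stays : ∀ᵐ ω ∂P, StaysIn E (hidden γ X fun l => W l ω)

end BNNet

end

/-! Write M = M(H), q = E_ν‖M‖_F², S = E_ν Σ_i ((M²)_ii)² and T = E_ν Tr M³, so that α = S/T. On
row-normalized states Tr M = d and r(H) = d²/‖M‖_F². The claim splits into the existence of the
limits and a moment estimate under ν.

Limits. For small γ the chain is Feller on the compact set of row-normalized states. Its innovations
obey an L² law of large numbers, so every weak limit of the empirical measures of a trajectory is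
invariant; the assumption on the long run makes it carried by E. Uniqueness then gives convergence
of averages of continuous functions of M (`IsSetting.ae_tendsto_average`), in particular of r. The
soft rank is discontinuous, but it is squeezed between traces of polynomials in M. The squeeze is
tight because ν-almost no M has a given eigenvalue τ > 0: this event is the vanishing of a nonzero
polynomial in weights without atoms (`IsSetting.ae_det_sub_ne_zero`). Pointwise, soft rank ≥ (1-τ)²
r by Cauchy–Schwarz on the eigenvalues ≥ τ.

Moments. Expanding one layer to second order in γ, the drift of ‖M‖_F² is γ²(8(Σ_i ((M²)_ii)² - Tr
M³) + 2d² - 2‖M‖_F²) + O(γ³). Stationarity gives 8(T - S) = 2d² - 2q + O(γ), hence T - S ≤ d². With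
q² ≤ dT this yields (1-α)q² ≤ d³, and Jensen's inequality gives E_ν r ≥ d²/q ≥ √((1-α)d).

For α < 1, q has to stay below d². The drift of log det M is at least γ²(2‖M‖_F² - d² - d) - O(γ³),
while log det M is finite along the trajectory of a full-rank input and bounded above. Averaging
along the trajectory gives 2q ≤ d² + d + O(γ), and d² + d < 2d² for d ≥ 2. These two drifts are
`IsSetting.abs_stationarity_le` and `IsSetting.integral_frobSq_le`; they are combined in
`IsSetting.regularity_bounds`. -/

noncomputable section

namespace BNNet

/-! ### Law of large numbers for the innovations of a Markov chain. -/

/-- A bounded sequence whose partial sums along the squares are `o(m²)` has partial sums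
`o(n)`. -/
lemma tendsto_average_of_squares {x : ℕ → ℝ} {C : ℝ} (hC : ∀ n, |x n| ≤ C)
    (hsq : Tendsto (fun m : ℕ => (∑ l ∈ Finset.range (m ^ 2), x l) / (m : ℝ) ^ 2) atTop (𝓝 0)) :
    Tendsto (fun n : ℕ => (1 / (n : ℝ)) * ∑ l ∈ Finset.range n, x l) atTop (𝓝 0) := by
  have hC0 : 0 ≤ C := (abs_nonneg _).trans (hC 0)
  have hsqrt : Tendsto Nat.sqrt atTop atTop := by
    refine tendsto_atTop.2 fun b => ?_
    filter_upwards [eventually_ge_atTop (b * b)] with n hn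
    exact Nat.le_sqrt.2 hn
  have h1 := (hsq.comp hsqrt).abs
  have h2 : Tendsto (fun n : ℕ => 3 * C / (Nat.sqrt n : ℝ)) atTop (𝓝 0) :=
    Tendsto.div_atTop tendsto_const_nhds (tendsto_natCast_atTop_atTop.comp hsqrt)
  have h3 := h1.add h2
  simp only [abs_zero, add_zero] at h3
  refine squeeze_zero_norm' ?_ h3
  filter_upwards [eventually_ge_atTop 1] with n hn
  -- Between m² and n there are at most 2m terms, contributing at most 2mC, that is 2C/m after
  -- division by n ≥ m².
  set m := Nat.sqrt n with hm
  have hm1 : 1 ≤ m := Nat.le_sqrt.2 (by simpa using hn)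
  have hmn : m ^ 2 ≤ n := by rw [pow_two]; exact Nat.sqrt_le n
  have hnm : n ≤ m ^ 2 + 2 * m := by
    have := Nat.sqrt_le_add n
    rw [← hm] at this
    nlinarith
  have hm0 : (0 : ℝ) < m := by exact_mod_cast hm1
  have hn0 : (0 : ℝ) < n := by exact_mod_cast hn
  have hmnR : (m : ℝ) ^ 2 ≤ n := by exact_mod_cast hmn
  have hsplit : ∑ l ∈ Finset.range n, x l
      = ∑ l ∈ Finset.range (m ^ 2), x l + ∑ l ∈ Finset.Ico (m ^ 2) n, x l :=
    (Finset.sum_range_add_sum_Ico _ hmn).symm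
  have hgap : |∑ l ∈ Finset.Ico (m ^ 2) n, x l| ≤ 2 * m * C := by
    refine (Finset.abs_sum_le_sum_abs _ _).trans ((Finset.sum_le_sum fun l _ => hC l).trans ?_)
    rw [Finset.sum_const, Nat.card_Ico, nsmul_eq_mul]
    gcongr
    have : n - m ^ 2 ≤ 2 * m := by omega
    exact_mod_cast this
  simp only [Function.comp, Real.norm_eq_abs]
  rw [hsplit, abs_mul, abs_of_pos (by positivity : (0 : ℝ) < 1 / n), abs_div,
    abs_of_pos (by positivity : (0 : ℝ) < (m : ℝ) ^ 2)]
  have hS := abs_add_le (∑ l ∈ Finset.range (m ^ 2), x l) (∑ l ∈ Finset.Ico (m ^ 2) n, x l)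
  calc 1 / (n : ℝ) * |∑ l ∈ Finset.range (m ^ 2), x l + ∑ l ∈ Finset.Ico (m ^ 2) n, x l|
      ≤ 1 / (m : ℝ) ^ 2 * (|∑ l ∈ Finset.range (m ^ 2), x l| + 2 * m * C) := by
        gcongr
        exact hS.trans (by gcongr)
    _ = |∑ l ∈ Finset.range (m ^ 2), x l| / (m : ℝ) ^ 2 + 2 * C / m := by
        field_simp
    _ ≤ _ := by gcongr; norm_num

section LLN

variable {Ω S V : Type*} [MeasurableSpace Ω] [MeasurableSpace S] [MeasurableSpace V]
  {P : Measure Ω} {μ : Measure V}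

/-- If the mean squares of the averages of `x` are summable along a sequence of times, the averages
tend to zero almost surely along it. -/
lemma ae_tendsto_zero_of_summable_integral_sq {f : ℕ → Ω → ℝ} {c : ℕ → ℝ}
    (hf : ∀ n, Measurable (f n)) (hint : ∀ n, Integrable (fun ω => f n ω ^ 2) P)
    (hle : ∀ n, ∫ ω, f n ω ^ 2 ∂P ≤ c n) (hc : Summable c) :
    ∀ᵐ ω ∂P, Tendsto (fun n => f n ω) atTop (𝓝 0) := by
  have h0 : ∀ n, 0 ≤ c n := fun n => (integral_nonneg fun ω => sq_nonneg _).trans (hle n)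
  have hfin : ∫⁻ ω, ∑' n, ENNReal.ofReal (f n ω ^ 2) ∂P ≠ ⊤ := by
    rw [lintegral_tsum fun n => ((hf n).pow_const 2).ennreal_ofReal.aemeasurable]
    have : ∀ n, ∫⁻ ω, ENNReal.ofReal (f n ω ^ 2) ∂P ≤ ENNReal.ofReal (c n) := fun n => by
      rw [← ofReal_integral_eq_lintegral_ofReal (hint n) (Eventually.of_forall fun _ => sq_nonneg _)]
      exact ENNReal.ofReal_le_ofReal (hle n)
    refine ne_top_of_le_ne_top ?_ (ENNReal.tsum_le_tsum this)
    rw [← ENNReal.ofReal_tsum_of_nonneg h0 hc]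
    exact ENNReal.ofReal_ne_top
  have hm : Measurable fun ω => ∑' n, ENNReal.ofReal (f n ω ^ 2) :=
    Measurable.tsum fun n => ((hf n).pow_const 2).ennreal_ofReal
  filter_upwards [ae_lt_top hm hfin] with ω hω
  have h1 := ENNReal.tendsto_atTop_zero_of_tsum_ne_top hω.ne
  have h2 : Tendsto (fun n => f n ω ^ 2) atTop (𝓝 0) := by
    have := (ENNReal.tendsto_toReal ENNReal.zero_ne_top).comp h1
    refine (this.congr fun n => ?_)
    simp [ENNReal.toReal_ofReal (sq_nonneg (f n ω))]
  have h3 := h2.sqrt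
  simp only [Real.sqrt_sq_eq_abs, Real.sqrt_zero] at h3
  exact (tendsto_zero_iff_abs_tendsto_zero _).2 h3

/-- Law of large numbers for the fluctuations of a bounded function of a Markov chain and of its
independent innovations. -/
lemma ae_tendsto_average_sub_integral [IsProbabilityMeasure P] [IsProbabilityMeasure μ]
    {h : ℕ → Ω → S} {w : ℕ → Ω → V}
    (hh : ∀ l, Measurable (h l)) (hw : ∀ l, Measurable (w l))
    (hlaw : ∀ l, P.map (w l) = μ)
    (hind : ∀ k l, k < l → IndepFun (fun ω => ((h k ω, w k ω), h l ω)) (w l) P)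
    {φ : S × V → ℝ} (hφ : Measurable φ) {C : ℝ} (hC : ∀ q, |φ q| ≤ C) :
    ∀ᵐ ω ∂P, Tendsto (fun L : ℕ => (1 / (L : ℝ)) * ∑ l ∈ Finset.range L,
      (φ (h l ω, w l ω) - ∫ v, φ (h l ω, v) ∂μ)) atTop (𝓝 0) := by
  set D : ℕ → Ω → ℝ := fun l ω => φ (h l ω, w l ω) - ∫ v, φ (h l ω, v) ∂μ with hD
  have hΦ : Measurable fun s => ∫ v, φ (s, v) ∂μ :=
    (StronglyMeasurable.integral_prod_right (f := fun s v => φ (s, v)) (ν := μ)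
      hφ.stronglyMeasurable).measurable
  have hΦC : ∀ s, |∫ v, φ (s, v) ∂μ| ≤ C := fun s => by
    have := norm_integral_le_of_norm_le_const (μ := μ) (f := fun v => φ (s, v)) (C := C)
      (Eventually.of_forall fun v => hC (s, v))
    simpa using this
  have hDm : ∀ l, Measurable (D l) := fun l =>
    (hφ.comp ((hh l).prodMk (hw l))).sub (hΦ.comp (hh l))
  have hDC : ∀ l ω, |D l ω| ≤ 2 * C := fun l ω => by
    refine (abs_sub _ _).trans ?_
    linarith [hC (h l ω, w l ω), hΦC (h l ω)]
  have hC0 : 0 ≤ C := by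
    obtain ⟨ω⟩ := nonempty_of_isProbabilityMeasure P
    exact (abs_nonneg _).trans (hC (h 0 ω, w 0 ω))
  have hbdd : ∀ {f : Ω → ℝ} {c : ℝ}, Measurable f → (∀ ω, |f ω| ≤ c) → Integrable f P :=
    fun hf hc => Integrable.of_bound hf.aestronglyMeasurable _ (Eventually.of_forall hc)
  -- Given the past and `h l`, the increment `D l` has mean zero over the independent `w l`, while
  -- `D k` is a function of the past.
  have horth : ∀ k l, k < l → ∫ ω, D k ω * D l ω ∂P = 0 := by
    intro k l hkl
    let F : ((S × V) × S) × V → ℝ := fun q =>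
      (φ q.1.1 - ∫ v, φ (q.1.1.1, v) ∂μ) * (φ (q.1.2, q.2) - ∫ v, φ (q.1.2, v) ∂μ)
    have hF : Measurable F := by
      refine ((hφ.comp (by fun_prop)).sub (hΦ.comp (by fun_prop))).mul
        ((hφ.comp (by fun_prop)).sub (hΦ.comp (by fun_prop)))
    have hpast : Measurable fun ω => ((h k ω, w k ω), h l ω) :=
      ((hh k).prodMk (hw k)).prodMk (hh l)
    have hmap := (indepFun_iff_map_prod_eq_prod_map_map hpast.aemeasurable
      (hw l).aemeasurable).1 (hind k l hkl)
    have : IsProbabilityMeasure (P.map fun ω => ((h k ω, w k ω), h l ω)) :=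
      Measure.isProbabilityMeasure_map hpast.aemeasurable
    have h1 : ∫ ω, D k ω * D l ω ∂P
        = ∫ q, F q ∂(P.map fun ω => (((h k ω, w k ω), h l ω), w l ω)) := by
      rw [integral_map (hpast.prodMk (hw l)).aemeasurable hF.aestronglyMeasurable]
    rw [h1, hmap, hlaw, integral_prod]
    · refine integral_eq_zero_of_ae (Eventually.of_forall fun q => ?_)
      simp only [F, Pi.zero_apply]
      rw [integral_const_mul, integral_sub, integral_const]
      · simp
      · exact Integrable.of_bound (hφ.comp (by fun_prop)).aestronglyMeasurable C
          (Eventually.of_forall fun v => hC _)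
      · exact integrable_const _
    · refine Integrable.of_bound hF.aestronglyMeasurable ((2 * C) * (2 * C))
        (Eventually.of_forall fun q => ?_)
      simp only [F, norm_mul, Real.norm_eq_abs]
      gcongr
      · refine (abs_sub _ _).trans ?_
        linarith [hC q.1.1, hΦC q.1.1.1]
      · refine (abs_sub _ _).trans ?_
        linarith [hC (q.1.2, q.2), hΦC q.1.2]
  have hDD : ∀ k l, Integrable (fun ω => D k ω * D l ω) P := fun k l =>
    hbdd ((hDm k).mul (hDm l)) (c := (2 * C) * (2 * C)) fun ω => by
      rw [abs_mul]; exact mul_le_mul (hDC k ω) (hDC l ω) (abs_nonneg _) (by positivity)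
  -- Orthogonality makes the second moment of the partial sums grow only linearly.
  have hsum : ∀ n, Integrable (fun ω => (∑ l ∈ Finset.range n, D l ω) ^ 2) P ∧
      ∫ ω, (∑ l ∈ Finset.range n, D l ω) ^ 2 ∂P ≤ (2 * C) * (2 * C) * n := by
    intro n
    induction n with
    | zero => simp
    | succ n ih =>
      have hcross : Integrable (fun ω => 2 * ∑ k ∈ Finset.range n, D k ω * D n ω) P :=
        (integrable_finsetSum _ fun k _ => hDD k n).const_mul 2
      have hexp : (fun ω => (∑ l ∈ Finset.range (n + 1), D l ω) ^ 2) = fun ω =>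
          (∑ l ∈ Finset.range n, D l ω) ^ 2 + 2 * ∑ k ∈ Finset.range n, D k ω * D n ω
            + D n ω * D n ω := by
        funext ω
        rw [Finset.sum_range_succ, ← Finset.sum_mul]
        ring
      rw [hexp]
      refine ⟨(ih.1.add hcross).add (hDD n n), ?_⟩
      rw [integral_add (by exact ih.1.add hcross) (hDD n n), integral_add ih.1 hcross,
        integral_const_mul,
        integral_finsetSum _ fun k _ => hDD k n,
        Finset.sum_eq_zero fun k hk => horth k n (Finset.mem_range.1 hk)]
      have hlast : ∫ ω, D n ω * D n ω ∂P ≤ (2 * C) * (2 * C) := by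
        have : ∫ ω, D n ω * D n ω ∂P ≤ ∫ ω, (2 * C) * (2 * C) ∂P :=
          integral_mono (hDD n n) (integrable_const _) fun ω => by
            have := mul_le_mul (hDC n ω) (hDC n ω) (abs_nonneg _) (by positivity)
            rwa [← abs_mul, abs_mul_self] at this
        simpa using this
      push_cast
      linarith [ih.2]
  -- At time m² the mean square of the average is O(1/m²), which is summable; this is why squares
  -- are used.
  have hkey : ∀ᵐ ω ∂P, Tendsto
      (fun m : ℕ => (∑ l ∈ Finset.range (m ^ 2), D l ω) / (m : ℝ) ^ 2) atTop (𝓝 0) := by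
    refine ae_tendsto_zero_of_summable_integral_sq
      (c := fun m => (2 * C) * (2 * C) * (1 / (m : ℝ) ^ 2))
      (fun m => ?_) (fun m => ?_) (fun m => ?_) ?_
    · exact (Finset.measurable_sum _ fun l _ => hDm l).div_const _
    · simp only [div_pow]
      exact (hsum _).1.div_const _
    · simp only [div_pow]
      rw [integral_div]
      rcases Nat.eq_zero_or_pos m with rfl | hm
      · simp
      have hm0 : (0 : ℝ) < m := by exact_mod_cast hm
      rw [div_le_iff₀ (by positivity)]
      refine (hsum (m ^ 2)).2.trans (le_of_eq ?_)
      push_cast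
      field_simp
    · exact (Real.summable_one_div_nat_pow.2 one_lt_two).mul_left _
  filter_upwards [hkey] with ω hω
  exact tendsto_average_of_squares (fun l => hDC l ω) hω

end LLN

/-! ### Weak limits of empirical measures of a Feller chain. -/

section Ergodic

variable {Ω S V : Type*} [MeasurableSpace Ω] [MeasurableSpace V]
  [TopologicalSpace S] [CompactSpace S] [T2Space S] [SecondCountableTopology S]
  [MeasurableSpace S] [BorelSpace S]
  {P : Measure Ω} {μ : Measure V} [IsProbabilityMeasure μ]

/-- The averages of a sequence of states do not distinguish a continuous observable from its image
under the transition operator of the random map `T`. -/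
def IsAsymptoticallyInvariant (μ : Measure V) (T : S → V → S) (x : ℕ → S) : Prop :=
  ∀ f : C(S, ℝ), Tendsto (fun L : ℕ => (1 / (L : ℝ)) * ∑ l ∈ Finset.range L,
    (f (x l) - ∫ v, f (T (x l) v) ∂μ)) atTop (𝓝 0)

lemma tendsto_average_shift_sub {a : ℕ → ℝ} {C : ℝ} (hC : ∀ n, |a n| ≤ C) :
    Tendsto (fun L : ℕ => (1 / (L : ℝ)) * ∑ l ∈ Finset.range L, (a (l + 1) - a l))
      atTop (𝓝 0) := by
  have h : Tendsto (fun L : ℕ => 2 * C / (L : ℝ)) atTop (𝓝 0) :=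
    Tendsto.div_atTop tendsto_const_nhds tendsto_natCast_atTop_atTop
  refine squeeze_zero_norm (fun L => ?_) h
  rw [Finset.sum_range_sub, norm_mul, Real.norm_eq_abs, Real.norm_eq_abs, abs_of_nonneg (by positivity),
    div_mul_eq_mul_div, one_mul]
  gcongr
  refine (abs_sub _ _).trans ?_
  linarith [hC L, hC 0]

lemma abs_average_le {a : ℕ → ℝ} {C : ℝ} (hC : ∀ n, |a n| ≤ C) (L : ℕ) :
    |(1 / (L : ℝ)) * ∑ l ∈ Finset.range L, a l| ≤ C := by
  have hC0 : 0 ≤ C := (abs_nonneg _).trans (hC 0)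
  rcases Nat.eq_zero_or_pos L with rfl | hL
  · simpa using hC0
  have hL0 : (0 : ℝ) < L := by exact_mod_cast hL
  rw [abs_mul, abs_of_nonneg (by positivity), div_mul_eq_mul_div, one_mul, div_le_iff₀ hL0]
  refine (Finset.abs_sum_le_sum_abs _ _).trans ((Finset.sum_le_sum fun l _ => hC l).trans ?_)
  simp [mul_comm]

/-- The trajectories of a Markov chain on a compact space are almost surely asymptotically
invariant. -/
theorem ae_isAsymptoticallyInvariant [IsProbabilityMeasure P] {h : ℕ → Ω → S} {w : ℕ → Ω → V}
    (hh : ∀ l, Measurable (h l)) (hw : ∀ l, Measurable (w l))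
    (hlaw : ∀ l, P.map (w l) = μ)
    (hind : ∀ k l, k < l → IndepFun (fun ω => ((h k ω, w k ω), h l ω)) (w l) P)
    {T : S → V → S} (hT : Measurable (Function.uncurry T))
    (hstep : ∀ᵐ ω ∂P, ∀ l, h (l + 1) ω = T (h l ω) (w l ω)) :
    ∀ᵐ ω ∂P, IsAsymptoticallyInvariant μ T fun l => h l ω := by
  -- A countable dense family of observables allows a single exceptional null set.
  have hdense : ∀ᵐ ω ∂P, ∀ n : ℕ, Tendsto (fun L : ℕ => (1 / (L : ℝ)) * ∑ l ∈ Finset.range L,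
      (TopologicalSpace.denseSeq C(S, ℝ) n (h l ω)
        - ∫ v, TopologicalSpace.denseSeq C(S, ℝ) n (T (h l ω) v) ∂μ)) atTop (𝓝 0) := by
    rw [ae_all_iff]
    intro n
    set f := TopologicalSpace.denseSeq C(S, ℝ) n
    have h1 := ae_tendsto_average_sub_integral (P := P) hh hw hlaw hind
      (φ := fun q => f (T q.1 q.2)) (f.continuous.measurable.comp hT) (C := ‖f‖)
      (fun q => f.norm_coe_le_norm _)
    filter_upwards [h1, hstep] with ω hω hs
    have h2 := tendsto_average_shift_sub (a := fun l => f (h l ω)) (C := ‖f‖)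
      (fun l => f.norm_coe_le_norm _)
    -- With Pf(s) = ∫ f(T(s,v)) dμ(v): f(h_l) - Pf(h_l) is the innovation f(h_{l+1}) - Pf(h_l) minus
    -- the telescoping difference f(h_{l+1}) - f(h_l).
    have h3 := hω.sub h2
    rw [sub_zero] at h3
    refine h3.congr fun L => ?_
    rw [← mul_sub, ← Finset.sum_sub_distrib]
    congr 1
    refine Finset.sum_congr rfl fun l _ => ?_
    rw [hs l]
    ring
  filter_upwards [hdense] with ω hω f
  rw [Metric.tendsto_atTop]
  intro ε hε
  obtain ⟨n, hn⟩ : ∃ n, dist f (TopologicalSpace.denseSeq C(S, ℝ) n) < ε / 4 := by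
    have := (TopologicalSpace.denseRange_denseSeq C(S, ℝ)).exists_dist_lt f
      (by positivity : (0 : ℝ) < ε / 4)
    exact this
  set g := TopologicalSpace.denseSeq C(S, ℝ) n
  obtain ⟨L₀, hL₀⟩ := Metric.tendsto_atTop.1 (hω n) (ε / 4) (by positivity)
  have hfg : ∀ s, |f s - g s| ≤ ε / 4 := fun s =>
    (ContinuousMap.dist_apply_le_dist s).trans hn.le
  have hint : ∀ (k : C(S, ℝ)) s, Integrable (fun v => k (T s v)) μ := fun k s =>
    Integrable.of_bound (k.continuous.measurable.comp
      (hT.comp measurable_prodMk_left)).aestronglyMeasurable ‖k‖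
      (Eventually.of_forall fun v => k.norm_coe_le_norm _)
  have hPfg : ∀ s, |∫ v, f (T s v) ∂μ - ∫ v, g (T s v) ∂μ| ≤ ε / 4 := fun s => by
    rw [← integral_sub (hint f s) (hint g s)]
    have := norm_integral_le_of_norm_le_const (μ := μ) (f := fun v => f (T s v) - g (T s v))
      (C := ε / 4) (Eventually.of_forall fun v => hfg _)
    simpa using this
  refine ⟨L₀, fun L hL => ?_⟩
  have h1 := hL₀ L hL
  rw [Real.dist_eq, sub_zero] at h1 ⊢
  -- Replacing f by g costs ε/4 in the function and ε/4 in its image under the transition operator.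
  have h2 := abs_average_le (C := ε / 2) (a := fun l => (f (h l ω) - ∫ v, f (T (h l ω) v) ∂μ)
    - (g (h l ω) - ∫ v, g (T (h l ω) v) ∂μ)) (fun l => by
      have e1 := abs_le.1 (hfg (h l ω))
      have e2 := abs_le.1 (hPfg (h l ω))
      rw [abs_le]
      constructor <;> linarith) L
  rw [Finset.sum_sub_distrib, mul_sub] at h2
  have e1 := abs_lt.1 h1
  have e2 := abs_le.1 h2
  rw [abs_lt]
  constructor <;> linarith

/-- The empirical measure of the first `L + 1` states of a sequence. -/
def empirical (x : ℕ → S) (L : ℕ) : Measure S :=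
  ((L + 1 : ℕ) : ENNReal)⁻¹ • ∑ l ∈ Finset.range (L + 1), Measure.dirac (x l)

omit [TopologicalSpace S] [CompactSpace S] [T2Space S] [SecondCountableTopology S]
  [BorelSpace S] in
lemma isProbabilityMeasure_empirical (x : ℕ → S) (L : ℕ) :
    IsProbabilityMeasure (empirical x L) := by
  constructor
  simp only [empirical, Measure.smul_apply, Measure.finsetSum_apply, measure_univ,
    Finset.sum_const, Finset.card_range, smul_eq_mul, nsmul_eq_mul, mul_one]
  exact ENNReal.inv_mul_cancel (by simp) (ENNReal.natCast_ne_top _)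

lemma integral_empirical (x : ℕ → S) (L : ℕ) (f : C(S, ℝ)) :
    ∫ s, f s ∂(empirical x L) = (1 / ((L + 1 : ℕ) : ℝ)) * ∑ l ∈ Finset.range (L + 1), f (x l) := by
  rw [empirical, integral_smul_measure, integral_finsetSum_measure]
  · rw [ENNReal.toReal_inv, ENNReal.toReal_natCast]
    simp [integral_dirac]
  · intro l _
    exact Integrable.of_bound f.continuous.measurable.aestronglyMeasurable ‖f‖
      (Eventually.of_forall fun v => f.norm_coe_le_norm _)

open Classical in
omit [TopologicalSpace S] [CompactSpace S] [T2Space S] [SecondCountableTopology S]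
  [BorelSpace S] in
lemma empirical_apply (x : ℕ → S) (L : ℕ) {K : Set S} (hK : MeasurableSet K) :
    empirical x L K = ((L + 1 : ℕ) : ENNReal)⁻¹ *
      (((Finset.range (L + 1)).filter fun l => x l ∈ K).card : ENNReal) := by
  simp only [empirical, Measure.smul_apply, Measure.finsetSum_apply, smul_eq_mul]
  congr 1
  simp [Measure.dirac_apply' _ hK, Set.indicator_apply]

open Classical in
/-- If all the invariant distributions of a Feller chain that are carried by `E` give the same
integral to a continuous function, then this is the limit of the averages of the function along any
asymptotically invariant sequence of states that loses no mass from `E`. -/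
theorem tendsto_average_of_unique {T : S → V → S} (hT : Measurable (Function.uncurry T))
    (hcont : ∀ᵐ v ∂μ, Continuous fun s => T s v) {x : ℕ → S}
    (hx : IsAsymptoticallyInvariant μ T x) {E : Set S}
    (hE : ∀ ε : ℝ, 0 < ε → ∃ K : Set S, IsClosed K ∧ K ⊆ E ∧ ∀ᶠ L : ℕ in atTop,
      (1 - ε) * (L : ℝ) ≤ (((Finset.range L).filter fun l => x l ∈ K).card : ℝ))
    (F : C(S, ℝ)) {c : ℝ}
    (hF : ∀ ν : Measure S, IsProbabilityMeasure ν → (ν.prod μ).map (Function.uncurry T) = ν →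
      (∀ᵐ s ∂ν, s ∈ E) → ∫ s, F s ∂ν = c) :
    Tendsto (fun L : ℕ => (1 / (L : ℝ)) * ∑ l ∈ Finset.range L, F (x l)) atTop (𝓝 c) := by
  -- The shift matches `empirical x L`, which uses L + 1 states and so never divides by zero.
  -- Probability measures on a compact space are compact, so every ultrafilter yields a limit
  -- measure, and it suffices that it integrates `F` to `c`.
  rw [← tendsto_add_atTop_iff_nat 1, tendsto_iff_ultrafilter]
  intro U hU
  let m : ℕ → ProbabilityMeasure S := fun L =>
    ⟨empirical x L, isProbabilityMeasure_empirical x L⟩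
  obtain ⟨ν, -, hν⟩ := isCompact_univ.ultrafilter_le_nhds' (U.map m) univ_mem
  have hν' : Tendsto m U (𝓝 ν) := hν
  have hlim := ProbabilityMeasure.tendsto_iff_forall_integral_tendsto.1 hν'
  have hlim' : ∀ f : C(S, ℝ), Tendsto (fun L : ℕ => (1 / ((L + 1 : ℕ) : ℝ)) *
      ∑ l ∈ Finset.range (L + 1), f (x l)) U (𝓝 (∫ s, f s ∂(ν : Measure S))) := fun f => by
    refine (hlim (BoundedContinuousFunction.mkOfCompact f)).congr fun L => ?_
    exact integral_empirical x L f
  have hTint : ∀ (k : C(S, ℝ)) s, Integrable (fun v => k (T s v)) μ := fun k s =>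
    Integrable.of_bound (k.continuous.measurable.comp
      (hT.comp measurable_prodMk_left)).aestronglyMeasurable ‖k‖
      (Eventually.of_forall fun v => k.norm_coe_le_norm _)
  have hprob : IsProbabilityMeasure (((ν : Measure S).prod μ).map (Function.uncurry T)) :=
    Measure.isProbabilityMeasure_map hT.aemeasurable
  -- The Feller property makes s ↦ ∫ f(T(s,v)) dμ(v) continuous, so asymptotic invariance passes to
  -- the weak limit.
  have hinv : ((ν : Measure S).prod μ).map (Function.uncurry T) = ν := by
    refine ext_of_forall_integral_eq_of_IsFiniteMeasure fun f => ?_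
    have hPf : Continuous fun s => ∫ v, f (T s v) ∂μ := by
      refine continuous_of_dominated (bound := fun _ => ‖f‖) (fun s => ?_) (fun s => ?_)
        (integrable_const _) ?_
      · exact (f.continuous.measurable.comp (hT.comp measurable_prodMk_left)).aestronglyMeasurable
      · exact Eventually.of_forall fun v => f.norm_coe_le_norm _
      · filter_upwards [hcont] with v hv
        exact f.continuous.comp hv
    have h1 := hlim' f.toContinuousMap
    have h2 := hlim' ⟨_, hPf⟩
    have h3 : Tendsto (fun L : ℕ => (1 / ((L + 1 : ℕ) : ℝ)) * ∑ l ∈ Finset.range (L + 1),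
        (f (x l) - ∫ v, f (T (x l) v) ∂μ)) U (𝓝 0) :=
      (((tendsto_add_atTop_iff_nat 1).2 (hx f.toContinuousMap)).mono_left hU)
    have h4 := tendsto_nhds_unique (h1.sub h2) (h3.congr fun L => by
      rw [Finset.sum_sub_distrib, mul_sub]; rfl)
    rw [integral_map hT.aemeasurable f.continuous.measurable.aestronglyMeasurable, integral_prod]
    · simp only [Function.uncurry]
      simp only [ContinuousMap.coe_mk] at h4
      exact (sub_eq_zero.1 h4).symm
    · exact Integrable.of_bound (f.continuous.measurable.comp hT).aestronglyMeasurable ‖f‖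
        (Eventually.of_forall fun v => f.norm_coe_le_norm _)
  -- The portmanteau inequality for the closed set K gives the limit mass at least 1 - ε on K ⊆ E,
  -- for each ε = 1/(n+1).
  have hcarried : ∀ᵐ s ∂(ν : Measure S), s ∈ E := by
    have hle : ∀ n : ℕ, (ν : Measure S) Eᶜ ≤ ENNReal.ofReal (1 / ((n : ℝ) + 1)) := by
      intro n
      set ε : ℝ := 1 / ((n : ℝ) + 1) with hε
      have hε0 : 0 < ε := by positivity
      obtain ⟨K, hKc, hKE, hK⟩ := hE ε hε0
      have hev : ∀ᶠ L in (U : Filter ℕ), ENNReal.ofReal (1 - ε) ≤ (m L : Measure S) K := by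
        have := ((tendsto_add_atTop_nat 1).eventually hK).filter_mono hU
        filter_upwards [this] with L hL
        change _ ≤ empirical x L K
        rw [empirical_apply x L hKc.measurableSet, mul_comm, ← div_eq_mul_inv,
          ENNReal.le_div_iff_mul_le (Or.inl (by simp)) (Or.inl (ENNReal.natCast_ne_top _))]
        rw [← ENNReal.ofReal_natCast, ← ENNReal.ofReal_mul' (by positivity),
          ← ENNReal.ofReal_natCast]
        exact ENNReal.ofReal_le_ofReal hL
      have h1 := ProbabilityMeasure.limsup_measure_closed_le_of_tendsto hν' hKc
      have h2 : ENNReal.ofReal (1 - ε) ≤ (ν : Measure S) K :=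
        (le_limsup_of_frequently_le hev.frequently).trans h1
      calc (ν : Measure S) Eᶜ ≤ (ν : Measure S) Kᶜ := measure_mono (Set.compl_subset_compl.2 hKE)
        _ = 1 - (ν : Measure S) K := prob_compl_eq_one_sub hKc.measurableSet
        _ ≤ 1 - ENNReal.ofReal (1 - ε) := tsub_le_tsub_left h2 _
        _ = ENNReal.ofReal ε := by
          have hε1 : ε ≤ 1 := by
            rw [hε, div_le_one (by positivity)]
            linarith [Nat.cast_nonneg (α := ℝ) n]
          rw [← ENNReal.ofReal_one, ← ENNReal.ofReal_sub _ (by linarith)]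
          congr 1
          ring
    have h0 : Tendsto (fun n : ℕ => ENNReal.ofReal (1 / ((n : ℝ) + 1))) atTop (𝓝 0) := by
      rw [← ENNReal.ofReal_zero]
      exact ENNReal.tendsto_ofReal tendsto_one_div_add_atTop_nhds_zero_nat
    exact le_antisymm (ge_of_tendsto' h0 hle) bot_le
  rw [← hF ν inferInstance hinv hcarried]
  exact hlim' F

end Ergodic

/-! ### Moments of the random weight matrix. -/

section Matrices

variable {d N : ℕ}

instance matrixBorelSpace : BorelSpace (Matrix (Fin d) (Fin N) ℝ) :=
  inferInstanceAs (BorelSpace (Fin d → Fin N → ℝ))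

instance matrixSecondCountableTopology : SecondCountableTopology (Matrix (Fin d) (Fin N) ℝ) :=
  inferInstanceAs (SecondCountableTopology (Fin d → Fin N → ℝ))

/-- The matrices with entries in `[-b, b]`. -/
def box (d N : ℕ) (b : ℝ) : Set (Matrix (Fin d) (Fin N) ℝ) := {W | ∀ i j, |W i j| ≤ b}

lemma isCompact_box (b : ℝ) : IsCompact (box d N b) := by
  have h : IsCompact (Set.pi Set.univ fun _ : Fin d => Set.pi Set.univ fun _ : Fin N =>
      Set.Icc (-b) b) :=
    isCompact_univ_pi fun _ => isCompact_univ_pi fun _ => isCompact_Icc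
  have e : (Set.pi Set.univ fun _ : Fin d => Set.pi Set.univ fun _ : Fin N =>
      Set.Icc (-b) b) = box d N b := by
    ext W
    simp only [box, abs_le, Set.mem_pi, Set.mem_univ, true_implies, Set.mem_Icc]
    rfl
  exact e ▸ h

section Law

variable {B : ℝ} {p : Measure ℝ}

lemma measurable_of_prod : Measurable fun w : Fin d × Fin N → ℝ => 
    (Matrix.of fun i j => w (i, j) : Matrix (Fin d) (Fin N) ℝ) :=
  measurable_pi_iff.2 fun _ => measurable_pi_iff.2 fun _ => measurable_pi_apply _

lemma IsWeightLaw.isProbabilityMeasure_weightMatrixLaw (hp : IsWeightLaw B p) :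
    IsProbabilityMeasure (weightMatrixLaw d p) := by
  have := hp.prob
  exact Measure.isProbabilityMeasure_map measurable_of_prod.aemeasurable

lemma IsWeightLaw.ae_mem_box (hp : IsWeightLaw B p) {b : ℝ} (hb : B ≤ b) :
    ∀ᵐ W ∂(weightMatrixLaw d p), W ∈ box d d b := by
  have := hp.prob
  refine (ae_map_iff measurable_of_prod.aemeasurable (isCompact_box b).measurableSet).2 ?_
  have h : ∀ᵐ w ∂(Measure.pi fun _ : Fin d × Fin d => p), ∀ q, w q ∈ Set.Icc (-B) B := by
    rw [ae_all_iff]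
    intro q
    exact (measurePreserving_eval (fun _ : Fin d × Fin d => p) q).quasiMeasurePreserving.ae
      hp.support
  filter_upwards [h] with w hw i j
  exact abs_le.2 ⟨(neg_le_neg hb).trans (hw (i, j)).1, (hw (i, j)).2.trans hb⟩

lemma IsWeightLaw.integrable_of_continuousOn (hp : IsWeightLaw B p) {b : ℝ} (hb : B ≤ b)
    {f : Matrix (Fin d) (Fin d) ℝ → ℝ} (hf : ContinuousOn f (box d d b)) :
    Integrable f (weightMatrixLaw d p) := by
  have := hp.isProbabilityMeasure_weightMatrixLaw (d := d)
  have h := hf.integrableOn_compact (μ := weightMatrixLaw d p) (isCompact_box b)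
  rwa [IntegrableOn, Measure.restrict_eq_self_of_ae_mem (hp.ae_mem_box hb)] at h

lemma IsWeightLaw.integrable_of_continuous (hp : IsWeightLaw B p)
    {f : Matrix (Fin d) (Fin d) ℝ → ℝ} (hf : Continuous f) :
    Integrable f (weightMatrixLaw d p) :=
  hp.integrable_of_continuousOn le_rfl hf.continuousOn

/-- The entries at distinct positions are independent. -/
lemma IsWeightLaw.integral_prod_entries (hp : IsWeightLaw B p) (s : Finset (Fin d × Fin d))
    (f : Fin d × Fin d → ℝ → ℝ) (hf : ∀ q, Continuous (f q)) :
    ∫ W, ∏ q ∈ s, f q (W q.1 q.2) ∂(weightMatrixLaw d p) = ∏ q ∈ s, ∫ x, f q x ∂p := by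
  have := hp.prob
  rw [weightMatrixLaw, integral_map measurable_of_prod.aemeasurable]
  · have h := integral_fintype_prod_eq_prod (𝕜 := ℝ) (μ := fun _ : Fin d × Fin d => p)
      (fun q x => if q ∈ s then f q x else 1)
    simp only [Finset.prod_ite_mem, Finset.univ_inter] at h
    simp only [Matrix.of_apply, Prod.mk.eta]
    rw [h, ← Finset.prod_subset (Finset.subset_univ s) fun q _ hq => by simp [hq]]
    exact Finset.prod_congr rfl fun q hq => by simp [hq]
  · refine Continuous.aestronglyMeasurable ?_
    exact continuous_finsetProd _ fun q _ => (hf q).comp (continuous_apply_apply q.1 q.2)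

lemma IsWeightLaw.integral_entry (hp : IsWeightLaw B p) (i j : Fin d) :
    ∫ W, W i j ∂(weightMatrixLaw d p) = 0 := by
  have := hp.integral_prod_entries {(i, j)} (fun _ x => x) (fun _ => continuous_id)
  simpa [hp.mean] using this

lemma IsWeightLaw.integral_entry_mul_entry (hp : IsWeightLaw B p) (i j k l : Fin d) :
    ∫ W, W i j * W k l ∂(weightMatrixLaw d p) = if i = k ∧ j = l then 1 else 0 := by
  split_ifs with h
  · obtain ⟨rfl, rfl⟩ := h
    have := hp.integral_prod_entries {(i, j)} (fun _ x => x ^ 2) (fun _ => by fun_prop)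
    simpa only [Finset.prod_singleton, hp.variance, ← pow_two] using this
  · have hne : (i, j) ≠ (k, l) := fun e => h (by simpa using e)
    have := hp.integral_prod_entries {(i, j), (k, l)} (fun _ x => x) (fun _ => continuous_id)
    simpa [Finset.prod_pair hne, hp.mean] using this

lemma IsWeightLaw.integral_mul_apply (hp : IsWeightLaw B p) (M : Matrix (Fin d) (Fin d) ℝ)
    (i j : Fin d) : ∫ W, (W * M) i j ∂(weightMatrixLaw d p) = 0 := by
  simp only [Matrix.mul_apply]
  rw [integral_finsetSum _ fun k _ => hp.integrable_of_continuous (by fun_prop)]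
  simp [integral_mul_const, hp.integral_entry]

lemma IsWeightLaw.integral_sum_sum (hp : IsWeightLaw B p) {ι κ : Type*} [Fintype ι] [Fintype κ]
    {f : ι → κ → Matrix (Fin d) (Fin d) ℝ → ℝ} (hf : ∀ a b, Continuous (f a b)) :
    ∫ W, ∑ a, ∑ b, f a b W ∂(weightMatrixLaw d p) = ∑ a, ∑ b, ∫ W, f a b W ∂(weightMatrixLaw d p) := by
  rw [integral_finsetSum _ fun a _ => hp.integrable_of_continuous
    (continuous_finsetSum _ fun b _ => hf a b)]
  exact Finset.sum_congr rfl fun a _ =>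
    integral_finsetSum _ fun b _ => hp.integrable_of_continuous (hf a b)

lemma IsWeightLaw.integral_mul_apply_mul (hp : IsWeightLaw B p) (M M' : Matrix (Fin d) (Fin d) ℝ)
    (i j k l : Fin d) : ∫ W, (W * M) i j * (W * M') k l ∂(weightMatrixLaw d p)
      = if i = k then (M.transpose * M') j l else 0 := by
  simp only [Matrix.mul_apply, Finset.sum_mul_sum]
  rw [hp.integral_sum_sum fun a b => by fun_prop]
  have h : ∀ a b, ∫ W, W i a * M a j * (W k b * M' b l) ∂(weightMatrixLaw d p)
      = if i = k ∧ a = b then M a j * M' b l else 0 := fun a b => by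
    have e : (fun W : Matrix (Fin d) (Fin d) ℝ => W i a * M a j * (W k b * M' b l))
        = fun W => W i a * W k b * (M a j * M' b l) := by funext W; ring
    rw [e, integral_mul_const, hp.integral_entry_mul_entry]
    split_ifs <;> simp
  simp_rw [h]
  by_cases hik : i = k <;> simp [hik]

/-- The entry is a sum of products of entries of WM and W = W·1, so the covariance formula applies
with `M'` the identity. -/
lemma IsWeightLaw.integral_conj_apply (hp : IsWeightLaw B p) (M : Matrix (Fin d) (Fin d) ℝ)
    (i j : Fin d) : ∫ W, (W * M * W.transpose) i j ∂(weightMatrixLaw d p)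
      = if i = j then M.trace else 0 := by
  have e : (fun W : Matrix (Fin d) (Fin d) ℝ => (W * M * W.transpose) i j)
      = fun W => ∑ k, (W * M) i k * (W * (1 : Matrix (Fin d) (Fin d) ℝ)) j k := by
    funext W
    rw [Matrix.mul_apply]
    simp
  rw [e, integral_finsetSum _ fun k _ => hp.integrable_of_continuous (by fun_prop)]
  simp_rw [hp.integral_mul_apply_mul]
  split_ifs <;> simp [Matrix.trace]

lemma IsWeightLaw.integral_trace_sq (hp : IsWeightLaw B p) :
    ∫ W, W.trace ^ 2 ∂(weightMatrixLaw d p) = d := by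
  simp only [Matrix.trace, Matrix.diag_apply, pow_two, Finset.sum_mul_sum]
  rw [hp.integral_sum_sum fun a b => by fun_prop]
  simp [hp.integral_entry_mul_entry]

/-- Each term of the Leibniz formula is a product over distinct entries, which are independent, so
the expectation of the determinant is the determinant of the expectation. -/
lemma IsWeightLaw.integral_det (hp : IsWeightLaw B p) (γ : ℝ) :
    ∫ W, (1 + γ • W).det ∂(weightMatrixLaw d p) = 1 := by
  have := hp.prob
  simp only [Matrix.det_apply']
  rw [integral_finsetSum _ fun σ _ => hp.integrable_of_continuous (by fun_prop)]
  have h : ∀ σ : Equiv.Perm (Fin d), ∫ W, (Equiv.Perm.sign σ : ℝ) *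
      ∏ i, (1 + γ • W : Matrix (Fin d) (Fin d) ℝ) (σ i) i ∂(weightMatrixLaw d p)
      = (Equiv.Perm.sign σ : ℝ) * ∏ i, (1 : Matrix (Fin d) (Fin d) ℝ) (σ i) i := fun σ => by
    rw [integral_const_mul]
    congr 1
    have hinj : Function.Injective fun i : Fin d => (σ i, i) := fun i j hij => (Prod.ext_iff.1 hij).2
    have := hp.integral_prod_entries (Finset.univ.map ⟨fun i : Fin d => (σ i, i), hinj⟩)
      (fun q x => (1 : Matrix (Fin d) (Fin d) ℝ) q.1 q.2 + γ * x) (fun _ => by fun_prop)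
    simp only [Finset.prod_map] at this
    refine Eq.trans ?_ (this.trans ?_)
    · simp only [Matrix.add_apply, Matrix.smul_apply, smul_eq_mul]
      rfl
    refine Finset.prod_congr rfl fun i _ => ?_
    change ∫ x, (1 : Matrix (Fin d) (Fin d) ℝ) (σ i) i + γ * x ∂p = _
    have hint : Integrable (fun x : ℝ => x) p := by
      refine Integrable.of_bound measurable_id.aestronglyMeasurable B ?_
      filter_upwards [hp.support] with x hx
      exact abs_le.2 hx
    rw [integral_add (integrable_const _) (hint.const_mul γ), integral_const_mul, hp.mean]
    simp
  rw [Finset.sum_congr rfl fun σ _ => h σ, ← Matrix.det_apply', Matrix.det_one]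

end Law

end Matrices

/-! ### Second-order Taylor expansions with explicit remainders. -/

section Expansion

/-- `f = f₀ + f₁ g + f₂ g² + O(g³)`, with the constant `κ` for the coefficients and the
remainder. -/
structure HasExpansion (g κ f f₀ f₁ f₂ : ℝ) : Prop where
  coeff_zero : |f₀| ≤ κ
  coeff_one : |f₁| ≤ κ
  coeff_two : |f₂| ≤ κ
  remainder : |f - (f₀ + f₁ * g + f₂ * g ^ 2)| ≤ κ * g ^ 3

/-- The factor 10 is 3 + 3 + 3 + 1: products of coefficients of total order at least 3, each
remainder against the other polynomial, and the product of the remainders. -/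
lemma HasExpansion.mul {g κ κ' f f₀ f₁ f₂ h h₀ h₁ h₂ : ℝ} (hg0 : 0 ≤ g) (hg1 : g ≤ 1)
    (hf : HasExpansion g κ f f₀ f₁ f₂) (hh : HasExpansion g κ' h h₀ h₁ h₂) :
    HasExpansion g (10 * (κ * κ')) (f * h) (f₀ * h₀) (f₀ * h₁ + f₁ * h₀)
      (f₀ * h₂ + f₁ * h₁ + f₂ * h₀) := by
  obtain ⟨a0, a1, a2, ar⟩ := hf
  obtain ⟨b0, b1, b2, br⟩ := hh
  have hκ : 0 ≤ κ := (abs_nonneg _).trans a0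
  have hκ' : 0 ≤ κ' := (abs_nonneg _).trans b0
  have hp : 0 ≤ κ * κ' := by positivity
  have mulb : ∀ {x y : ℝ}, |x| ≤ κ → |y| ≤ κ' → |x * y| ≤ κ * κ' := fun hx hy => by
    rw [abs_mul]; gcongr
  have hg2 : g ^ 2 ≤ 1 := pow_le_one₀ hg0 hg1
  have hg3 : g ^ 3 ≤ 1 := pow_le_one₀ hg0 hg1
  refine ⟨?_, ?_, ?_, ?_⟩
  · linarith [mulb a0 b0]
  · refine (abs_add_le _ _).trans ?_
    linarith [mulb a0 b1, mulb a1 b0]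
  · refine (abs_add_three _ _ _).trans ?_
    linarith [mulb a0 b2, mulb a1 b1, mulb a2 b0]
  set r := f - (f₀ + f₁ * g + f₂ * g ^ 2) with hr
  set s := h - (h₀ + h₁ * g + h₂ * g ^ 2) with hs
  have poly : ∀ {x y z k : ℝ}, |x| ≤ k → |y| ≤ k → |z| ≤ k → |x + y * g + z * g ^ 2| ≤ 3 * k := by
    intro x y z k hx hy hz
    have hk : 0 ≤ k := (abs_nonneg _).trans hx
    refine (abs_add_three _ _ _).trans ?_
    rw [abs_mul, abs_mul, abs_of_nonneg hg0, abs_of_nonneg (by positivity : 0 ≤ g ^ 2)]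
    have e1 := mul_le_mul hy hg1 hg0 hk
    have e2 := mul_le_mul hz hg2 (by positivity) hk
    linarith
  have e : f * h - (f₀ * h₀ + (f₀ * h₁ + f₁ * h₀) * g + (f₀ * h₂ + f₁ * h₁ + f₂ * h₀) * g ^ 2)
      = (f₁ * h₂ + f₂ * h₁ + f₂ * h₂ * g) * g ^ 3 + r * (h₀ + h₁ * g + h₂ * g ^ 2)
        + (f₀ + f₁ * g + f₂ * g ^ 2) * s + r * s := by
    rw [hr, hs]; ring
  rw [e]
  have t1 : |(f₁ * h₂ + f₂ * h₁ + f₂ * h₂ * g) * g ^ 3| ≤ 3 * (κ * κ') * g ^ 3 := by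
    rw [abs_mul, abs_of_nonneg (by positivity : 0 ≤ g ^ 3)]
    gcongr
    refine (abs_add_three _ _ _).trans ?_
    have := mul_le_mul (mulb a2 b2) hg1 hg0 hp
    rw [abs_mul (f₂ * h₂), abs_of_nonneg hg0]
    linarith [mulb a1 b2, mulb a2 b1]
  have t2 : |r * (h₀ + h₁ * g + h₂ * g ^ 2)| ≤ κ * g ^ 3 * (3 * κ') := by
    rw [abs_mul]
    exact mul_le_mul ar (poly b0 b1 b2) (abs_nonneg _) (by positivity)
  have t3 : |(f₀ + f₁ * g + f₂ * g ^ 2) * s| ≤ 3 * κ * (κ' * g ^ 3) := by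
    rw [abs_mul]
    exact mul_le_mul (poly a0 a1 a2) br (abs_nonneg _) (by positivity)
  have t4 : |r * s| ≤ κ * κ' * g ^ 3 := by
    rw [abs_mul]
    calc |r| * |s| ≤ (κ * g ^ 3) * (κ' * g ^ 3) :=
          mul_le_mul ar br (abs_nonneg _) (by positivity)
      _ = κ * κ' * g ^ 3 * g ^ 3 := by ring
      _ ≤ κ * κ' * g ^ 3 * 1 := by gcongr
      _ = _ := mul_one _
  have s1 := abs_add_le ((f₁ * h₂ + f₂ * h₁ + f₂ * h₂ * g) * g ^ 3
    + r * (h₀ + h₁ * g + h₂ * g ^ 2) + (f₀ + f₁ * g + f₂ * g ^ 2) * s) (r * s)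
  have s2 := abs_add_three ((f₁ * h₂ + f₂ * h₁ + f₂ * h₂ * g) * g ^ 3)
    (r * (h₀ + h₁ * g + h₂ * g ^ 2)) ((f₀ + f₁ * g + f₂ * g ^ 2) * s)
  linarith

lemma abs_linear_add_quadratic_le {g u v : ℝ} (hg0 : 0 ≤ g) (hg : g ≤ 1 / 8) (hu : |u| ≤ 2)
    (hv : |v| ≤ 1) : |g * u + g ^ 2 * v| ≤ 3 * g := by
  refine (abs_add_le _ _).trans ?_
  rw [abs_mul, abs_mul, abs_of_nonneg hg0, abs_of_nonneg (by positivity : 0 ≤ g ^ 2)]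
  have e1 := mul_le_mul_of_nonneg_left hu hg0
  have e2 := mul_le_mul_of_nonneg_left hv (by positivity : 0 ≤ g ^ 2)
  nlinarith

lemma abs_sq_sub_le {g u v : ℝ} (hg0 : 0 ≤ g) (hg : g ≤ 1 / 8) (hu : |u| ≤ 2) (hv : |v| ≤ 1) :
    |(g * u + g ^ 2 * v) ^ 2 - g ^ 2 * u ^ 2| ≤ 5 * g ^ 3 := by
  have e : (g * u + g ^ 2 * v) ^ 2 - g ^ 2 * u ^ 2 = g ^ 3 * (2 * (u * v) + g * v ^ 2) := by ring
  rw [e, abs_mul, abs_of_nonneg (by positivity : 0 ≤ g ^ 3), mul_comm]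
  gcongr
  refine (abs_add_le _ _).trans ?_
  have h1 : |u * v| ≤ 2 * 1 := by rw [abs_mul]; gcongr
  have h2 : |v ^ 2| ≤ 1 := by rw [abs_pow]; exact pow_le_one₀ (abs_nonneg _) hv
  rw [abs_mul, abs_mul g, abs_two, abs_of_nonneg hg0]
  have := mul_le_mul hg h2 (abs_nonneg _) (by norm_num)
  linarith

/-- With x = gu + g²v, one has 1/(1+x) = 1 - x + x² - x³/(1+x). Since |x| ≤ 3g ≤ 3/8, the cubic term
is at most (27/(5/8))g³ ≤ 44g³, and replacing x² by g²u² costs 5g³. -/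
lemma hasExpansion_inv {g u v : ℝ} (hg0 : 0 ≤ g) (hg : g ≤ 1 / 8) (hu : |u| ≤ 2) (hv : |v| ≤ 1) :
    HasExpansion g 50 (1 + g * u + g ^ 2 * v)⁻¹ 1 (-u) (u ^ 2 - v) := by
  set x := g * u + g ^ 2 * v with hx
  have hx3 : |x| ≤ 3 * g := abs_linear_add_quadratic_le hg0 hg hu hv
  have hx1 : -(3 / 8) ≤ x := by linarith [(abs_le.1 hx3).1]
  have hu2 : |u ^ 2| ≤ 4 := by
    rw [abs_pow]; nlinarith [abs_nonneg u]
  refine ⟨by norm_num, by rw [abs_neg]; linarith, (abs_sub _ _).trans (by linarith), ?_⟩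
  have e : (1 + g * u + g ^ 2 * v)⁻¹ - (1 + -u * g + (u ^ 2 - v) * g ^ 2)
      = (x ^ 2 - g ^ 2 * u ^ 2) - x ^ 3 / (1 + x) := by
    rw [add_assoc, ← hx]
    have : 1 + x ≠ 0 := by linarith
    field_simp
    rw [hx]; ring
  rw [e]
  have hc : |x ^ 3 / (1 + x)| ≤ 44 * g ^ 3 := by
    rw [abs_div, abs_of_nonneg (by linarith : 0 ≤ 1 + x), div_le_iff₀ (by linarith), abs_pow]
    have h1 : |x| ^ 3 ≤ (3 * g) ^ 3 := by gcongr
    have h2 : 0 ≤ g ^ 3 := by positivity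
    nlinarith
  have hg3 : 0 ≤ g ^ 3 := by positivity
  refine (abs_sub _ _).trans ?_
  linarith [abs_sq_sub_le hg0 hg hu hv]

/-- Second order expansion of a squared normalized entry. -/
lemma abs_sq_div_sub_le {g m a b u v u' v' : ℝ} (hg0 : 0 ≤ g) (hg : g ≤ 1 / 8) (hm : |m| ≤ 1)
    (ha : |a| ≤ 2) (hb : |b| ≤ 1) (hu : |u| ≤ 2) (hv : |v| ≤ 1) (hu' : |u'| ≤ 2) (hv' : |v'| ≤ 1) :
    |(m + g * a + g ^ 2 * b) ^ 2 / ((1 + g * u + g ^ 2 * v) * (1 + g * u' + g ^ 2 * v'))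
      - (m ^ 2 + g * (2 * (m * a) - m ^ 2 * (u + u'))
        + g ^ 2 * (a ^ 2 + 2 * (m * b) + m ^ 2 * (u ^ 2 - v + (u' ^ 2 - v') + u * u')
          - 2 * m * (a * u + a * u')))| ≤ 10 ^ 7 * g ^ 3 := by
  have hg1 : g ≤ 1 := by linarith
  have h1 : HasExpansion g 2 (m + g * a + g ^ 2 * b) m a b := by
    refine ⟨by linarith, ha, by linarith, ?_⟩
    have : m + g * a + g ^ 2 * b - (m + a * g + b * g ^ 2) = 0 := by ring
    rw [this, abs_zero]
    positivity
  -- The constants multiply: 10·2·2 = 40 for the squared numerator, 10·50·50 = 25000 for the two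
  -- inverses, and 10·40·25000 = 10⁷.
  have h2 := (h1.mul hg0 hg1 h1).mul hg0 hg1
    ((hasExpansion_inv hg0 hg hu hv).mul hg0 hg1 (hasExpansion_inv hg0 hg hu' hv'))
  have h3 := h2.remainder
  convert h3 using 2
  · rw [div_eq_mul_inv, mul_inv]
    ring
  · norm_num

lemma abs_log_one_add_sub_le {x : ℝ} (hx : |x| ≤ 1 / 2) :
    |Real.log (1 + x) - (x - x ^ 2 / 2)| ≤ 2 * |x| ^ 3 := by
  have h := Real.abs_log_sub_add_sum_range_le (x := -x) (by rw [abs_neg]; linarith) 2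
  rw [abs_neg, sub_neg_eq_add] at h
  have e : ∑ i ∈ Finset.range 2, (-x) ^ (i + 1) / ((i : ℝ) + 1) + Real.log (1 + x)
      = Real.log (1 + x) - (x - x ^ 2 / 2) := by
    simp [Finset.sum_range_succ]
    ring
  rw [e] at h
  refine h.trans ?_
  rw [div_le_iff₀ (by linarith)]
  have : 0 ≤ |x| ^ 3 := by positivity
  norm_num
  nlinarith

/-- Second order expansion of the logarithm of a diagonal entry. -/
lemma abs_log_sub_le {g u v : ℝ} (hg0 : 0 ≤ g) (hg : g ≤ 1 / 8) (hu : |u| ≤ 2) (hv : |v| ≤ 1) :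
    |Real.log (1 + g * u + g ^ 2 * v) - (g * u + g ^ 2 * (v - u ^ 2 / 2))| ≤ 60 * g ^ 3 := by
  set x := g * u + g ^ 2 * v with hx
  have hx3 : |x| ≤ 3 * g := abs_linear_add_quadratic_le hg0 hg hu hv
  have h1 := abs_log_one_add_sub_le (x := x) (by linarith)
  have h2 := abs_sq_sub_le hg0 hg hu hv
  rw [← hx] at h2
  have h3 : |x| ^ 3 ≤ (3 * g) ^ 3 := by gcongr
  have hg3 : 0 ≤ g ^ 3 := by positivity
  rw [add_assoc, ← hx]
  have e : Real.log (1 + x) - (g * u + g ^ 2 * (v - u ^ 2 / 2))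
      = (Real.log (1 + x) - (x - x ^ 2 / 2)) - (x ^ 2 - g ^ 2 * u ^ 2) / 2 := by
    rw [hx]; ring
  rw [e]
  refine (abs_sub _ _).trans ?_
  rw [abs_div, abs_two]
  nlinarith

end Expansion

/-- Expansion of the determinant to first order. -/
lemma abs_prod_one_add_sub_le {ι : Type*} (s : Finset ι) {b : ℝ} (hb : 0 ≤ b) :
    ∃ C : ℝ, 0 ≤ C ∧ ∀ (γ : ℝ) (x : ι → ℝ), 0 ≤ γ → γ ≤ 1 → (∀ i, |x i| ≤ b) →
      |∏ i ∈ s, (1 + γ * x i) - (1 + γ * ∑ i ∈ s, x i)| ≤ C * γ ^ 2 := by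
  classical
  induction s using Finset.induction_on with
  | empty => exact ⟨0, le_rfl, fun γ x _ _ _ => by simp⟩
  | insert i s hi ih =>
    obtain ⟨C, hC0, hC⟩ := ih
    refine ⟨C * (1 + b) + b * (s.card * b), by positivity, fun γ x hγ0 hγ1 hx => ?_⟩
    rw [Finset.prod_insert hi, Finset.sum_insert hi]
    set R := ∏ j ∈ s, (1 + γ * x j) - (1 + γ * ∑ j ∈ s, x j) with hR
    have e : (1 + γ * x i) * ∏ j ∈ s, (1 + γ * x j) - (1 + γ * (x i + ∑ j ∈ s, x j))
        = R * (1 + γ * x i) + x i * (∑ j ∈ s, x j) * γ ^ 2 := by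
      rw [hR]; ring
    rw [e]
    refine (abs_add_le _ _).trans ?_
    have h1 : |R * (1 + γ * x i)| ≤ C * γ ^ 2 * (1 + b) := by
      rw [abs_mul]
      refine mul_le_mul (hC γ x hγ0 hγ1 hx) ?_ (abs_nonneg _) (by positivity)
      refine (abs_add_le _ _).trans ?_
      rw [abs_one, abs_mul, abs_of_nonneg hγ0]
      have := mul_le_mul hγ1 (hx i) (abs_nonneg _) zero_le_one
      linarith
    have h2 : |∑ j ∈ s, x j| ≤ s.card * b := by
      refine (Finset.abs_sum_le_sum_abs _ _).trans ((Finset.sum_le_sum fun j _ => hx j).trans ?_)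
      simp
    have h3 : |x i * (∑ j ∈ s, x j) * γ ^ 2| ≤ b * (s.card * b) * γ ^ 2 := by
      rw [abs_mul, abs_mul, abs_of_nonneg (by positivity : 0 ≤ γ ^ 2)]
      gcongr
      exact hx i
    linarith

/-- The identity permutation gives the product of the diagonal entries. Any other permutation moves
some i and then also σ i, hence has two off-diagonal factors of size at most γb and is O(γ²). -/
lemma abs_det_one_add_smul_sub_le (d : ℕ) {b : ℝ} (hb : 0 ≤ b) :
    ∃ C : ℝ, 0 ≤ C ∧ ∀ (γ : ℝ) (W : Matrix (Fin d) (Fin d) ℝ), 0 ≤ γ → γ ≤ 1 → W ∈ box d d b →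
      |(1 + γ • W).det - (1 + γ * W.trace)| ≤ C * γ ^ 2 := by
  obtain ⟨C, hC0, hC⟩ := abs_prod_one_add_sub_le (Finset.univ : Finset (Fin d)) hb
  refine ⟨C + (d.factorial : ℝ) * (b ^ 2 * (1 + b) ^ d), by positivity, fun γ W hγ0 hγ1 hW => ?_⟩
  have hdet : (1 + γ • W).det = ∏ i, (1 + γ * W i i) + ∑ σ ∈ Finset.univ.erase (1 : Equiv.Perm (Fin d)),
      (Equiv.Perm.sign σ : ℝ) * ∏ i, (1 + γ • W : Matrix (Fin d) (Fin d) ℝ) (σ i) i := by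
    rw [Matrix.det_apply', ← Finset.add_sum_erase _ _ (Finset.mem_univ (1 : Equiv.Perm (Fin d)))]
    simp
  have hterm : ∀ σ ∈ Finset.univ.erase (1 : Equiv.Perm (Fin d)), |(Equiv.Perm.sign σ : ℝ) *
      ∏ i, (1 + γ • W : Matrix (Fin d) (Fin d) ℝ) (σ i) i| ≤ b ^ 2 * (1 + b) ^ d * γ ^ 2 := by
    intro σ hσ
    have hs : |(Equiv.Perm.sign σ : ℝ)| = 1 := by
      rcases Int.units_eq_one_or (Equiv.Perm.sign σ) with h | h <;> simp [h]
    rw [abs_mul, hs, one_mul, Finset.abs_prod]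
    obtain ⟨i, hi⟩ : ∃ i, σ i ≠ i := by
      by_contra! h
      exact (Finset.ne_of_mem_erase hσ) (Equiv.ext h)
    have hij : σ i ≠ i := hi
    have hj : σ (σ i) ≠ σ i := fun h => hi (σ.injective h)
    have hoff : ∀ k, σ k ≠ k → |(1 + γ • W : Matrix (Fin d) (Fin d) ℝ) (σ k) k| ≤ γ * b := by
      intro k hk
      rw [Matrix.add_apply, Matrix.one_apply_ne hk, zero_add, Matrix.smul_apply, smul_eq_mul,
        abs_mul, abs_of_nonneg hγ0]
      gcongr
      exact hW _ _
    have hall : ∀ k, |(1 + γ • W : Matrix (Fin d) (Fin d) ℝ) (σ k) k| ≤ 1 + b := by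
      intro k
      rw [Matrix.add_apply, Matrix.smul_apply, smul_eq_mul]
      refine (abs_add_le _ _).trans (add_le_add ?_ ?_)
      · rw [Matrix.one_apply]; split_ifs <;> simp
      · rw [abs_mul, abs_of_nonneg hγ0]
        exact (mul_le_mul hγ1 (hW _ _) (abs_nonneg _) zero_le_one).trans_eq (one_mul b)
    rw [← Finset.mul_prod_erase _ _ (Finset.mem_univ i),
      ← Finset.mul_prod_erase _ _ (Finset.mem_erase.2 ⟨hij, Finset.mem_univ _⟩)]
    have hrest : ∏ k ∈ (Finset.univ.erase i).erase (σ i),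
        |(1 + γ • W : Matrix (Fin d) (Fin d) ℝ) (σ k) k| ≤ (1 + b) ^ d := by
      refine (Finset.prod_le_prod (fun _ _ => abs_nonneg _) fun k _ => hall k).trans ?_
      rw [Finset.prod_const]
      refine pow_le_pow_right₀ (by linarith) ?_
      exact (Finset.card_le_univ _).trans_eq (Fintype.card_fin d)
    calc _ ≤ (γ * b) * ((γ * b) * (1 + b) ^ d) := by
          refine mul_le_mul (hoff i hi) ?_ (by positivity) (by positivity)
          exact mul_le_mul (hoff _ hj) hrest (by positivity) (by positivity)
      _ = _ := by ring
  rw [hdet]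
  have h1 := hC γ (fun i => W i i) hγ0 hγ1 fun i => hW i i
  have h2 := (Finset.abs_sum_le_sum_abs _ _).trans (Finset.sum_le_sum hterm)
  rw [Finset.sum_const, nsmul_eq_mul] at h2
  have hcard : ((Finset.univ.erase (1 : Equiv.Perm (Fin d))).card : ℝ) ≤ d.factorial := by
    have : (Finset.univ.erase (1 : Equiv.Perm (Fin d))).card ≤ d.factorial := by
      refine (Finset.card_le_univ _).trans_eq ?_
      rw [Fintype.card_perm, Fintype.card_fin]
    exact_mod_cast this
  have h3 := mul_le_mul_of_nonneg_right hcard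
    (by positivity : 0 ≤ b ^ 2 * (1 + b) ^ d * γ ^ 2)
  have e : ∀ p q t : ℝ, p + q - t = (p - t) + q := fun p q t => by ring
  rw [e]
  refine (abs_add_le _ _).trans ?_
  have h1' : |∏ i, (1 + γ * W i i) - (1 + γ * W.trace)| ≤ C * γ ^ 2 := h1
  linarith

/-! ### One layer acting on a correlation matrix: bounds and expectations of entries. -/

section Correlation

variable {d N : ℕ}

/-- The properties of the second moment matrix of a row-normalized matrix that the expansions
use. -/
structure IsCorrelation (M : Matrix (Fin d) (Fin d) ℝ) : Prop where
  symm : M.transpose = M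
  diag : ∀ i, M i i = 1
  le_one : ∀ i j, |M i j| ≤ 1

/-- The second moment matrix `(1 + γ W) M (1 + γ W)ᵀ` before normalization. -/
def gram (γ : ℝ) (W M : Matrix (Fin d) (Fin d) ℝ) : Matrix (Fin d) (Fin d) ℝ :=
  (1 + γ • W) * M * (1 + γ • W).transpose

lemma IsCorrelation.symm_apply {M : Matrix (Fin d) (Fin d) ℝ} (hM : IsCorrelation M)
    (i j : Fin d) : M i j = M j i := by
  conv_lhs => rw [← hM.symm, Matrix.transpose_apply]

lemma IsCorrelation.gram_apply {M : Matrix (Fin d) (Fin d) ℝ} (hM : IsCorrelation M) (γ : ℝ)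
    (W : Matrix (Fin d) (Fin d) ℝ) (i j : Fin d) :
    gram γ W M i j = M i j + γ * ((W * M) i j + (W * M) j i)
      + γ ^ 2 * (W * M * W.transpose) i j := by
  have h : M * W.transpose = (W * M).transpose := by rw [Matrix.transpose_mul, hM.symm]
  have e : gram γ W M = M + γ • (W * M + (W * M).transpose) + γ ^ 2 • (W * M * W.transpose) := by
    rw [gram, Matrix.transpose_add, Matrix.transpose_smul, Matrix.transpose_one, Matrix.add_mul,
      Matrix.one_mul, Matrix.mul_add, Matrix.mul_one, Matrix.smul_mul, Matrix.add_mul,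
      Matrix.mul_smul, Matrix.smul_mul, Matrix.mul_smul, h, smul_smul, ← pow_two, smul_add]
    abel
  rw [e]
  rfl

lemma continuous_gram (γ : ℝ) : Continuous fun q : Matrix (Fin d) (Fin d) ℝ × Matrix (Fin d) (Fin d) ℝ =>
    gram γ q.1 q.2 := by
  unfold gram
  fun_prop

lemma abs_mul_apply_le {W M : Matrix (Fin d) (Fin d) ℝ} {b c : ℝ} (hW : W ∈ box d d b)
    (hM : ∀ i j, |M i j| ≤ c) (i j : Fin d) : |(W * M) i j| ≤ d * b * c := by
  rw [Matrix.mul_apply]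
  have hb : 0 ≤ b := (abs_nonneg _).trans (hW i i)
  refine (Finset.abs_sum_le_sum_abs _ _).trans ((Finset.sum_le_sum fun k _ =>
    (abs_mul _ _).trans_le (mul_le_mul (hW i k) (hM k j) (abs_nonneg _) hb)).trans_eq ?_)
  simp [mul_assoc]

lemma abs_conj_apply_le {W M : Matrix (Fin d) (Fin d) ℝ} {b : ℝ} (hW : W ∈ box d d b)
    (hM : ∀ i j, |M i j| ≤ 1) (i j : Fin d) :
    |(W * M * W.transpose) i j| ≤ (d * b) ^ 2 := by
  rw [Matrix.mul_apply]
  have hb : 0 ≤ b := (abs_nonneg _).trans (hW i i)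
  refine (Finset.abs_sum_le_sum_abs _ _).trans ((Finset.sum_le_sum fun k _ =>
    (abs_mul _ _).trans_le (mul_le_mul (abs_mul_apply_le hW hM i k) (hW j k) (abs_nonneg _)
      (by positivity))).trans_eq ?_)
  simp
  ring

section Bounds

variable {γ b : ℝ} {W M : Matrix (Fin d) (Fin d) ℝ}

lemma IsCorrelation.gram_diag (hM : IsCorrelation M) (i : Fin d) :
    gram γ W M i i = 1 + γ * (2 * (W * M) i i) + γ ^ 2 * (W * M * W.transpose) i i := by
  rw [hM.gram_apply, hM.diag]; ring

lemma abs_add_div_le {x y K : ℝ} (hK : 0 < K) (hx : |x| ≤ K) (hy : |y| ≤ K) :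
    |(x + y) / K| ≤ 2 := by
  rw [abs_div, abs_of_pos hK, div_le_iff₀ hK]
  linarith [abs_add_le x y]

lemma abs_div_sq_le {x K : ℝ} (hK : 0 < K) (hx : |x| ≤ K ^ 2) : |x / K ^ 2| ≤ 1 := by
  rw [abs_div, abs_of_pos (by positivity : 0 < K ^ 2), div_le_iff₀ (by positivity)]
  linarith

/-- The scalar expansions are used with g = γdb: dividing the linear terms by db and the quadratic
ones by (db)² bounds their coefficients by 2 and 1. The result is 3g ≤ 3/8. -/
lemma IsCorrelation.abs_gram_diag_sub_one_le (hM : IsCorrelation M) (hb : 1 ≤ b) (hγ0 : 0 ≤ γ)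
    (hγ : γ * (d * b) ≤ 1 / 8) (hW : W ∈ box d d b) (i : Fin d) :
    |gram γ W M i i - 1| ≤ 3 / 8 := by
  have hd : (0 : ℝ) < d := by exact_mod_cast i.pos
  have hK : 0 < d * b := by positivity
  have h1 := abs_mul_apply_le (c := 1) hW hM.le_one i i
  rw [mul_one] at h1
  have h := abs_linear_add_quadratic_le (g := γ * (d * b)) (by positivity) hγ
    (abs_add_div_le hK h1 h1) (abs_div_sq_le hK (abs_conj_apply_le hW hM.le_one i i))
  rw [hM.gram_diag]
  have e : γ * (d * b) * (((W * M) i i + (W * M) i i) / (d * b))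
      + (γ * (d * b)) ^ 2 * ((W * M * W.transpose) i i / (d * b) ^ 2)
      = 1 + γ * (2 * (W * M) i i) + γ ^ 2 * (W * M * W.transpose) i i - 1 := by
    field_simp; ring
  rw [e] at h
  linarith

lemma IsCorrelation.gram_diag_pos (hM : IsCorrelation M) (hb : 1 ≤ b) (hγ0 : 0 ≤ γ)
    (hγ : γ * (d * b) ≤ 1 / 8) (hW : W ∈ box d d b) (i : Fin d) : 1 / 2 ≤ gram γ W M i i := by
  linarith [(abs_le.1 (hM.abs_gram_diag_sub_one_le hb hγ0 hγ hW i)).1]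

lemma IsCorrelation.abs_sq_div_sub_le (hM : IsCorrelation M) (hb : 1 ≤ b) (hγ0 : 0 ≤ γ)
    (hγ : γ * (d * b) ≤ 1 / 8) (hW : W ∈ box d d b) (i j : Fin d) :
    |gram γ W M i j ^ 2 / (gram γ W M i i * gram γ W M j j)
      - (M i j ^ 2 + γ * (2 * (M i j * ((W * M) i j + (W * M) j i))
          - M i j ^ 2 * (2 * (W * M) i i + 2 * (W * M) j j))
        + γ ^ 2 * (((W * M) i j + (W * M) j i) ^ 2 + 2 * (M i j * (W * M * W.transpose) i j)
          + M i j ^ 2 * ((2 * (W * M) i i) ^ 2 - (W * M * W.transpose) i i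
            + ((2 * (W * M) j j) ^ 2 - (W * M * W.transpose) j j)
            + 2 * (W * M) i i * (2 * (W * M) j j))
          - 2 * M i j * (((W * M) i j + (W * M) j i) * (2 * (W * M) i i)
            + ((W * M) i j + (W * M) j i) * (2 * (W * M) j j))))|
      ≤ 10 ^ 7 * (γ * (d * b)) ^ 3 := by
  have hd : (0 : ℝ) < d := by exact_mod_cast i.pos
  have hK : 0 < d * b := by positivity
  have h1 : ∀ k l, |(W * M) k l| ≤ d * b := fun k l => by
    simpa using abs_mul_apply_le (c := 1) hW hM.le_one k l
  have h2 := fun k l => abs_div_sq_le hK (abs_conj_apply_le hW hM.le_one k l)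
  have h := BNNet.abs_sq_div_sub_le (g := γ * (d * b)) (by positivity) hγ (hM.le_one i j)
    (abs_add_div_le hK (h1 i j) (h1 j i)) (h2 i j) (abs_add_div_le hK (h1 i i) (h1 i i)) (h2 i i)
    (abs_add_div_le hK (h1 j j) (h1 j j)) (h2 j j)
  rw [hM.gram_diag, hM.gram_diag, hM.gram_apply]
  have lin : ∀ x : ℝ, γ * (d * b) * (x / (d * b)) = γ * x := fun x => by field_simp
  have quad : ∀ x : ℝ, (γ * (d * b)) ^ 2 * (x / (d * b) ^ 2) = γ ^ 2 * x := fun x => by field_simp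
  convert h using 2
  simp only [lin, quad, ← two_mul]
  congr 1
  field_simp

lemma IsCorrelation.abs_log_gram_diag_sub_le (hM : IsCorrelation M) (hb : 1 ≤ b) (hγ0 : 0 ≤ γ)
    (hγ : γ * (d * b) ≤ 1 / 8) (hW : W ∈ box d d b) (i : Fin d) :
    |Real.log (gram γ W M i i) - (γ * (2 * (W * M) i i)
      + γ ^ 2 * ((W * M * W.transpose) i i - (2 * (W * M) i i) ^ 2 / 2))|
      ≤ 60 * (γ * (d * b)) ^ 3 := by
  have hd : (0 : ℝ) < d := by exact_mod_cast i.pos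
  have hK : 0 < d * b := by positivity
  have h1 : |(W * M) i i| ≤ d * b := by
    simpa using abs_mul_apply_le (c := 1) hW hM.le_one i i
  have h := abs_log_sub_le (g := γ * (d * b)) (by positivity) hγ
    (abs_add_div_le hK h1 h1) (abs_div_sq_le hK (abs_conj_apply_le hW hM.le_one i i))
  rw [hM.gram_diag]
  have lin : ∀ x : ℝ, γ * (d * b) * (x / (d * b)) = γ * x := fun x => by field_simp
  have quad : ∀ x : ℝ, (γ * (d * b)) ^ 2 * (x / (d * b) ^ 2) = γ ^ 2 * x := fun x => by field_simp
  convert h using 2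
  simp only [lin, quad, ← two_mul]
  congr 1
  field_simp

end Bounds

section Expectation

variable {B : ℝ} {p : Measure ℝ}

/-- The expectation over the weight matrix as a linear form on continuous functions. -/
def IsWeightLaw.expectation (hp : IsWeightLaw B p) : C(Matrix (Fin d) (Fin d) ℝ, ℝ) →ₗ[ℝ] ℝ where
  toFun f := ∫ W, f W ∂(weightMatrixLaw d p)
  map_add' f g := integral_add (hp.integrable_of_continuous f.continuous)
    (hp.integrable_of_continuous g.continuous)
  map_smul' c _ := integral_const_mul c _

/-- The entry `(W M)ᵢⱼ` as a continuous function of `W`. -/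
def mulEntry (M : Matrix (Fin d) (Fin d) ℝ) (i j : Fin d) : C(Matrix (Fin d) (Fin d) ℝ, ℝ) :=
  ⟨fun W => (W * M) i j, by fun_prop⟩

/-- The entry `(W M Wᵀ)ᵢⱼ` as a continuous function of `W`. -/
def conjEntry (M : Matrix (Fin d) (Fin d) ℝ) (i j : Fin d) : C(Matrix (Fin d) (Fin d) ℝ, ℝ) :=
  ⟨fun W => (W * M * W.transpose) i j, by fun_prop⟩

variable {M : Matrix (Fin d) (Fin d) ℝ}

lemma IsWeightLaw.expectation_mulEntry (hp : IsWeightLaw B p) (i j : Fin d) :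
    hp.expectation (mulEntry M i j) = 0 := hp.integral_mul_apply M i j

lemma IsWeightLaw.expectation_conjEntry (hp : IsWeightLaw B p) (hM : IsCorrelation M)
    (i j : Fin d) : hp.expectation (conjEntry M i j) = if i = j then (d : ℝ) else 0 := by
  have h : M.trace = d := by simp [Matrix.trace, hM.diag]
  rw [← h]
  exact hp.integral_conj_apply M i j

lemma IsWeightLaw.expectation_mulEntry_mul (hp : IsWeightLaw B p) (hM : IsCorrelation M)
    (i j k l : Fin d) : hp.expectation (mulEntry M i j * mulEntry M k l)
      = if i = k then (M ^ 2) j l else 0 := by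
  have := hp.integral_mul_apply_mul M M i j k l
  rw [hM.symm, ← pow_two] at this
  exact this

lemma IsWeightLaw.expectation_one (hp : IsWeightLaw B p) :
    hp.expectation (1 : C(Matrix (Fin d) (Fin d) ℝ, ℝ)) = 1 := by
  have := hp.isProbabilityMeasure_weightMatrixLaw (d := d)
  change ∫ W, (1 : ℝ) ∂(weightMatrixLaw d p) = 1
  simp

/-- Quotients and logarithms behave well only for weights in the box, which carries all the mass, so
continuity and the error bound are asked for only there. -/
lemma IsWeightLaw.abs_integral_sub_le (hp : IsWeightLaw B p) {b c : ℝ} (hb : B ≤ b)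
    {f : Matrix (Fin d) (Fin d) ℝ → ℝ} (hf : ContinuousOn f (box d d b))
    (g : C(Matrix (Fin d) (Fin d) ℝ, ℝ)) (h : ∀ W ∈ box d d b, |f W - g W| ≤ c) :
    |∫ W, f W ∂(weightMatrixLaw d p) - hp.expectation g| ≤ c := by
  have := hp.isProbabilityMeasure_weightMatrixLaw (d := d)
  change |∫ W, f W ∂(weightMatrixLaw d p) - ∫ W, g W ∂(weightMatrixLaw d p)| ≤ c
  rw [← integral_sub (hp.integrable_of_continuousOn hb hf)
    (hp.integrable_of_continuous g.continuous)]
  have := norm_integral_le_of_norm_le_const (μ := weightMatrixLaw d p) (C := c)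
    (f := fun W => f W - g W) (by filter_upwards [hp.ae_mem_box hb] with W hW using h W hW)
  simpa using this

variable {γ b : ℝ}

lemma continuous_gram_left (i j : Fin d) : Continuous fun W => gram γ W M i j :=
  ((continuous_gram γ).comp (continuous_id.prodMk continuous_const)).matrix_elem i j

/-- The first-order terms have mean zero. At second order, only products of entries of WM in the
same row and diagonal entries of WMWᵀ have nonzero mean; i ≠ j removes the mixed-row products. -/
lemma IsWeightLaw.abs_integral_sq_div_sub_le (hp : IsWeightLaw B p) (hBb : B ≤ b)
    (hM : IsCorrelation M) (hb : 1 ≤ b) (hγ0 : 0 ≤ γ) (hγ : γ * (d * b) ≤ 1 / 8) {i j : Fin d}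
    (hij : i ≠ j) :
    |∫ W, gram γ W M i j ^ 2 / (gram γ W M i i * gram γ W M j j) ∂(weightMatrixLaw d p)
      - (M i j ^ 2 + γ ^ 2 * ((M ^ 2) i i + (M ^ 2) j j
        + M i j ^ 2 * (4 * (M ^ 2) i i + 4 * (M ^ 2) j j - 2 * d) - 8 * (M i j * (M ^ 2) i j)))|
      ≤ 10 ^ 7 * (γ * (d * b)) ^ 3 := by
  set m := M i j with hm
  let X := mulEntry M
  let Y := conjEntry M
  let g : C(Matrix (Fin d) (Fin d) ℝ, ℝ) := m ^ 2 • 1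
    + γ • ((2 * m) • X i j + (2 * m) • X j i - (2 * m ^ 2) • X i i - (2 * m ^ 2) • X j j)
    + γ ^ 2 • (X i j * X i j + (2 : ℝ) • (X i j * X j i) + X j i * X j i + (2 * m) • Y i j
      + (4 * m ^ 2) • (X i i * X i i) - m ^ 2 • Y i i + (4 * m ^ 2) • (X j j * X j j)
      - m ^ 2 • Y j j + (4 * m ^ 2) • (X i i * X j j)
      - (4 * m) • (X i j * X i i) - (4 * m) • (X j i * X i i)
      - (4 * m) • (X i j * X j j) - (4 * m) • (X j i * X j j))
  have hg : hp.expectation g = m ^ 2 + γ ^ 2 * ((M ^ 2) i i + (M ^ 2) j j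
      + m ^ 2 * (4 * (M ^ 2) i i + 4 * (M ^ 2) j j - 2 * d) - 8 * (m * (M ^ 2) i j)) := by
    have hsymm : (M ^ 2) j i = (M ^ 2) i j := by
      have : (M ^ 2).transpose = M ^ 2 := by rw [Matrix.transpose_pow, hM.symm]
      conv_rhs => rw [← this, Matrix.transpose_apply]
    simp only [g, X, Y, map_add, map_sub, map_smul, smul_eq_mul, hp.expectation_mulEntry,
      hp.expectation_conjEntry hM, hp.expectation_mulEntry_mul hM, hp.expectation_one, hij,
      hij.symm, if_true, if_false, hsymm]
    ring
  rw [← hg]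
  refine hp.abs_integral_sub_le hBb ?_ g fun W hW => ?_
  · refine ContinuousOn.div (((continuous_gram_left i j).pow 2).continuousOn)
      (((continuous_gram_left i i).mul (continuous_gram_left j j)).continuousOn) fun W hW => ?_
    have h1 := hM.gram_diag_pos hb hγ0 hγ hW i
    have h2 := hM.gram_diag_pos hb hγ0 hγ hW j
    have h3 : 0 < gram γ W M i i * gram γ W M j j := mul_pos (by linarith) (by linarith)
    exact h3.ne'
  · have h := hM.abs_sq_div_sub_le hb hγ0 hγ hW i j
    convert h using 3
    simp only [g, X, Y, mulEntry, conjEntry, ContinuousMap.add_apply, ContinuousMap.sub_apply,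
      ContinuousMap.smul_apply, ContinuousMap.mul_apply, ContinuousMap.one_apply,
      ContinuousMap.coe_mk, smul_eq_mul]
    ring

/-- To second order log(1+x) is x - x²/2, where (WMWᵀ)_ii has mean d and ((WM)_ii)² has mean
(M²)_ii. An upper bound suffices, since these logarithms enter log det M with a minus sign. -/
lemma IsWeightLaw.integral_log_gram_diag_le (hp : IsWeightLaw B p) (hBb : B ≤ b)
    (hM : IsCorrelation M) (hb : 1 ≤ b) (hγ0 : 0 ≤ γ) (hγ : γ * (d * b) ≤ 1 / 8) (i : Fin d) :
    ∫ W, Real.log (gram γ W M i i) ∂(weightMatrixLaw d p)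
      ≤ γ ^ 2 * (d - 2 * (M ^ 2) i i) + 60 * (γ * (d * b)) ^ 3 := by
  let g : C(Matrix (Fin d) (Fin d) ℝ, ℝ) := (2 * γ) • mulEntry M i i + γ ^ 2 • (conjEntry M i i
    - (2 : ℝ) • (mulEntry M i i * mulEntry M i i))
  have hg : hp.expectation g = γ ^ 2 * (d - 2 * (M ^ 2) i i) := by
    simp only [g, map_add, map_sub, map_smul, smul_eq_mul, hp.expectation_mulEntry,
      hp.expectation_conjEntry hM, hp.expectation_mulEntry_mul hM, if_true]
    ring
  have h := hp.abs_integral_sub_le (b := b) (c := 60 * (γ * (d * b)) ^ 3)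
    (f := fun W => Real.log (gram γ W M i i)) hBb ?_ g fun W hW => ?_
  · rw [hg] at h
    linarith [(abs_le.1 h).2]
  · refine ContinuousOn.log (continuous_gram_left i i).continuousOn fun W hW => ?_
    linarith [hM.gram_diag_pos hb hγ0 hγ hW i]
  · have h := hM.abs_log_gram_diag_sub_le hb hγ0 hγ hW i
    convert h using 3
    simp only [g, mulEntry, conjEntry, ContinuousMap.add_apply, ContinuousMap.sub_apply,
      ContinuousMap.smul_apply, ContinuousMap.mul_apply,
      ContinuousMap.coe_mk, smul_eq_mul]
    ring

end Expectation

end Correlation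

/-! ### Expected drifts of the squared Frobenius norm and of the log-determinant. -/

section Expansions

variable {d N : ℕ} {B : ℝ} {p : Measure ℝ} {γ b : ℝ} {M : Matrix (Fin d) (Fin d) ℝ}

lemma IsCorrelation.sq_apply_self (hM : IsCorrelation M) (i : Fin d) :
    (M ^ 2) i i = ∑ j, M i j ^ 2 := by
  rw [pow_two, Matrix.mul_apply]
  exact Finset.sum_congr rfl fun j _ => by rw [hM.symm_apply j i, pow_two]

lemma IsCorrelation.frobSq_eq (hM : IsCorrelation M) : frobSq M = ∑ i, (M ^ 2) i i :=
  Finset.sum_congr rfl fun i _ => (hM.sq_apply_self i).symm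

lemma IsCorrelation.trace_pow_three (hM : IsCorrelation M) :
    (M ^ 3).trace = ∑ i, ∑ j, M i j * (M ^ 2) i j := by
  rw [pow_succ' M 2, Matrix.trace]
  simp only [Matrix.diag_apply, Matrix.mul_apply]
  refine Finset.sum_congr rfl fun i _ => Finset.sum_congr rfl fun j _ => ?_
  have : (M ^ 2).transpose = M ^ 2 := by rw [Matrix.transpose_pow, hM.symm]
  conv_rhs => rw [← this, Matrix.transpose_apply]

lemma trace_diagonal_diag_sq (M : Matrix (Fin d) (Fin d) ℝ) :
    (Matrix.diagonal (Matrix.diag (M ^ 2)) ^ 2).trace = ∑ i, (M ^ 2) i i ^ 2 := by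
  simp [Matrix.diagonal_pow, Matrix.trace]

/-- Expected change of the squared Frobenius norm of the second moment matrix in one layer. -/
lemma IsWeightLaw.abs_integral_frobSq_sub_le (hp : IsWeightLaw B p) (hBb : B ≤ b)
    (hM : IsCorrelation M) (hb : 1 ≤ b) (hγ0 : 0 ≤ γ) (hγ : γ * (d * b) ≤ 1 / 8) :
    |∫ W, ∑ i, ∑ j, gram γ W M i j ^ 2 / (gram γ W M i i * gram γ W M j j) ∂(weightMatrixLaw d p)
      - (frobSq M + γ ^ 2 * (8 * (∑ i, (M ^ 2) i i ^ 2 - (M ^ 3).trace) + 2 * d ^ 2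
        - 2 * frobSq M))| ≤ d ^ 2 * (10 ^ 7 * (γ * (d * b)) ^ 3) := by
  set S := M ^ 2 with hS
  let c : Fin d → Fin d → ℝ := fun i j => S i i + S j j
    + M i j ^ 2 * (4 * S i i + 4 * S j j - 2 * d) - 8 * (M i j * S i j)
  -- The expansion `c` is valid off the diagonal only. Normalized diagonal entries are exactly 1, so
  -- the formal value c_ii = 2(M²)_ii - 2d has to be taken out; this produces the terms 2d² -
  -- 2‖M‖_F².
  let e : Fin d → Fin d → ℝ := fun i j => if i = j then c i i else 0
  have hsum : frobSq M + γ ^ 2 * (8 * (∑ i, S i i ^ 2 - (M ^ 3).trace) + 2 * d ^ 2 - 2 * frobSq M)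
      = ∑ i, ∑ j, (M i j ^ 2 + γ ^ 2 * (c i j - e i j)) := by
    have h1 : ∑ i, ∑ j, c i j = 2 * d * (∑ i, S i i) + 8 * (∑ i, S i i ^ 2)
        - 2 * d * frobSq M - 8 * (M ^ 3).trace := by
      have t1 : ∑ i : Fin d, ∑ j : Fin d, S i i = d * ∑ i, S i i := by
        simp [Finset.mul_sum]
      have t2 : ∑ i : Fin d, ∑ j : Fin d, S j j = d * ∑ i, S i i := by simp
      have t3 : ∑ i, ∑ j, M i j ^ 2 * S i i = ∑ i, S i i ^ 2 := by
        refine Finset.sum_congr rfl fun i _ => ?_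
        rw [← Finset.sum_mul, ← hM.sq_apply_self i, pow_two (S i i)]
      have t4 : ∑ i, ∑ j, M i j ^ 2 * S j j = ∑ i, S i i ^ 2 := by
        rw [Finset.sum_comm, ← t3]
        exact Finset.sum_congr rfl fun i _ => Finset.sum_congr rfl fun j _ => by
          rw [hM.symm_apply j i]
      rw [hM.trace_pow_three]
      have : ∀ i j, c i j = S i i + S j j + 4 * (M i j ^ 2 * S i i) + 4 * (M i j ^ 2 * S j j)
          - 2 * d * M i j ^ 2 - 8 * (M i j * S i j) := fun i j => by simp only [c]; ring
      simp only [this, Finset.sum_add_distrib, Finset.sum_sub_distrib, ← Finset.mul_sum, t1, t2, t3,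
        t4, frobSq]
      ring
    have h2 : ∑ i, ∑ j, e i j = 2 * (∑ i, S i i) - 2 * d ^ 2 := by
      have : ∀ i, c i i = 2 * S i i - 2 * d := fun i => by simp only [c, hM.diag]; ring
      simp only [e, Finset.sum_ite_eq, Finset.mem_univ, if_true, this, Finset.sum_sub_distrib,
        ← Finset.mul_sum]
      simp
      ring
    simp only [Finset.sum_add_distrib, Finset.sum_sub_distrib, ← Finset.mul_sum, h1, h2, frobSq]
    rw [hS, ← hM.frobSq_eq, frobSq]
    ring
  have hcont : ∀ i j, ContinuousOn (fun W => gram γ W M i j ^ 2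
      / (gram γ W M i i * gram γ W M j j)) (box d d b) := fun i j => by
    refine ContinuousOn.div (((continuous_gram_left i j).pow 2).continuousOn)
      (((continuous_gram_left i i).mul (continuous_gram_left j j)).continuousOn) fun W hW => ?_
    have h1 := hM.gram_diag_pos hb hγ0 hγ hW i
    have h2 := hM.gram_diag_pos hb hγ0 hγ hW j
    exact (mul_pos (by linarith) (by linarith)).ne'
  have hint := fun i j => hp.integrable_of_continuousOn hBb (hcont i j)
  rw [hsum, integral_finsetSum _ fun i _ => integrable_finsetSum _ fun j _ => hint i j]
  simp only [integral_finsetSum _ fun j _ => hint _ j]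
  simp only [← Finset.sum_sub_distrib]
  have hprob := hp.isProbabilityMeasure_weightMatrixLaw (d := d)
  have hentry : ∀ i j, |∫ W, gram γ W M i j ^ 2 / (gram γ W M i i * gram γ W M j j)
      ∂(weightMatrixLaw d p) - (M i j ^ 2 + γ ^ 2 * (c i j - e i j))|
      ≤ 10 ^ 7 * (γ * (d * b)) ^ 3 := by
    intro i j
    by_cases hij : i = j
    · subst hij
      have h1 : ∫ W, gram γ W M i i ^ 2 / (gram γ W M i i * gram γ W M i i)
          ∂(weightMatrixLaw d p) = 1 := by
        have : ∫ W, gram γ W M i i ^ 2 / (gram γ W M i i * gram γ W M i i)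
            ∂(weightMatrixLaw d p) = ∫ W, (1 : ℝ) ∂(weightMatrixLaw d p) := by
          refine integral_congr_ae ?_
          filter_upwards [hp.ae_mem_box hBb] with W hW
          have h1 := hM.gram_diag_pos hb hγ0 hγ hW i
          rw [pow_two]
          exact div_self (mul_pos (by linarith) (by linarith)).ne'
        simpa using this
      rw [h1, hM.diag]
      simp only [e, if_true, sub_self, mul_zero, add_zero, one_pow, abs_zero]
      positivity
    · simp only [e, hij, if_false, sub_zero]
      exact hp.abs_integral_sq_div_sub_le hBb hM hb hγ0 hγ hij
  refine (Finset.abs_sum_le_sum_abs _ _).trans ?_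
  refine (Finset.sum_le_sum fun i _ => (Finset.abs_sum_le_sum_abs _ _).trans
    (Finset.sum_le_sum fun j _ => hentry i j)).trans_eq ?_
  simp
  ring

/-- Expected logarithm of the determinant of a layer. -/
lemma exists_integral_log_det_ge (d : ℕ) (hb : 0 ≤ b) :
    ∃ C γ₁ : ℝ, 0 ≤ C ∧ 0 < γ₁ ∧ γ₁ ≤ 1 ∧
      (∀ γ, 0 ≤ γ → γ ≤ γ₁ → ∀ W ∈ box d d b, 1 / 2 ≤ (1 + γ • W).det) ∧
      ∀ (B : ℝ) (p : Measure ℝ), IsWeightLaw B p → B ≤ b → ∀ γ, 0 ≤ γ → γ ≤ γ₁ →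
        -(γ ^ 2 * d) - C * γ ^ 3 ≤ ∫ W, 2 * Real.log (1 + γ • W).det ∂(weightMatrixLaw d p) := by
  obtain ⟨C, hC0, hC⟩ := abs_det_one_add_smul_sub_le d hb
  have htr : ∀ W ∈ box d d b, |W.trace| ≤ d * b := fun W hW => by
    rw [Matrix.trace]
    refine (Finset.abs_sum_le_sum_abs _ _).trans ((Finset.sum_le_sum fun i _ => hW i i).trans ?_)
    simp
  set κ := d * b + C with hκ
  have hκ0 : 0 ≤ κ := by positivity
  have ht : ∀ γ, 0 ≤ γ → γ ≤ 1 → ∀ W ∈ box d d b, |(1 + γ • W).det - 1| ≤ κ * γ := by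
    intro γ hγ0 hγ1 W hW
    have h1 := hC γ W hγ0 hγ1 hW
    have h2 := htr W hW
    have e : (1 + γ • W).det - 1 = ((1 + γ • W).det - (1 + γ * W.trace)) + γ * W.trace := by ring
    rw [e]
    refine (abs_add_le _ _).trans ?_
    rw [abs_mul, abs_of_nonneg hγ0]
    have h3 : C * γ ^ 2 ≤ C * γ := by
      gcongr
      nlinarith
    have h4 := mul_le_mul_of_nonneg_left h2 hγ0
    rw [hκ]
    linarith
  -- This choice keeps |det(1+γW) - 1| ≤ κγ below 1/2, inside the range of the logarithmic
  -- expansion.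
  set γ₁ := 1 / (2 * (κ + 1)) with hγ₁
  have hγ₁0 : 0 < γ₁ := by positivity
  have hγ₁1 : γ₁ ≤ 1 := by
    rw [hγ₁, div_le_one (by positivity)]; linarith
  have ht2 : ∀ γ, 0 ≤ γ → γ ≤ γ₁ → ∀ W ∈ box d d b, |(1 + γ • W).det - 1| ≤ 1 / 2 := by
    intro γ hγ0 hγ W hW
    refine (ht γ hγ0 (hγ.trans hγ₁1) W hW).trans ?_
    have h1 : κ * γ ≤ (κ + 1) * γ₁ := by gcongr; linarith
    have h2 : (κ + 1) * γ₁ = 1 / 2 := by rw [hγ₁]; field_simp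
    linarith
  refine ⟨2 * (d * b) * C + C ^ 2 + 4 * κ ^ 3, γ₁, by positivity, hγ₁0, hγ₁1,
    fun γ hγ0 hγ W hW => ?_, fun B p hp hB γ hγ0 hγ => ?_⟩
  · linarith [(abs_le.1 (ht2 γ hγ0 hγ W hW)).1]
  have hprob := hp.isProbabilityMeasure_weightMatrixLaw (d := d)
  have hγ1 := hγ.trans hγ₁1
  set R := (2 * (d * b) * C + C ^ 2 + 4 * κ ^ 3) * γ ^ 3 with hR
  have hcdet : Continuous fun W : Matrix (Fin d) (Fin d) ℝ => (1 + γ • W).det := by fun_prop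
  have hctr : Continuous fun W : Matrix (Fin d) (Fin d) ℝ => γ ^ 2 * W.trace ^ 2 := by fun_prop
  -- With t = det(1+γW) - 1, 2 log(1+t) ≥ 2t - t² - 4|t|³, and t² equals γ²(Tr W)² up to O(γ³). In
  -- expectation t vanishes and (Tr W)² gives d.
  have hlow : ∀ W ∈ box d d b, 2 * ((1 + γ • W).det - 1) - γ ^ 2 * W.trace ^ 2 - R
      ≤ 2 * Real.log (1 + γ • W).det := by
    intro W hW
    set t := (1 + γ • W).det - 1 with ht'
    set r := (1 + γ • W).det - (1 + γ * W.trace) with hr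
    have h1 := (abs_le.1 (abs_log_one_add_sub_le (ht2 γ hγ0 hγ W hW))).1
    have h2 : |t| ^ 3 ≤ (κ * γ) ^ 3 := by gcongr; exact ht γ hγ0 hγ1 W hW
    have h3 : |r| ≤ C * γ ^ 2 := hC γ W hγ0 hγ1 hW
    have h4 : t = γ * W.trace + r := by rw [ht', hr]; ring
    have h5 : t ^ 2 - γ ^ 2 * W.trace ^ 2 ≤ (2 * (d * b) * C + C ^ 2) * γ ^ 3 := by
      have e : t ^ 2 - γ ^ 2 * W.trace ^ 2 = 2 * γ * (W.trace * r) + r ^ 2 := by rw [h4]; ring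
      have h6 : W.trace * r ≤ d * b * (C * γ ^ 2) := by
        refine (le_abs_self _).trans ?_
        rw [abs_mul]
        exact mul_le_mul (htr W hW) h3 (abs_nonneg _) (by positivity)
      have h7 : r ^ 2 ≤ C ^ 2 * γ ^ 3 := by
        rw [← sq_abs]
        calc |r| ^ 2 ≤ (C * γ ^ 2) ^ 2 := by gcongr
          _ = C ^ 2 * γ ^ 3 * γ := by ring
          _ ≤ C ^ 2 * γ ^ 3 * 1 := by gcongr
          _ = _ := mul_one _
      have h8 := mul_le_mul_of_nonneg_left h6 (by positivity : 0 ≤ 2 * γ)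
      rw [e]
      linarith
    have e : (1 + γ • W).det = 1 + t := by rw [ht']; ring
    rw [e]
    have h9 : (κ * γ) ^ 3 = κ ^ 3 * γ ^ 3 := by ring
    rw [hR]
    linarith
  have hlog : Integrable (fun W => 2 * Real.log (1 + γ • W).det) (weightMatrixLaw d p) := by
    refine hp.integrable_of_continuousOn hB ((ContinuousOn.log hcdet.continuousOn fun W hW => ?_).const_smul (2 : ℝ))
    linarith [(abs_le.1 (ht2 γ hγ0 hγ W hW)).1]
  have i1 : Integrable (fun W : Matrix (Fin d) (Fin d) ℝ => 2 * ((1 + γ • W).det - 1))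
      (weightMatrixLaw d p) := hp.integrable_of_continuous (by fun_prop)
  have i2 : Integrable (fun W : Matrix (Fin d) (Fin d) ℝ => γ ^ 2 * W.trace ^ 2)
      (weightMatrixLaw d p) := hp.integrable_of_continuous hctr
  have hmono : ∫ W, (2 * ((1 + γ • W).det - 1) - γ ^ 2 * W.trace ^ 2 - R) ∂(weightMatrixLaw d p)
      ≤ ∫ W, 2 * Real.log (1 + γ • W).det ∂(weightMatrixLaw d p) := by
    refine integral_mono_ae ((i1.sub i2).sub (integrable_const R)) hlog ?_
    filter_upwards [hp.ae_mem_box hB] with W hW using hlow W hW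
  rw [integral_sub (by exact i1.sub i2) (integrable_const R), integral_sub i1 i2, integral_const_mul,
    integral_sub (hp.integrable_of_continuous hcdet) (integrable_const _), hp.integral_det,
    integral_const_mul, hp.integral_trace_sq] at hmono
  simp at hmono
  linarith

end Expansions

/-! ### The second moment matrix and its transformation under a layer. -/

section SecondMoment

variable {d N : ℕ} {γ b : ℝ}

lemma secondMoment_apply (H : Matrix (Fin d) (Fin N) ℝ) (i j : Fin d) :
    secondMoment H i j = (1 / (N : ℝ)) * ∑ k, H i k * H j k := by
  simp [secondMoment, Matrix.mul_apply]

lemma secondMoment_mul (A : Matrix (Fin d) (Fin d) ℝ) (H : Matrix (Fin d) (Fin N) ℝ) :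
    secondMoment (A * H) = A * secondMoment H * A.transpose := by
  simp only [secondMoment, Matrix.transpose_mul, Matrix.mul_smul, Matrix.smul_mul, Matrix.mul_assoc]

lemma transpose_secondMoment (H : Matrix (Fin d) (Fin N) ℝ) :
    (secondMoment H).transpose = secondMoment H := by
  simp [secondMoment, Matrix.transpose_mul]

lemma add_smul_mul_eq (W : Matrix (Fin d) (Fin d) ℝ) (H : Matrix (Fin d) (Fin N) ℝ) :
    H + γ • (W * H) = (1 + γ • W) * H := by
  rw [Matrix.add_mul, Matrix.one_mul, Matrix.smul_mul]

lemma secondMoment_add_smul_mul (W : Matrix (Fin d) (Fin d) ℝ) (H : Matrix (Fin d) (Fin N) ℝ) :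
    secondMoment (H + γ • (W * H)) = gram γ W (secondMoment H) := by
  rw [add_smul_mul_eq, secondMoment_mul, gram]

lemma continuous_secondMoment : Continuous (secondMoment : Matrix (Fin d) (Fin N) ℝ → _) := by
  unfold secondMoment
  fun_prop

lemma mem_normalized_iff (hN : N ≠ 0) {H : Matrix (Fin d) (Fin N) ℝ} :
    H ∈ normalized d N ↔ ∀ i, secondMoment H i i = 1 := by
  have hN' : (N : ℝ) ≠ 0 := by exact_mod_cast hN
  refine forall_congr' fun i => ?_
  rw [secondMoment_apply, one_div, inv_mul_eq_one₀ hN']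
  simp only [← pow_two]
  exact eq_comm

lemma isCorrelation_secondMoment (hN : N ≠ 0) {H : Matrix (Fin d) (Fin N) ℝ}
    (hH : H ∈ normalized d N) : IsCorrelation (secondMoment H) where
  symm := transpose_secondMoment H
  diag := (mem_normalized_iff hN).1 hH
  le_one i j := by
    have hN' : (0 : ℝ) < N := by positivity
    have h := Finset.sum_mul_sq_le_sq_mul_sq Finset.univ (fun k => H i k) (fun k => H j k)
    rw [hH i, hH j, ← pow_two] at h
    rw [secondMoment_apply, abs_mul, abs_of_pos (by positivity : (0 : ℝ) < 1 / N),
      div_mul_eq_mul_div, one_mul, div_le_one hN']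
    exact abs_le_of_sq_le_sq h hN'.le

lemma isCompact_normalized : IsCompact (normalized d N) := by
  refine (isCompact_box (√(N : ℝ))).of_isClosed_subset ?_ fun H hH i j => ?_
  · have : normalized d N = ⋂ i, {H | ∑ j, H i j ^ 2 = (N : ℝ)} := by
      ext H; simp [normalized]
    rw [this]
    exact isClosed_iInter fun i => isClosed_eq (by fun_prop) continuous_const
  · refine Real.abs_le_sqrt ?_
    rw [← hH i]
    exact Finset.single_le_sum (f := fun k => H i k ^ 2) (fun k _ => sq_nonneg _)
      (Finset.mem_univ j)

lemma IsCorrelation.trace_eq {M : Matrix (Fin d) (Fin d) ℝ} (hM : IsCorrelation M) :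
    M.trace = d := by simp [Matrix.trace, hM.diag]

lemma IsCorrelation.le_frobSq {M : Matrix (Fin d) (Fin d) ℝ} (hM : IsCorrelation M) :
    (d : ℝ) ≤ frobSq M := by
  have h : ∀ i, (1 : ℝ) ≤ ∑ j, M i j ^ 2 := fun i => by
    have := Finset.single_le_sum (f := fun j => M i j ^ 2) (fun k _ => sq_nonneg _)
      (Finset.mem_univ i)
    rwa [hM.diag, one_pow] at this
  calc (d : ℝ) = ∑ _i : Fin d, (1 : ℝ) := by simp
    _ ≤ frobSq M := Finset.sum_le_sum fun i _ => h i

/-- Cauchy–Schwarz for the moments of the spectrum. -/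
lemma frobSq_sq_le (hN : N ≠ 0) {H : Matrix (Fin d) (Fin N) ℝ} (hH : H ∈ normalized d N) :
    frobSq (secondMoment H) ^ 2 ≤ d * (secondMoment H ^ 3).trace := by
  have hM := isCorrelation_secondMoment hN hH
  have hN' : (N : ℝ) ≠ 0 := by exact_mod_cast hN
  set M := secondMoment H with hMdef
  have htr : ∀ X Y : Matrix (Fin d) (Fin N) ℝ, ∑ q : Fin d × Fin N, X q.1 q.2 * Y q.1 q.2
      = (X * Y.transpose).trace := fun X Y => by
    rw [Fintype.sum_prod_type]
    rfl
  have hHH : H * H.transpose = (N : ℝ) • M := by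
    rw [hMdef, secondMoment, smul_smul, mul_one_div_cancel hN', one_smul]
  have h1 : ∑ q : Fin d × Fin N, H q.1 q.2 ^ 2 = N * d := by
    simp only [pow_two]
    rw [htr, hHH, Matrix.trace_smul, hM.trace_eq, smul_eq_mul]
  have h2 : ∑ q : Fin d × Fin N, H q.1 q.2 * (M * H) q.1 q.2 = N * frobSq M := by
    rw [htr, Matrix.transpose_mul, ← Matrix.mul_assoc, hHH, hM.symm, Matrix.smul_mul,
      Matrix.trace_smul, hM.frobSq_eq, ← pow_two]
    rfl
  have h3 : ∑ q : Fin d × Fin N, (M * H) q.1 q.2 ^ 2 = N * (M ^ 3).trace := by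
    simp only [pow_two]
    rw [htr, Matrix.transpose_mul, Matrix.mul_assoc, ← Matrix.mul_assoc H, hHH, hM.symm,
      Matrix.smul_mul, Matrix.mul_smul, Matrix.trace_smul, ← Matrix.mul_assoc, pow_three',
      smul_eq_mul]
  -- Cauchy–Schwarz is applied to the entries of H and MH, with ‖H‖² = Nd, ⟨H, MH⟩ = N‖M‖_F² and
  -- ‖MH‖² = N Tr M³; no diagonalization is needed.
  have h := Finset.sum_mul_sq_le_sq_mul_sq Finset.univ (fun q : Fin d × Fin N => H q.1 q.2)
    (fun q => (M * H) q.1 q.2)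
  rw [h1, h2, h3, mul_pow] at h
  have h4 : (N : ℝ) ^ 2 * frobSq M ^ 2 ≤ (N : ℝ) ^ 2 * (d * (M ^ 3).trace) := by
    refine h.trans_eq ?_; ring
  exact le_of_mul_le_mul_left h4 (by positivity)

section Layer

variable {W : Matrix (Fin d) (Fin d) ℝ} {H : Matrix (Fin d) (Fin N) ℝ}

lemma secondMoment_layer (γ : ℝ) (W : Matrix (Fin d) (Fin d) ℝ) (H : Matrix (Fin d) (Fin N) ℝ) :
    secondMoment (layer γ W H)
      = Matrix.diagonal (fun i => gram γ W (secondMoment H) i i ^ (-(1 / 2) : ℝ))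
        * gram γ W (secondMoment H)
        * Matrix.diagonal (fun i => gram γ W (secondMoment H) i i ^ (-(1 / 2) : ℝ)) := by
  rw [layer, batchNorm, secondMoment_mul, secondMoment_add_smul_mul, Matrix.diagonal_transpose]

lemma rpow_neg_half_sq {x : ℝ} (hx : 0 < x) : (x ^ (-(1 / 2) : ℝ)) ^ 2 = x⁻¹ := by
  rw [← Real.rpow_natCast, ← Real.rpow_mul hx.le]
  norm_num [Real.rpow_neg_one]

lemma secondMoment_layer_sq (hG : ∀ i, 0 < gram γ W (secondMoment H) i i) (i j : Fin d) :
    secondMoment (layer γ W H) i j ^ 2 = gram γ W (secondMoment H) i j ^ 2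
      / (gram γ W (secondMoment H) i i * gram γ W (secondMoment H) j j) := by
  rw [secondMoment_layer, Matrix.mul_diagonal, Matrix.diagonal_mul, mul_pow, mul_pow,
    rpow_neg_half_sq (hG i), rpow_neg_half_sq (hG j), div_eq_mul_inv, mul_inv]
  ring

lemma layer_mem_normalized (hN : N ≠ 0) (hG : ∀ i, 0 < gram γ W (secondMoment H) i i) :
    layer γ W H ∈ normalized d N := by
  refine (mem_normalized_iff hN).2 fun i => ?_
  rw [secondMoment_layer, Matrix.mul_diagonal, Matrix.diagonal_mul, mul_right_comm, ← pow_two,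
    rpow_neg_half_sq (hG i), inv_mul_cancel₀ (hG i).ne']

lemma det_gram (γ : ℝ) (W M : Matrix (Fin d) (Fin d) ℝ) :
    (gram γ W M).det = (1 + γ • W).det ^ 2 * M.det := by
  rw [gram, Matrix.det_mul, Matrix.det_mul, Matrix.det_transpose]
  ring

lemma det_secondMoment_layer (hG : ∀ i, 0 < gram γ W (secondMoment H) i i) :
    (secondMoment (layer γ W H)).det
      = (1 + γ • W).det ^ 2 * (secondMoment H).det / ∏ i, gram γ W (secondMoment H) i i := by
  have h : (∏ i, gram γ W (secondMoment H) i i ^ (-(1 / 2) : ℝ))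
      * (∏ i, gram γ W (secondMoment H) i i ^ (-(1 / 2) : ℝ))
      = (∏ i, gram γ W (secondMoment H) i i)⁻¹ := by
    rw [← Finset.prod_mul_distrib, ← Finset.prod_inv_distrib]
    exact Finset.prod_congr rfl fun i _ => by rw [← pow_two, rpow_neg_half_sq (hG i)]
  rw [secondMoment_layer, Matrix.det_mul, Matrix.det_mul, Matrix.det_diagonal, det_gram,
    mul_right_comm, h, div_eq_mul_inv, mul_comm]

lemma log_det_secondMoment_layer (hG : ∀ i, 0 < gram γ W (secondMoment H) i i)
    (hA : 0 < (1 + γ • W).det) (hdet : 0 < (secondMoment H).det) :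
    0 < (secondMoment (layer γ W H)).det ∧ Real.log (secondMoment (layer γ W H)).det
      = Real.log (secondMoment H).det + (2 * Real.log (1 + γ • W).det
        - ∑ i, Real.log (gram γ W (secondMoment H) i i)) := by
  have hP : 0 < ∏ i, gram γ W (secondMoment H) i i := Finset.prod_pos fun i _ => hG i
  rw [det_secondMoment_layer hG]
  refine ⟨by positivity, ?_⟩
  rw [Real.log_div (by positivity) hP.ne', Real.log_mul (by positivity) hdet.ne', Real.log_pow,
    Real.log_prod fun i _ => (hG i).ne']
  push_cast
  ring

lemma continuous_secondMoment_pre (γ : ℝ) :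
    Continuous fun q : Matrix (Fin d) (Fin N) ℝ × Matrix (Fin d) (Fin d) ℝ =>
      gram γ q.2 (secondMoment q.1) := by
  unfold gram secondMoment
  fun_prop

lemma layer_apply (i : Fin d) (j : Fin N) : layer γ W H i j
    = gram γ W (secondMoment H) i i ^ (-(1 / 2) : ℝ) * ((1 + γ • W) * H : Matrix (Fin d) (Fin N) ℝ) i j := by
  rw [layer, batchNorm, Matrix.diagonal_mul, secondMoment_add_smul_mul, add_smul_mul_eq]

lemma measurable_layer (γ : ℝ) :
    Measurable fun q : Matrix (Fin d) (Fin N) ℝ × Matrix (Fin d) (Fin d) ℝ => layer γ q.2 q.1 := by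
  refine measurable_pi_iff.2 fun i => measurable_pi_iff.2 fun j => ?_
  simp only [layer_apply]
  refine Measurable.mul ?_ ?_
  · exact ((continuous_secondMoment_pre γ).matrix_elem i i).measurable.pow_const _
  · have : Continuous fun q : Matrix (Fin d) (Fin N) ℝ × Matrix (Fin d) (Fin d) ℝ =>
        ((1 + γ • q.2) * q.1 : Matrix (Fin d) (Fin N) ℝ) i j := by fun_prop
    exact this.measurable

lemma measurable_layer_comp {α : Type*} [MeasurableSpace α] {f : α → Matrix (Fin d) (Fin N) ℝ}
    {g : α → Matrix (Fin d) (Fin d) ℝ} (hf : Measurable f) (hg : Measurable g) :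
    Measurable fun a => layer γ (g a) (f a) := by
  have h := (measurable_layer (d := d) (N := N) γ).comp (hf.prodMk hg)
  simp only [Function.comp_def] at h
  exact h

lemma continuousAt_layer (hG : ∀ i, 0 < gram γ W (secondMoment H) i i) :
    ContinuousAt (fun H => layer γ W H) H := by
  have h : ∀ i j, ContinuousAt (fun H : Matrix (Fin d) (Fin N) ℝ => layer γ W H i j) H := by
    intro i j
    simp only [layer_apply]
    refine ContinuousAt.mul ?_ (by fun_prop)
    refine ContinuousAt.rpow_const ?_ (Or.inl (hG i).ne')
    exact (((continuous_secondMoment_pre γ).comp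
      (continuous_id.prodMk continuous_const)).matrix_elem i i).continuousAt
  exact continuousAt_pi.2 fun i => continuousAt_pi.2 fun j => h i j

end Layer

lemma det_secondMoment_pos (hN : N ≠ 0) {X : Matrix (Fin d) (Fin N) ℝ} (hX : X.rank = d) :
    0 < (secondMoment X).det := by
  have hN' : (0 : ℝ) < N := by positivity
  have hrank : (X * X.transpose).rank = d := by rw [Matrix.rank_self_mul_transpose, hX]
  have hpsd : (X * X.transpose).PosSemidef := by
    simpa [Matrix.conjTranspose_eq_transpose_of_trivial] using
      Matrix.posSemidef_self_mul_conjTranspose X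
  have hunit : IsUnit (X * X.transpose) := by
    rw [← Matrix.linearIndependent_rows_iff_isUnit]
    rw [linearIndependent_iff_card_eq_finrank_span, Set.finrank, ← Matrix.rank_eq_finrank_span_row,
      hrank, Fintype.card_fin]
  have hdet : 0 < (X * X.transpose).det :=
    lt_of_le_of_ne hpsd.det_nonneg fun h => ((Matrix.isUnit_iff_isUnit_det _).1 hunit).ne_zero h.symm
  rw [secondMoment, Matrix.det_smul]
  positivity

/-- The Leibniz formula has d! terms, each at most 1. This crude bound is all that is needed to keep
log det bounded above. -/
lemma abs_det_secondMoment_le (hN : N ≠ 0) {H : Matrix (Fin d) (Fin N) ℝ}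
    (hH : H ∈ normalized d N) : |(secondMoment H).det| ≤ d.factorial := by
  have := Matrix.det_le (A := secondMoment H) (abv := AbsoluteValue.abs) (x := 1)
    fun i j => (isCorrelation_secondMoment hN hH).le_one i j
  simpa using this

end SecondMoment

/-! ### Small steps: the chain on the compact state space and its independent weights. -/

section SmallStep

variable {d N : ℕ} {γ b B : ℝ} {p : Measure ℝ}

/-- The step size `γ` is small for weights with entries in `[-b, b]`. -/
structure IsSmallStep (d : ℕ) (b γ : ℝ) : Prop where
  one_le : 1 ≤ b
  pos : 0 < γ
  mul_le : γ * (d * b) ≤ 1 / 8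
  det_ge : ∀ W ∈ box d d b, 1 / 2 ≤ (1 + γ • W).det

lemma IsSmallStep.gram_diag_pos (hγ : IsSmallStep d b γ) (hN : N ≠ 0)
    {W : Matrix (Fin d) (Fin d) ℝ} (hW : W ∈ box d d b) {H : Matrix (Fin d) (Fin N) ℝ}
    (hH : H ∈ normalized d N) (i : Fin d) : 1 / 2 ≤ gram γ W (secondMoment H) i i :=
  (isCorrelation_secondMoment hN hH).gram_diag_pos hγ.one_le hγ.pos.le hγ.mul_le hW i

lemma IsSmallStep.layer_mem_normalized (hγ : IsSmallStep d b γ) (hN : N ≠ 0)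
    {W : Matrix (Fin d) (Fin d) ℝ} (hW : W ∈ box d d b) {H : Matrix (Fin d) (Fin N) ℝ}
    (hH : H ∈ normalized d N) : layer γ W H ∈ normalized d N :=
  BNNet.layer_mem_normalized hN fun i => by linarith [hγ.gram_diag_pos hN hW hH i]

/-- A zero row before normalization would make the determinant vanish. Unlike the perturbative bound
this covers the first layer, where `X` need not be row-normalized. -/
lemma gram_diag_pos_of_det_pos (hN : N ≠ 0) {W : Matrix (Fin d) (Fin d) ℝ}
    {H : Matrix (Fin d) (Fin N) ℝ} (hdet : 0 < (secondMoment H).det)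
    (hA : 0 < (1 + γ • W).det) (i : Fin d) : 0 < gram γ W (secondMoment H) i i := by
  have hN' : (0 : ℝ) < N := by positivity
  have hpos : 0 < (gram γ W (secondMoment H)).det := by
    rw [det_gram]; positivity
  rw [← secondMoment_add_smul_mul] at hpos ⊢
  set G := H + γ • (W * H)
  have hnn : 0 ≤ ∑ k, G i k * G i k := Finset.sum_nonneg fun k _ => mul_self_nonneg _
  rw [secondMoment_apply]
  refine mul_pos (by positivity) (lt_of_le_of_ne hnn fun h => ?_)
  have hrow : ∀ k, G i k = 0 := fun k =>
    mul_self_eq_zero.1 ((Finset.sum_eq_zero_iff_of_nonneg fun k _ => mul_self_nonneg _).1 h.symm k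
      (Finset.mem_univ k))
  refine hpos.ne' (Matrix.det_eq_zero_of_row_eq_zero i fun j => ?_)
  rw [secondMoment_apply]
  simp [hrow]

/-- Full rank propagates because 1 + γW is invertible, so no row ever vanishes and normalization is
effective. The index starts at l + 1 because the input itself need not be normalized. -/
lemma hidden_mem_normalized_and_det_pos (hγ : IsSmallStep d b γ) (hN : N ≠ 0)
    {X : Matrix (Fin d) (Fin N) ℝ} (hX : X.rank = d) {V : ℕ → Matrix (Fin d) (Fin d) ℝ}
    (hV : ∀ l, V l ∈ box d d b) (l : ℕ) :
    hidden γ X V (l + 1) ∈ normalized d N ∧ 0 < (secondMoment (hidden γ X V (l + 1))).det := by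
  have hdet : ∀ l, 0 < (secondMoment (hidden γ X V l)).det := by
    intro l
    induction l with
    | zero => exact det_secondMoment_pos hN hX
    | succ l ih =>
      have hA : 0 < (1 + γ • V l).det := by linarith [hγ.det_ge _ (hV l)]
      exact (log_det_secondMoment_layer (gram_diag_pos_of_det_pos hN ih hA) hA ih).1
  refine ⟨?_, hdet _⟩
  have hA : 0 < (1 + γ • V l).det := by linarith [hγ.det_ge _ (hV l)]
  exact layer_mem_normalized hN (gram_diag_pos_of_det_pos hN (hdet l) hA)

section Retraction

/-- The matrix of ones is a row-normalized state. -/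
lemma ones_mem_normalized : (Matrix.of fun _ _ => 1 : Matrix (Fin d) (Fin N) ℝ) ∈ normalized d N :=
  fun i => by simp

open Classical in
/-- A measurable retraction onto the row-normalized states. -/
def retract (H : Matrix (Fin d) (Fin N) ℝ) : normalized d N :=
  ⟨if H ∈ normalized d N then H else Matrix.of fun _ _ => 1, by
    split_ifs with h
    · exact h
    · exact ones_mem_normalized⟩

lemma measurable_retract : Measurable (retract : Matrix (Fin d) (Fin N) ℝ → normalized d N) :=
  Measurable.subtype_mk
    (Measurable.ite isCompact_normalized.measurableSet measurable_id measurable_const)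

lemma coe_retract {H : Matrix (Fin d) (Fin N) ℝ} (hH : H ∈ normalized d N) :
    (retract H : Matrix (Fin d) (Fin N) ℝ) = H := by
  simp [retract, hH]

instance compactSpace_normalized : CompactSpace (normalized d N) :=
  isCompact_iff_compactSpace.1 isCompact_normalized

/-- The chain on the row-normalized states. -/
def step (γ : ℝ) (s : normalized d N) (W : Matrix (Fin d) (Fin d) ℝ) : normalized d N :=
  retract (layer γ W (s : Matrix (Fin d) (Fin N) ℝ))

lemma measurable_step (γ : ℝ) :
    Measurable fun q : normalized d N × Matrix (Fin d) (Fin d) ℝ => step γ q.1 q.2 := by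
  have h : Measurable fun q : normalized d N × Matrix (Fin d) (Fin d) ℝ =>
      layer γ q.2 (q.1 : Matrix (Fin d) (Fin N) ℝ) :=
    measurable_layer_comp (measurable_subtype_coe.comp measurable_fst) measurable_snd
  have h2 := measurable_retract.comp h
  simp only [Function.comp_def] at h2
  exact h2

/-- This is the Feller property: for weights in the box the diagonal entries stay at least 1/2, so
normalization is continuous and the retraction does nothing. -/
lemma IsSmallStep.continuous_step (hγ : IsSmallStep d b γ) (hN : N ≠ 0)
    {W : Matrix (Fin d) (Fin d) ℝ} (hW : W ∈ box d d b) :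
    Continuous fun s : normalized d N => step γ s W := by
  refine continuous_induced_rng.2 ?_
  have e : (Subtype.val ∘ fun s : normalized d N => step γ s W)
      = fun s : normalized d N => layer γ W (s : Matrix (Fin d) (Fin N) ℝ) := by
    funext s
    exact coe_retract (hγ.layer_mem_normalized hN hW s.2)
  rw [e]
  refine continuous_iff_continuousAt.2 fun s => ?_
  have h := ContinuousAt.comp (f := fun s : normalized d N => (s : Matrix (Fin d) (Fin N) ℝ))
    (x := s) (continuousAt_layer (γ := γ) (W := W) fun i => by
      linarith [hγ.gram_diag_pos hN hW s.2 i]) continuous_subtype_val.continuousAt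
  simp only [Function.comp_def] at h
  exact h

end Retraction

section Weights

variable {Ω : Type*} [MeasurableSpace Ω] {P : Measure Ω}
  {W : ℕ → Ω → Matrix (Fin d) (Fin d) ℝ}

lemma hidden_congr {X : Matrix (Fin d) (Fin N) ℝ} {V V' : ℕ → Matrix (Fin d) (Fin d) ℝ} {l : ℕ}
    (h : ∀ k < l, V k = V' k) : hidden γ X V l = hidden γ X V' l := by
  induction l with
  | zero => rfl
  | succ l ih => rw [hidden, hidden, h l l.lt_succ_self, ih fun k hk => h k (hk.trans l.lt_succ_self)]

lemma measurable_hidden (γ : ℝ) (X : Matrix (Fin d) (Fin N) ℝ) (l : ℕ) :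
    Measurable fun V : ℕ → Matrix (Fin d) (Fin d) ℝ => hidden γ X V l := by
  induction l with
  | zero => exact measurable_const
  | succ l ih => exact measurable_layer_comp ih (measurable_pi_apply l)

/-- `HasLaw` gives only almost everywhere measurable entries; a modification on a null set makes the
whole trajectory measurable. -/
lemma IsIIDWeights.exists_measurable (hW : IsIIDWeights p P W) :
    ∃ W' : ℕ → Ω → Matrix (Fin d) (Fin d) ℝ, IsIIDWeights p P W' ∧
      (∀ l i j, Measurable fun ω => W' l ω i j) ∧ ∀ᵐ ω ∂P, ∀ l, W l ω = W' l ω := by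
  have hae : ∀ l i j, (fun ω => W l ω i j) =ᵐ[P] (hW.hasLaw l i j).aemeasurable.mk :=
    fun l i j => (hW.hasLaw l i j).aemeasurable.ae_eq_mk
  refine ⟨fun l ω => Matrix.of fun i j => (hW.hasLaw l i j).aemeasurable.mk _ ω, ⟨?_, ?_⟩, ?_, ?_⟩
  · exact fun l i j => (hW.hasLaw l i j).congr (hae l i j).symm
  · exact hW.indep.congr fun q => hae q.1 q.2.1 q.2.2
  · exact fun l i j => (hW.hasLaw l i j).aemeasurable.measurable_mk
  · have h : ∀ᵐ ω ∂P, ∀ l i j, W l ω i j = (hW.hasLaw l i j).aemeasurable.mk _ ω := by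
      simp only [ae_all_iff]
      exact hae
    filter_upwards [h] with ω hω l
    ext i j
    exact hω l i j

lemma measurable_of_entries (hm : ∀ l i j, Measurable fun ω => W l ω i j) (l : ℕ) :
    Measurable (W l) :=
  measurable_pi_iff.2 fun i => measurable_pi_iff.2 fun j => hm l i j

lemma IsIIDWeights.map_eq [IsProbabilityMeasure P] (hW : IsIIDWeights p P W)
    (hm : ∀ l i j, Measurable fun ω => W l ω i j) (l : ℕ) :
    P.map (W l) = weightMatrixLaw d p := by
  have hind : iIndepFun (fun (q : Fin d × Fin d) ω => W l ω q.1 q.2) P :=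
    hW.indep.precomp (g := fun q : Fin d × Fin d => (l, q.1, q.2)) fun q q' h => by
      simpa [Prod.ext_iff] using h
  have h := (iIndepFun_iff_map_fun_eq_pi_map
    fun q : Fin d × Fin d => (hm l q.1 q.2).aemeasurable).1 hind
  have hp : (fun q : Fin d × Fin d => P.map (fun ω => W l ω q.1 q.2)) = fun _ => p :=
    funext fun q => (hW.hasLaw l q.1 q.2).map_eq
  rw [hp] at h
  rw [weightMatrixLaw, ← h, Measure.map_map measurable_of_prod
    (measurable_pi_iff.2 fun q => hm l q.1 q.2)]
  rfl

/-- The weights of a layer are independent of the previous ones. -/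
lemma IsIIDWeights.indepFun_of_measurable (hW : IsIIDWeights p P W)
    (hm : ∀ l i j, Measurable fun ω => W l ω i j) {α : Type*} [MeasurableSpace α] (l : ℕ)
    {f : (ℕ → Matrix (Fin d) (Fin d) ℝ) → α} (hf : Measurable f)
    (hdep : ∀ V V' : ℕ → Matrix (Fin d) (Fin d) ℝ, (∀ k < l, V k = V' k) → f V = f V') :
    IndepFun (fun ω => f fun k => W k ω) (W l) P := by
  let S : Finset (ℕ × Fin d × Fin d) := Finset.range l ×ˢ Finset.univ
  let T : Finset (ℕ × Fin d × Fin d) := {l} ×ˢ Finset.univ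
  have hST : Disjoint S T := by
    rw [Finset.disjoint_left]
    intro q hS hT
    simp only [S, T, Finset.mem_product, Finset.mem_range, Finset.mem_singleton] at hS hT
    omega
  have h := hW.indep.indepFun_finset S T hST fun q => hm q.1 q.2.1 q.2.2
  classical
  -- Layers from `l` on are filled with zeros, which is harmless because `f` ignores them.
  let ext : (S → ℝ) → ℕ → Matrix (Fin d) (Fin d) ℝ := fun x k => Matrix.of fun i j =>
    if hk : (k, i, j) ∈ S then x ⟨(k, i, j), hk⟩ else 0
  let last : (T → ℝ) → Matrix (Fin d) (Fin d) ℝ := fun x => Matrix.of fun i j =>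
    x ⟨(l, i, j), by simp [T]⟩
  have hext : Measurable ext := by
    refine measurable_pi_iff.2 fun k => measurable_pi_iff.2 fun i => measurable_pi_iff.2 fun j => ?_
    simp only [ext, Matrix.of_apply]
    split_ifs
    · exact measurable_pi_apply _
    · exact measurable_const
  have hlast : Measurable last :=
    measurable_pi_iff.2 fun i => measurable_pi_iff.2 fun j => measurable_pi_apply _
  have h2 := h.comp (hf.comp hext) hlast
  have e : (fun ω => f fun k => W k ω)
      = (f ∘ ext) ∘ fun ω (q : S) => W (q : ℕ × Fin d × Fin d).1 ω q.1.2.1 q.1.2.2 := ?_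
  · rw [e]; exact h2
  funext ω
  refine hdep _ _ fun k hk => ?_
  ext i j
  have : (k, i, j) ∈ S := by simp [S, hk]
  simp [ext, this]

end Weights

end SmallStep

/-! ### Convergence of averages along almost every trajectory. -/

section Averages

variable {d N : ℕ} {γ b B : ℝ} {p : Measure ℝ}
  {Ω : Type*} [MeasurableSpace Ω] {P : Measure Ω} [IsProbabilityMeasure P]
  {X : Matrix (Fin d) (Fin N) ℝ} {W : ℕ → Ω → Matrix (Fin d) (Fin d) ℝ}
  {E : Set (Matrix (Fin d) (Fin N) ℝ)} {ν : Measure (Matrix (Fin d) (Fin N) ℝ)}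

lemma sum_Icc_one_eq_sum_range {M : Type*} [AddCommMonoid M] (f : ℕ → M) (L : ℕ) :
    ∑ l ∈ Finset.Icc 1 L, f l = ∑ l ∈ Finset.range L, f (l + 1) := by
  rw [Finset.range_eq_Ico, Finset.sum_Ico_add' f 0 L 1]
  rfl

lemma card_filter_Icc_one_eq (q : ℕ → Prop) [DecidablePred q] (L : ℕ) :
    ((Finset.Icc 1 L).filter q).card = ((Finset.range L).filter fun l => q (l + 1)).card := by
  simp only [Finset.card_filter]
  exact sum_Icc_one_eq_sum_range _ L

/-- The state after `l + 1` layers, as an element of the space of row-normalized states. -/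
def state (γ : ℝ) (X : Matrix (Fin d) (Fin N) ℝ) (W : ℕ → Ω → Matrix (Fin d) (Fin d) ℝ) (l : ℕ)
    (ω : Ω) : normalized d N :=
  retract (hidden γ X (fun k => W k ω) (l + 1))

omit [IsProbabilityMeasure P] in
lemma measurable_state (hm : ∀ l i j, Measurable fun ω => W l ω i j) (l : ℕ) :
    Measurable (state γ X W l) := by
  have h1 : Measurable fun ω => (fun k => W k ω : ℕ → Matrix (Fin d) (Fin d) ℝ) :=
    measurable_pi_iff.2 fun k => measurable_of_entries hm k
  have h2 := measurable_retract.comp ((measurable_hidden γ X (l + 1)).comp h1)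
  simp only [Function.comp_def] at h2
  exact h2

omit [IsProbabilityMeasure P] in
-- `state` number l is the representation after l + 1 layers and involves W_0, …, W_l only; hence
-- the next weight is number l + 1.
lemma IsIIDWeights.indepFun_state (hW : IsIIDWeights p P W)
    (hm : ∀ l i j, Measurable fun ω => W l ω i j) {k l : ℕ} (hkl : k < l) :
    IndepFun (fun ω => ((state γ X W k ω, W (k + 1) ω), state γ X W l ω)) (W (l + 1)) P := by
  have hr : ∀ n, Measurable fun V : ℕ → Matrix (Fin d) (Fin d) ℝ => retract (hidden γ X V n) :=
    fun n => by
      have h := measurable_retract.comp (measurable_hidden γ X n)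
      simp only [Function.comp_def] at h
      exact h
  refine hW.indepFun_of_measurable hm (l + 1)
    (f := fun V => ((retract (hidden γ X V (k + 1)), V (k + 1)), retract (hidden γ X V (l + 1))))
    (((hr (k + 1)).prodMk (measurable_pi_apply _)).prodMk (hr (l + 1))) fun V V' h => ?_
  rw [hidden_congr (l := k + 1) fun n hn => h n (by omega),
    hidden_congr (l := l + 1) fun n hn => h n (by omega), h (k + 1) (by omega)]

lemma IsIIDWeights.ae_mem_box (hp : IsWeightLaw B p) (hBb : B ≤ b) (hW : IsIIDWeights p P W)
    (hm : ∀ l i j, Measurable fun ω => W l ω i j) : ∀ᵐ ω ∂P, ∀ l, W l ω ∈ box d d b := by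
  rw [ae_all_iff]
  intro l
  have h := hp.ae_mem_box (d := d) hBb
  rw [← hW.map_eq hm l] at h
  exact ae_of_ae_map (measurable_of_entries hm l).aemeasurable h

/-- The limit measures live on the subtype of normalized states, whereas uniqueness concerns
measures on all matrices. For weights in the box `step` and `layer` agree, so invariance transfers.
-/
lemma IsSmallStep.isInvariant_map_coe (hγ : IsSmallStep d b γ) (hBb : B ≤ b) (hN : N ≠ 0)
    (hp : IsWeightLaw B p) {ν : Measure (normalized d N)} [IsProbabilityMeasure ν]
    (hν : (ν.prod (weightMatrixLaw d p)).map (Function.uncurry (step γ)) = ν) :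
    IsInvariant γ p (ν.map ((↑) : normalized d N → Matrix (Fin d) (Fin N) ℝ)) := by
  have hprob := hp.isProbabilityMeasure_weightMatrixLaw (d := d)
  have hc : Measurable ((↑) : normalized d N → Matrix (Fin d) (Fin N) ℝ) := measurable_subtype_coe
  have hstep : Measurable (Function.uncurry (step γ (d := d) (N := N))) := measurable_step γ
  refine ⟨Measure.isProbabilityMeasure_map hc.aemeasurable, ?_⟩
  have h1 : (ν.map ((↑) : normalized d N → Matrix (Fin d) (Fin N) ℝ)).prod (weightMatrixLaw d p)
      = (ν.prod (weightMatrixLaw d p)).map (Prod.map (↑) id) := by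
    rw [← Measure.map_prod_map _ _ hc measurable_id, Measure.map_id]
  rw [h1, Measure.map_map (measurable_layer γ) (hc.prodMap measurable_id)]
  conv_rhs => rw [← hν]
  rw [Measure.map_map hc hstep]
  refine Measure.map_congr ?_
  have hbox : ∀ᵐ q ∂(ν.prod (weightMatrixLaw d p)), q.2 ∈ box d d b :=
    Measure.quasiMeasurePreserving_snd.ae (hp.ae_mem_box hBb)
  filter_upwards [hbox] with q hq
  exact (coe_retract (hγ.layer_mem_normalized hN hq q.1.2)).symm

/-- Along almost every trajectory, the averages of every continuous function of the second moment
matrix converge to its expectation under the invariant distribution. -/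
theorem IsSetting.ae_tendsto_average (hγ : IsSmallStep d b γ) (hBb : B ≤ b) (hN : N ≠ 0)
    (hS : IsSetting B p γ X P W E ν) (hm : ∀ l i j, Measurable fun ω => W l ω i j) :
    ∀ᵐ ω ∂P, ∀ F : C(Matrix (Fin d) (Fin d) ℝ, ℝ), Tendsto (fun L : ℕ => (1 / (L : ℝ)) *
      ∑ l ∈ Finset.Icc 1 L, F (secondMoment (hidden γ X (fun k => W k ω) l))) atTop
      (𝓝 (∫ H, F (secondMoment H) ∂ν)) := by
  classical
  have hp := hS.law
  have hprob := hp.isProbabilityMeasure_weightMatrixLaw (d := d)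
  have hstep : Measurable (Function.uncurry (step γ (d := d) (N := N))) := measurable_step γ
  have hbox := hS.weights.ae_mem_box hp hBb hm
  have hgood : ∀ ω, (∀ l, W l ω ∈ box d d b) → ∀ l, (state γ X W l ω : Matrix (Fin d) (Fin N) ℝ)
      = hidden γ X (fun k => W k ω) (l + 1) := fun ω hω l =>
    coe_retract (hidden_mem_normalized_and_det_pos hγ hN hS.fullRank hω l).1
  have hasym := ae_isAsymptoticallyInvariant (P := P) (μ := weightMatrixLaw d p)
    (h := state γ X W) (w := fun l => W (l + 1)) (fun l => measurable_state hm l)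
    (fun l => measurable_of_entries hm (l + 1)) (fun l => hS.weights.map_eq hm (l + 1))
    (fun k l hkl => hS.weights.indepFun_state hm hkl) hstep (by
      filter_upwards [hbox] with ω hω l
      rw [step, hgood ω hω l]
      rfl)
  filter_upwards [hbox, hasym, hS.stays] with ω hω hx hst F
  have hF : Continuous fun s : normalized d N => F (secondMoment (s : Matrix (Fin d) (Fin N) ℝ)) :=
    F.continuous.comp (continuous_secondMoment.comp continuous_subtype_val)
  have key := tendsto_average_of_unique (μ := weightMatrixLaw d p) hstep (by
    filter_upwards [hp.ae_mem_box hBb] with V hV using hγ.continuous_step hN hV) hx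
    (E := (↑) ⁻¹' E) (fun ε hε => ?_) ⟨_, hF⟩ (c := ∫ H, F (secondMoment H) ∂ν) ?_
  · refine key.congr fun L => ?_
    rw [sum_Icc_one_eq_sum_range]
    congr 1
    refine Finset.sum_congr rfl fun l _ => ?_
    simp only [ContinuousMap.coe_mk]
    rw [hgood ω hω l]
  · obtain ⟨K, hK, hKE, hL⟩ := hst ε hε
    refine ⟨(↑) ⁻¹' K, hK.isClosed.preimage continuous_subtype_val, Set.preimage_mono hKE, ?_⟩
    filter_upwards [hL] with L hL
    rw [card_filter_Icc_one_eq] at hL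
    convert hL using 4
    rename_i l _
    simp only [Set.mem_preimage]
    rw [hgood ω hω l]
  · intro ν' hν' hinv hcar
    have h1 := hγ.isInvariant_map_coe hBb hN hp hinv
    have hemb : MeasurableEmbedding ((↑) : normalized d N → Matrix (Fin d) (Fin N) ℝ) :=
      MeasurableEmbedding.subtype_coe isCompact_normalized.measurableSet
    have h2 : ∀ᵐ H ∂(ν'.map ((↑) : normalized d N → Matrix (Fin d) (Fin N) ℝ)), H ∈ E :=
      hemb.ae_map_iff.2 hcar
    -- Uniqueness up to the law of M suffices, since the observable depends on H only through M.
    have h3 := hS.uniqueInvariant.unique _ h1 h2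
    have hsm : Measurable (secondMoment : Matrix (Fin d) (Fin N) ℝ → _) :=
      continuous_secondMoment.measurable
    have h4 : ∀ ρ : Measure (Matrix (Fin d) (Fin N) ℝ), ∫ H, F (secondMoment H) ∂ρ
        = ∫ M, F M ∂(ρ.map secondMoment) := fun ρ => by
      rw [integral_map hsm.aemeasurable F.continuous.measurable.aestronglyMeasurable]
    rw [h4, ← h3, ← h4]
    exact (hemb.integral_map fun H => F (secondMoment H)).symm

end Averages

/-! ### Consequences of stationarity: the moment identity and non-degeneracy. -/

section Stationarity

variable {d N : ℕ} {γ b B : ℝ} {p : Measure ℝ}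
  {Ω : Type*} [MeasurableSpace Ω] {P : Measure Ω}
  {X : Matrix (Fin d) (Fin N) ℝ} {W : ℕ → Ω → Matrix (Fin d) (Fin d) ℝ}
  {E : Set (Matrix (Fin d) (Fin N) ℝ)} {ν : Measure (Matrix (Fin d) (Fin N) ℝ)}

lemma IsSetting.ae_mem_normalized (hS : IsSetting B p γ X P W E ν) :
    ∀ᵐ H ∂ν, H ∈ normalized d N :=
  hS.uniqueInvariant.carried.mono fun _ h => hS.states h

lemma IsSetting.integrable_of_continuous (hS : IsSetting B p γ X P W E ν)
    {f : Matrix (Fin d) (Fin N) ℝ → ℝ} (hf : Continuous f) : Integrable f ν := by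
  have := hS.uniqueInvariant.isInvariant.prob
  have h := hf.continuousOn.integrableOn_compact (μ := ν) isCompact_normalized
  rwa [IntegrableOn, Measure.restrict_eq_self_of_ae_mem hS.ae_mem_normalized] at h

lemma continuous_frobSq_secondMoment :
    Continuous fun H : Matrix (Fin d) (Fin N) ℝ => frobSq (secondMoment H) := by
  unfold frobSq secondMoment
  fun_prop

lemma continuous_trace_secondMoment_pow (n : ℕ) :
    Continuous fun H : Matrix (Fin d) (Fin N) ℝ => (secondMoment H ^ n).trace := by
  unfold secondMoment
  fun_prop

lemma continuous_sum_sq_diag :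
    Continuous fun H : Matrix (Fin d) (Fin N) ℝ => ∑ i, (secondMoment H ^ 2) i i ^ 2 := by
  have h : Continuous fun H : Matrix (Fin d) (Fin N) ℝ => secondMoment H ^ 2 := 
    continuous_secondMoment.pow 2
  exact continuous_finsetSum _ fun i _ => (h.matrix_elem i i).pow 2

/-- The stationarity of the expected squared Frobenius norm. -/
lemma IsSetting.abs_stationarity_le (hγ : IsSmallStep d b γ) (hBb : B ≤ b) (hN : N ≠ 0)
    (hS : IsSetting B p γ X P W E ν) :
    |8 * (∫ H, ∑ i, (secondMoment H ^ 2) i i ^ 2 ∂ν - ∫ H, (secondMoment H ^ 3).trace ∂ν)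
      + 2 * d ^ 2 - 2 * ∫ H, frobSq (secondMoment H) ∂ν| * γ ^ 2
      ≤ d ^ 2 * (10 ^ 7 * (γ * (d * b)) ^ 3) := by
  have hp := hS.law
  have hprob := hp.isProbabilityMeasure_weightMatrixLaw (d := d)
  have hνp := hS.uniqueInvariant.isInvariant.prob
  set F : Matrix (Fin d) (Fin N) ℝ → ℝ := fun H => frobSq (secondMoment H) with hFdef
  have hFc : Continuous F := continuous_frobSq_secondMoment
  have hFi : Integrable F ν := hS.integrable_of_continuous hFc
  have hinv := hS.uniqueInvariant.isInvariant.invariant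
  have hFi' : Integrable (fun q : Matrix (Fin d) (Fin N) ℝ × Matrix (Fin d) (Fin d) ℝ =>
      F (layer γ q.2 q.1)) (ν.prod (weightMatrixLaw d p)) := by
    have h : Integrable F ((ν.prod (weightMatrixLaw d p)).map fun q => layer γ q.2 q.1) := by
      rw [hinv]; exact hFi
    exact (integrable_map_measure hFc.aestronglyMeasurable (measurable_layer γ).aemeasurable).1 h
  have h1 : ∫ H, F H ∂ν = ∫ H, ∫ V, F (layer γ V H) ∂(weightMatrixLaw d p) ∂ν := by
    conv_lhs => rw [← hinv]
    rw [integral_map (measurable_layer γ).aemeasurable hFc.aestronglyMeasurable,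
      integral_prod _ hFi']
  have i1 : Integrable (fun H => ∑ i, (secondMoment H ^ 2) i i ^ 2) ν :=
    hS.integrable_of_continuous continuous_sum_sq_diag
  have i2 : Integrable (fun H => (secondMoment H ^ 3).trace) ν :=
    hS.integrable_of_continuous (continuous_trace_secondMoment_pow 3)
  set D : Matrix (Fin d) (Fin N) ℝ → ℝ := fun H => F H + γ ^ 2 *
    (8 * (∑ i, (secondMoment H ^ 2) i i ^ 2 - (secondMoment H ^ 3).trace) + 2 * d ^ 2 - 2 * F H)
    with hD
  have i3 : Integrable (fun H => 8 * (∑ i, (secondMoment H ^ 2) i i ^ 2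
      - (secondMoment H ^ 3).trace) + 2 * (d : ℝ) ^ 2 - 2 * F H) ν :=
    (((i1.sub i2).const_mul 8).add (integrable_const _)).sub (hFi.const_mul 2)
  have hDi : Integrable D ν := hFi.add (i3.const_mul _)
  have hDint : ∫ H, D H ∂ν = ∫ H, F H ∂ν + γ ^ 2 * (8 * (∫ H, ∑ i, (secondMoment H ^ 2) i i ^ 2 ∂ν
      - ∫ H, (secondMoment H ^ 3).trace ∂ν) + 2 * d ^ 2 - 2 * ∫ H, F H ∂ν) := by
    rw [hD, integral_add hFi (i3.const_mul _), integral_const_mul,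
      integral_sub (by exact ((i1.sub i2).const_mul 8).add (integrable_const _)) (hFi.const_mul 2),
      integral_add (by exact (i1.sub i2).const_mul 8) (integrable_const _), integral_const_mul,
      integral_sub i1 i2, integral_const_mul 2 F]
    simp
  have hdiff : |∫ H, (∫ V, F (layer γ V H) ∂(weightMatrixLaw d p) - D H) ∂ν|
      ≤ d ^ 2 * (10 ^ 7 * (γ * (d * b)) ^ 3) := by
    have h := norm_integral_le_of_norm_le_const (μ := ν)
      (f := fun H => ∫ V, F (layer γ V H) ∂(weightMatrixLaw d p) - D H)
      (C := d ^ 2 * (10 ^ 7 * (γ * (d * b)) ^ 3)) ?_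
    · simpa using h
    filter_upwards [hS.ae_mem_normalized] with H hH
    have hM := isCorrelation_secondMoment hN hH
    have e : ∫ V, F (layer γ V H) ∂(weightMatrixLaw d p)
        = ∫ V, ∑ i, ∑ j, gram γ V (secondMoment H) i j ^ 2 / (gram γ V (secondMoment H) i i
          * gram γ V (secondMoment H) j j) ∂(weightMatrixLaw d p) := by
      refine integral_congr_ae ?_
      filter_upwards [hp.ae_mem_box hBb] with V hV
      refine Finset.sum_congr rfl fun i _ => Finset.sum_congr rfl fun j _ => ?_
      exact secondMoment_layer_sq (fun i => by linarith [hγ.gram_diag_pos hN hV hH i]) i j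
    rw [e]
    exact hp.abs_integral_frobSq_sub_le hBb hM hγ.one_le hγ.pos.le hγ.mul_le
  -- Invariance equates the mean of F with the mean of its one-step expectation, so the zeroth-order
  -- terms cancel and the drift of order γ² is left against the remainder.
  rw [integral_sub hFi'.integral_prod_left hDi, ← h1, hDint, sub_add_cancel_left, abs_neg, abs_mul,
    abs_of_nonneg (sq_nonneg γ), mul_comm] at hdiff
  exact hdiff

/-- The chain does not degenerate: the expected squared Frobenius norm under the invariant
distribution stays away from its maximum `d²`, since `log det` of the second moment matrix is
bounded above. -/
lemma IsSetting.integral_frobSq_le [IsProbabilityMeasure P] (hγ : IsSmallStep d b γ) (hBb : B ≤ b)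
    (hN : N ≠ 0) (hS : IsSetting B p γ X P W E ν) (hm : ∀ l i j, Measurable fun ω => W l ω i j)
    {C : ℝ} (hC : -(γ ^ 2 * d) - C * γ ^ 3
      ≤ ∫ V, 2 * Real.log (1 + γ • V).det ∂(weightMatrixLaw d p)) :
    γ ^ 2 * (2 * ∫ H, frobSq (secondMoment H) ∂ν - d ^ 2 - d)
      ≤ C * γ ^ 3 + d * (60 * (γ * (d * b)) ^ 3) := by
  classical
  have hp := hS.law
  have hprob := hp.isProbabilityMeasure_weightMatrixLaw (d := d)
  set K : Set (normalized d N × Matrix (Fin d) (Fin d) ℝ) := Set.univ ×ˢ box d d b with hK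
  have hKc : IsCompact K := isCompact_univ.prod (isCompact_box b)
  let ψ : normalized d N × Matrix (Fin d) (Fin d) ℝ → ℝ := fun q =>
    2 * Real.log (1 + γ • q.2).det
      - ∑ i, Real.log (gram γ q.2 (secondMoment (q.1 : Matrix (Fin d) (Fin N) ℝ)) i i)
  have hdetc : Continuous fun q : normalized d N × Matrix (Fin d) (Fin d) ℝ =>
      (1 + γ • q.2).det := by fun_prop
  have hgramc : ∀ i, Continuous fun q : normalized d N × Matrix (Fin d) (Fin d) ℝ =>
      gram γ q.2 (secondMoment (q.1 : Matrix (Fin d) (Fin N) ℝ)) i i := fun i =>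
    ((continuous_secondMoment_pre γ).comp
      ((continuous_subtype_val.comp continuous_fst).prodMk continuous_snd)).matrix_elem i i
  have hψm : Measurable ψ :=
    (hdetc.measurable.log.const_mul 2).sub
      (Finset.measurable_sum _ fun i _ => (hgramc i).measurable.log)
  have hψc : ContinuousOn ψ K := by
    refine ContinuousOn.sub (continuousOn_const.mul (hdetc.continuousOn.log fun q hq => ?_))
      (continuousOn_finsetSum _ fun i _ => (hgramc i).continuousOn.log fun q hq => ?_)
    · linarith [hγ.det_ge q.2 hq.2]
    · linarith [hγ.gram_diag_pos hN hq.2 q.1.2 i]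
  obtain ⟨R, hR⟩ := hKc.exists_bound_of_continuousOn hψc
  -- The law of large numbers needs a globally bounded function; `ψ` is bounded only for weights in
  -- the box, where they almost surely are.
  set φ : normalized d N × Matrix (Fin d) (Fin d) ℝ → ℝ := K.indicator ψ with hφ
  have hφm : Measurable φ := hψm.indicator
    (MeasurableSet.univ.prod (isCompact_box b).measurableSet)
  have hφC : ∀ q, |φ q| ≤ |R| := fun q => by
    by_cases hq : q ∈ K
    · rw [hφ, Set.indicator_of_mem hq]
      exact (hR q hq).trans (le_abs_self R)
    · rw [hφ, Set.indicator_of_notMem hq, abs_zero]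
      exact abs_nonneg R
  have hφeq : ∀ (s : normalized d N) (V : Matrix (Fin d) (Fin d) ℝ), V ∈ box d d b →
      φ (s, V) = ψ (s, V) := fun s V hV =>
    Set.indicator_of_mem (show (s, V) ∈ K from ⟨Set.mem_univ _, hV⟩) ψ
  set R' := C * γ ^ 3 + d * (60 * (γ * (d * b)) ^ 3) with hR'
  have hlow : ∀ s : normalized d N,
      γ ^ 2 * (2 * frobSq (secondMoment (s : Matrix (Fin d) (Fin N) ℝ)) - d ^ 2 - d) - R'
        ≤ ∫ V, φ (s, V) ∂(weightMatrixLaw d p) := by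
    intro s
    have hM := isCorrelation_secondMoment hN s.2
    set M := secondMoment (s : Matrix (Fin d) (Fin N) ℝ)
    have e : ∫ V, φ (s, V) ∂(weightMatrixLaw d p) = ∫ V, (2 * Real.log (1 + γ • V).det
        - ∑ i, Real.log (gram γ V M i i)) ∂(weightMatrixLaw d p) := by
      refine integral_congr_ae ?_
      filter_upwards [hp.ae_mem_box hBb] with V hV using hφeq s V hV
    have j1 : Integrable (fun V : Matrix (Fin d) (Fin d) ℝ => 2 * Real.log (1 + γ • V).det)
        (weightMatrixLaw d p) := by
      refine hp.integrable_of_continuousOn hBb (continuousOn_const.mul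
        (ContinuousOn.log (by fun_prop) fun V hV => ?_))
      linarith [hγ.det_ge V hV]
    have j2 : ∀ i, Integrable (fun V => Real.log (gram γ V M i i)) (weightMatrixLaw d p) := by
      intro i
      refine hp.integrable_of_continuousOn hBb
        (ContinuousOn.log (continuous_gram_left i i).continuousOn fun V hV => ?_)
      linarith [hγ.gram_diag_pos hN hV s.2 i]
    rw [e, integral_sub j1 (integrable_finsetSum _ fun i _ => j2 i),
      integral_finsetSum _ fun i _ => j2 i]
    have h1 := Finset.sum_le_sum fun i (_ : i ∈ Finset.univ) =>
      hp.integral_log_gram_diag_le hBb hM hγ.one_le hγ.pos.le hγ.mul_le i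
    have h2 : ∑ i : Fin d, (γ ^ 2 * (d - 2 * (M ^ 2) i i) + 60 * (γ * (d * b)) ^ 3)
        = γ ^ 2 * (d ^ 2 - 2 * frobSq M) + d * (60 * (γ * (d * b)) ^ 3) := by
      rw [hM.frobSq_eq, Finset.sum_add_distrib, ← Finset.mul_sum, Finset.sum_sub_distrib,
        ← Finset.mul_sum]
      simp only [Finset.sum_const, Finset.card_univ, Fintype.card_fin, nsmul_eq_mul]
      ring
    rw [h2] at h1
    rw [hR']
    linarith
  have hLLN := ae_tendsto_average_sub_integral (P := P) (μ := weightMatrixLaw d p)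
    (h := state γ X W) (w := fun l => W (l + 1)) (fun l => measurable_state hm l)
    (fun l => measurable_of_entries hm (l + 1)) (fun l => hS.weights.map_eq hm (l + 1))
    (fun k l hkl => hS.weights.indepFun_state hm hkl) hφm hφC
  -- The claim is deterministic, so one good trajectory suffices. Working along it avoids
  -- integrating log det under ν, which might charge singular matrices.
  obtain ⟨ω, hω, hlln, havg⟩ := ((hS.weights.ae_mem_box hp hBb hm).and
    (hLLN.and (hS.ae_tendsto_average hγ hBb hN hm))).exists
  have hfrobc : Continuous (frobSq : Matrix (Fin d) (Fin d) ℝ → ℝ) := by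
    unfold frobSq; fun_prop
  have hfrob := havg ⟨frobSq, hfrobc⟩
  set H : ℕ → Matrix (Fin d) (Fin N) ℝ := hidden γ X fun k => W k ω with hH
  have hmem : ∀ l, H (l + 1) ∈ normalized d N ∧ 0 < (secondMoment (H (l + 1))).det :=
    hidden_mem_normalized_and_det_pos hγ hN hS.fullRank hω
  have hstate : ∀ l, (state γ X W l ω : Matrix (Fin d) (Fin N) ℝ) = H (l + 1) := fun l =>
    coe_retract (hmem l).1
  have hinc : ∀ l, φ (state γ X W l ω, W (l + 1) ω) = Real.log (secondMoment (H (l + 1 + 1))).det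
      - Real.log (secondMoment (H (l + 1))).det := by
    intro l
    rw [hφeq _ _ (hω _)]
    simp only [ψ]
    rw [hstate l]
    have hA : 0 < (1 + γ • W (l + 1) ω).det := by linarith [hγ.det_ge _ (hω (l + 1))]
    have h := (log_det_secondMoment_layer (fun i => by
      linarith [hγ.gram_diag_pos hN (hω (l + 1)) (hmem l).1 i]) hA (hmem l).2).2
    have e : H (l + 1 + 1) = layer γ (W (l + 1) ω) (H (l + 1)) := rfl
    rw [e, h]
    ring
  have hlogle : ∀ l, Real.log (secondMoment (H (l + 1))).det ≤ Real.log d.factorial := fun l =>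
    Real.log_le_log (hmem l).2 ((le_abs_self _).trans (abs_det_secondMoment_le hN (hmem l).1))
  set R₀ := Real.log d.factorial - Real.log (secondMoment (H (0 + 1))).det with hR₀
  -- The increments of log det telescope, and log det ≤ log d!, so their average is at most a
  -- constant over L.
  have hub : ∀ L : ℕ, (1 / (L : ℝ)) * ∑ l ∈ Finset.range L, φ (state γ X W l ω, W (l + 1) ω)
      ≤ R₀ / L := fun L => by
    rw [Finset.sum_congr rfl fun l _ => hinc l,
      Finset.sum_range_sub fun l => Real.log (secondMoment (H (l + 1))).det,
      div_mul_eq_mul_div, one_mul]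
    gcongr
    exact sub_le_sub_right (hlogle L) _
  have hlim0 : Tendsto (fun L : ℕ => R₀ / (L : ℝ)) atTop (𝓝 0) :=
    Tendsto.div_atTop tendsto_const_nhds tendsto_natCast_atTop_atTop
  have hlim : Tendsto (fun L : ℕ => R₀ / (L : ℝ) - (1 / (L : ℝ)) * ∑ l ∈ Finset.range L,
      (φ (state γ X W l ω, W (l + 1) ω) - ∫ V, φ (state γ X W l ω, V) ∂(weightMatrixLaw d p)))
      atTop (𝓝 0) := by
    simpa using hlim0.sub hlln
  set q := ∫ H, frobSq (secondMoment H) ∂ν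
  have hfrob' : Tendsto (fun L : ℕ => γ ^ 2 * (2 * ((1 / (L : ℝ)) *
      ∑ l ∈ Finset.Icc 1 L, frobSq (secondMoment (H l))) - d ^ 2 - d) - R') atTop
      (𝓝 (γ ^ 2 * (2 * q - d ^ 2 - d) - R')) :=
    ((((hfrob.const_mul 2).sub_const _).sub_const _).const_mul _).sub_const _
  -- The conditional mean increments dominate the drift bound, and their average is the average of
  -- the increments minus fluctuations that vanish. Hence the limit of the drift bound is at most 0.
  have hle := le_of_tendsto_of_tendsto hfrob' hlim ?_
  · linarith
  filter_upwards [eventually_ge_atTop 1] with L hL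
  have hL0 : (0 : ℝ) < L := by exact_mod_cast hL
  rw [Finset.sum_sub_distrib, mul_sub]
  have h1 : γ ^ 2 * (2 * ((1 / (L : ℝ)) * ∑ l ∈ Finset.Icc 1 L, frobSq (secondMoment (H l)))
      - d ^ 2 - d) - R' = (1 / (L : ℝ)) * ∑ l ∈ Finset.range L,
        (γ ^ 2 * (2 * frobSq (secondMoment (H (l + 1))) - d ^ 2 - d) - R') := by
    rw [sum_Icc_one_eq_sum_range]
    simp only [Finset.sum_sub_distrib, ← Finset.mul_sum, Finset.sum_const, Finset.card_range,
      nsmul_eq_mul]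
    field_simp
  have h2 : (1 / (L : ℝ)) * ∑ l ∈ Finset.range L,
        (γ ^ 2 * (2 * frobSq (secondMoment (H (l + 1))) - d ^ 2 - d) - R')
      ≤ (1 / (L : ℝ)) * ∑ l ∈ Finset.range L,
        ∫ V, φ (state γ X W l ω, V) ∂(weightMatrixLaw d p) := by
    gcongr with l hl
    have := hlow (state γ X W l ω)
    rwa [hstate l] at this
  linarith [hub L]

end Stationarity

/-! ### Bounds on the regularity constant and on the mean stable rank. -/

section Regularity

variable {d N : ℕ} {γ b B : ℝ} {p : Measure ℝ}
  {Ω : Type*} [MeasurableSpace Ω] {P : Measure Ω}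
  {X : Matrix (Fin d) (Fin N) ℝ} {W : ℕ → Ω → Matrix (Fin d) (Fin d) ℝ}
  {E : Set (Matrix (Fin d) (Fin N) ℝ)} {ν : Measure (Matrix (Fin d) (Fin N) ℝ)}

/-- The step size is so small that the remainders of the expected drifts are negligible. -/
structure IsAdmissibleStep (d : ℕ) (b γ : ℝ) : Prop extends IsSmallStep d b γ where
  remainder : ∃ C : ℝ, 0 ≤ C ∧ (∀ (B : ℝ) (p : Measure ℝ), IsWeightLaw B p → B ≤ b →
      -(γ ^ 2 * d) - C * γ ^ 3 ≤ ∫ V, 2 * Real.log (1 + γ • V).det ∂(weightMatrixLaw d p)) ∧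
    (d ^ 2 * (10 ^ 7 * (d * b) ^ 3) + C + d * (60 * (d * b) ^ 3)) * γ ≤ 1

lemma exists_isAdmissibleStep (d : ℕ) (hb : 1 ≤ b) :
    ∃ γ₀ : ℝ, 0 < γ₀ ∧ ∀ γ, 0 < γ → γ < γ₀ → IsAdmissibleStep d b γ := by
  obtain ⟨C, γ₁, hC0, hγ₁0, -, hdet, hlog⟩ := exists_integral_log_det_ge (b := b) d (by linarith)
  set R := d ^ 2 * (10 ^ 7 * (d * b) ^ 3) + C + d * (60 * (d * b) ^ 3) with hR
  have hR0 : 0 ≤ R := by positivity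
  refine ⟨min γ₁ (min (1 / (8 * (d * b + 1))) (1 / (R + 1))), by positivity, fun γ hγ0 hγ => ?_⟩
  obtain ⟨h1, h2, h3⟩ := by simpa [lt_min_iff] using hγ
  refine ⟨⟨hb, hγ0, ?_, hdet γ hγ0.le h1.le⟩, C, hC0, fun B p hp hB => hlog B p hp hB γ hγ0.le h1.le,
    ?_⟩
  · have : γ * (8 * (d * b + 1)) ≤ 1 := by
      rw [← le_div_iff₀ (by positivity)]
      have e : (1 : ℝ) / (8 * (d * b + 1)) = (d * b + 1)⁻¹ * 8⁻¹ := by field_simp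
      rw [e]; exact h2.le
    linarith
  · have : γ * (R + 1) ≤ 1 := by
      rw [← le_div_iff₀ (by positivity), one_div]
      exact h3.le
    linarith

lemma IsSetting.ne_zero (hd : 2 ≤ d) (hS : IsSetting B p γ X P W E ν) : N ≠ 0 := by
  rintro rfl
  have h := X.rank_le_width
  rw [hS.fullRank] at h
  omega

lemma IsSetting.exists_measurable (hS : IsSetting B p γ X P W E ν) :
    ∃ W' : ℕ → Ω → Matrix (Fin d) (Fin d) ℝ, IsSetting B p γ X P W' E ν ∧
      (∀ l i j, Measurable fun ω => W' l ω i j) ∧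
      ∀ᵐ ω ∂P, (fun k => W k ω) = fun k => W' k ω := by
  obtain ⟨W', hW', hm, hae⟩ := hS.weights.exists_measurable
  have hae' : ∀ᵐ ω ∂P, (fun k => W k ω) = fun k => W' k ω := hae.mono fun ω h => funext h
  refine ⟨W', ⟨hS.law, hS.fullRank, hW', hS.states, hS.uniqueInvariant, ?_⟩, hm, hae'⟩
  filter_upwards [hS.stays, hae'] with ω h1 h2
  rwa [← h2]

lemma regularity_eq (ν : Measure (Matrix (Fin d) (Fin N) ℝ)) :
    regularity ν = (∫ H, ∑ i, (secondMoment H ^ 2) i i ^ 2 ∂ν)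
      / ∫ H, (secondMoment H ^ 3).trace ∂ν := by
  simp only [regularity, trace_diagonal_diag_sq]

/-- The regularity constant lies strictly between `0` and `1`, and controls the expected squared
Frobenius norm of the second moment matrix. -/
theorem IsSetting.regularity_bounds [IsProbabilityMeasure P] (hγ : IsAdmissibleStep d b γ)
    (hBb : B ≤ b) (hd : 2 ≤ d) (hS : IsSetting B p γ X P W E ν) :
    0 < regularity ν ∧ regularity ν < 1 ∧
      (1 - regularity ν) * (∫ H, frobSq (secondMoment H) ∂ν) ^ 2 ≤ (d : ℝ) ^ 3 ∧
      (d : ℝ) ≤ ∫ H, frobSq (secondMoment H) ∂ν := by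
  have hN := hS.ne_zero hd
  obtain ⟨W', hS', hm, -⟩ := hS.exists_measurable
  obtain ⟨C, hC0, hC, hR⟩ := hγ.remainder
  have hνp := hS.uniqueInvariant.isInvariant.prob
  have hst := hS.abs_stationarity_le hγ.toIsSmallStep hBb hN
  have hdrift := hS'.integral_frobSq_le hγ.toIsSmallStep hBb hN hm (hC B p hS.law hBb)
  rw [regularity_eq]
  have hnorm := hS.ae_mem_normalized
  have i1 : Integrable (fun H => ∑ i, (secondMoment H ^ 2) i i ^ 2) ν :=
    hS.integrable_of_continuous continuous_sum_sq_diag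
  have i2 : Integrable (fun H => (secondMoment H ^ 3).trace) ν :=
    hS.integrable_of_continuous (continuous_trace_secondMoment_pow 3)
  have i3 : Integrable (fun H => frobSq (secondMoment H)) ν :=
    hS.integrable_of_continuous continuous_frobSq_secondMoment
  have i4 : Integrable (fun H => frobSq (secondMoment H) ^ 2) ν :=
    hS.integrable_of_continuous (continuous_frobSq_secondMoment.pow 2)
  set q := ∫ H, frobSq (secondMoment H) ∂ν with hq
  set S := ∫ H, ∑ i, (secondMoment H ^ 2) i i ^ 2 ∂ν with hSdef
  set T := ∫ H, (secondMoment H ^ 3).trace ∂ν with hT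
  have hd2 : (2 : ℝ) ≤ d := by exact_mod_cast hd
  have hdq : (d : ℝ) ≤ q := by
    have : ∫ H, (d : ℝ) ∂ν ≤ q := integral_mono_ae (integrable_const _) i3 (by
      filter_upwards [hnorm] with H hH using (isCorrelation_secondMoment hN hH).le_frobSq)
    simpa using this
  have hdS : (d : ℝ) ≤ S := by
    have : ∫ H, (d : ℝ) ∂ν ≤ S := integral_mono_ae (integrable_const _) i1 (by
      filter_upwards [hnorm] with H hH
      have hM := isCorrelation_secondMoment hN hH
      have h1 : ∀ i, 1 ≤ (secondMoment H ^ 2) i i ^ 2 := fun i => by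
        have h := Finset.single_le_sum (f := fun j => secondMoment H i j ^ 2)
          (fun k _ => sq_nonneg _) (Finset.mem_univ i)
        rw [hM.diag, one_pow, ← hM.sq_apply_self] at h
        exact one_le_pow₀ h
      calc (d : ℝ) = ∑ _i : Fin d, (1 : ℝ) := by simp
        _ ≤ _ := Finset.sum_le_sum fun i _ => h1 i)
    simpa using this
  -- Jensen's inequality for the square, from the mean of (‖M‖_F² - q)² ≥ 0, followed by the
  -- pointwise Cauchy–Schwarz bound.
  have hqT : q ^ 2 ≤ d * T := by
    have h1 : ∫ H, (2 * q * frobSq (secondMoment H) - q ^ 2) ∂ν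
        ≤ ∫ H, frobSq (secondMoment H) ^ 2 ∂ν :=
      integral_mono ((i3.const_mul _).sub (integrable_const _)) i4 fun H => by
        have := sq_nonneg (frobSq (secondMoment H) - q)
        simp only
        linarith
    have h2 : ∫ H, frobSq (secondMoment H) ^ 2 ∂ν ≤ ∫ H, d * (secondMoment H ^ 3).trace ∂ν :=
      integral_mono_ae i4 (i2.const_mul _) (by
        filter_upwards [hnorm] with H hH using frobSq_sq_le hN hH)
    rw [integral_sub (i3.const_mul _) (integrable_const _), integral_const_mul] at h1
    rw [integral_const_mul] at h2
    simp only [integral_const, probReal_univ, one_smul] at h1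
    linarith
  have hγ0 := hγ.pos
  have hγ2 : 0 < γ ^ 2 := by positivity
  have hT0 : 0 < T := by
    have h1 : 0 < d * T := lt_of_lt_of_le (by nlinarith) hqT
    exact pos_of_mul_pos_right h1 (by positivity)
  have e1 : |8 * (S - T) + 2 * d ^ 2 - 2 * q| ≤ d ^ 2 * (10 ^ 7 * (d * b) ^ 3) * γ := by
    refine le_of_mul_le_mul_right (hst.trans_eq ?_) hγ2
    ring
  have e2 : 2 * q - d ^ 2 - d ≤ (C + d * (60 * (d * b) ^ 3)) * γ := by
    refine le_of_mul_le_mul_left (hdrift.trans_eq ?_) hγ2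
    ring
  have e3 := abs_le.1 e1
  have hb0 : 0 ≤ b := by linarith [hγ.one_le]
  have hpos1 : 0 ≤ (C + d * (60 * (d * b) ^ 3)) * γ := by positivity
  -- The total error is at most 1 by the choice of γ, so 8(T - S) ≥ d² - d - 1 ≥ 1 for d ≥ 2.
  have hlt : S < T := by nlinarith
  refine ⟨div_pos (by linarith) hT0, (div_lt_one hT0).2 hlt, ?_, hdq⟩
  have hα : 1 - S / T = (T - S) / T := by field_simp
  rw [hα, div_mul_eq_mul_div, div_le_iff₀ hT0]
  have h5 : T - S ≤ d ^ 2 := by nlinarith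
  calc (T - S) * q ^ 2 ≤ d ^ 2 * (d * T) := by
        refine mul_le_mul h5 hqT (by positivity) (by positivity)
    _ = _ := by ring

/-- The lower bound on the expected stable rank. -/
lemma IsSetting.sqrt_le_integral [IsProbabilityMeasure P] (hγ : IsAdmissibleStep d b γ)
    (hBb : B ≤ b) (hd : 2 ≤ d) (hS : IsSetting B p γ X P W E ν) {F : Matrix (Fin d) (Fin d) ℝ → ℝ}
    (hF : Continuous F) (hFr : ∀ H ∈ normalized d N, F (secondMoment H) = stableRank H) :
    √(1 - regularity ν) * √(d : ℝ) ≤ ∫ H, F (secondMoment H) ∂ν := by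
  have hN := hS.ne_zero hd
  have hνp := hS.uniqueInvariant.isInvariant.prob
  obtain ⟨-, hα1, hα, hdq⟩ := hS.regularity_bounds hγ hBb hd
  have i3 : Integrable (fun H => frobSq (secondMoment H)) ν :=
    hS.integrable_of_continuous continuous_frobSq_secondMoment
  set q := ∫ H, frobSq (secondMoment H) ∂ν with hq
  have hd2 : (2 : ℝ) ≤ d := by exact_mod_cast hd
  have hq0 : 0 < q := by linarith
  have h1 : (d : ℝ) ^ 2 / q ≤ ∫ H, F (secondMoment H) ∂ν := by
    -- Jensen's inequality through the tangent line of the convex function t ↦ d²/t at t = q.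
    have h2 : ∫ H, (2 * d ^ 2 / q - d ^ 2 / q ^ 2 * frobSq (secondMoment H)) ∂ν
        ≤ ∫ H, F (secondMoment H) ∂ν := by
      refine integral_mono_ae ((integrable_const _).sub (i3.const_mul _))
        (hS.integrable_of_continuous (hF.comp continuous_secondMoment)) ?_
      filter_upwards [hS.ae_mem_normalized] with H hH
      have hM := isCorrelation_secondMoment hN hH
      rw [hFr H hH, stableRank, hM.trace_eq]
      have hT0 : 0 < frobSq (secondMoment H) := by linarith [hM.le_frobSq]
      rw [le_div_iff₀ hT0]
      set t := frobSq (secondMoment H)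
      have e : (d : ℝ) ^ 2 - (2 * d ^ 2 / q - d ^ 2 / q ^ 2 * t) * t = d ^ 2 * (1 - t / q) ^ 2 := by
        field_simp; ring
      have : 0 ≤ (d : ℝ) ^ 2 * (1 - t / q) ^ 2 := by positivity
      linarith
    rw [integral_sub (integrable_const _) (i3.const_mul _), integral_const_mul, ← hq] at h2
    simp only [integral_const, probReal_univ, one_smul] at h2
    refine le_trans (le_of_eq ?_) h2
    field_simp; ring
  refine le_trans ?_ h1
  rw [le_div_iff₀ hq0, ← Real.sqrt_mul (by linarith)]
  refine abs_le_of_sq_le_sq' ?_ (by positivity) |>.2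
  rw [mul_pow, Real.sq_sqrt (mul_nonneg (by linarith) (by linarith))]
  have h3 := mul_le_mul_of_nonneg_left hα (by positivity : (0 : ℝ) ≤ d)
  have e : (1 - regularity ν) * d * q ^ 2 = d * ((1 - regularity ν) * q ^ 2) := by ring
  rw [e]
  exact h3.trans_eq (by ring)

end Regularity

/-! ### Zero sets of polynomials under atomless product laws. -/

section Polynomial

variable {p : Measure ℝ} [IsProbabilityMeasure p]

/-- The zero set of a nonzero polynomial is null for a product of atomless laws. -/
lemma measure_pi_fin_zero_set (hp : ∀ x, p {x} = 0) {n : ℕ} {Q : MvPolynomial (Fin n) ℝ}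
    (hQ : Q ≠ 0) : Measure.pi (fun _ : Fin n => p) {x | MvPolynomial.eval x Q = 0} = 0 := by
  have hatom : NullSingletonClass p := ⟨hp⟩
  induction n with
  | zero =>
    have : {x : Fin 0 → ℝ | MvPolynomial.eval x Q = 0} = ∅ := by
      refine Set.eq_empty_iff_forall_notMem.2 fun x hx => hQ ?_
      exact MvPolynomial.funext fun y => by
        rw [Subsingleton.elim y x, map_zero]; exact hx
    rw [this, measure_empty]
  | succ n ih =>
    -- `Q` is read as a polynomial in one variable over polynomials in the others. By induction its
    -- leading coefficient is almost surely nonzero; then only finitely many values of the remaining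
    -- variable are roots, and they carry no mass.
    set f := MvPolynomial.finSuccEquiv ℝ n Q with hf
    have hf0 : f ≠ 0 := by
      rw [hf, Ne, EmbeddingLike.map_eq_zero_iff]; exact hQ
    have hlead := ih (Polynomial.leadingCoeff_ne_zero.2 hf0)
    have hmeas : MeasurableSet {x : Fin (n + 1) → ℝ | MvPolynomial.eval x Q = 0} :=
      (isClosed_eq (MvPolynomial.continuous_eval Q) continuous_const).measurableSet
    have hmp := (measurePreserving_piFinSuccAbove (fun _ : Fin (n + 1) => p) 0).symm
    rw [← hmp.measure_preimage hmeas.nullMeasurableSet, ← Measure.prod_swap,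
      Measure.map_apply measurable_swap (hmp.measurable hmeas), Measure.measure_prod_null
        (measurable_swap (hmp.measurable hmeas))]
    have hae : ∀ᵐ s ∂(Measure.pi fun _ : Fin n => p), MvPolynomial.eval s f.leadingCoeff ≠ 0 := by
      rw [ae_iff]
      simpa using hlead
    filter_upwards [hae] with s hs
    have hg : f.map (MvPolynomial.eval s) ≠ 0 := fun h => hs (by
      rw [Polynomial.leadingCoeff, ← Polynomial.coeff_map, h, Polynomial.coeff_zero])
    have hset : Prod.mk s ⁻¹' (Prod.swap ⁻¹' ((MeasurableEquiv.piFinSuccAbove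
        (fun _ : Fin (n + 1) => ℝ) 0).symm ⁻¹' {x | MvPolynomial.eval x Q = 0}))
        ⊆ ((f.map (MvPolynomial.eval s)).roots.toFinset : Set ℝ) := by
      intro y hy
      simp only [Set.mem_preimage, Prod.swap_prod_mk, Set.mem_ofPred_eq] at hy
      rw [Finset.mem_coe, Multiset.mem_toFinset, Polynomial.mem_roots hg, Polynomial.IsRoot.def]
      have hcons : (MeasurableEquiv.piFinSuccAbove (fun _ : Fin (n + 1) => ℝ) 0).symm (y, s)
          = Fin.cons y s := Fin.insertNth_zero' y s
      rw [← MvPolynomial.eval_eq_eval_mv_eval', ← hcons, hy]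
    refine measure_mono_null hset ?_
    exact (Finset.finite_toSet _).measure_zero p

lemma measure_pi_zero_set (hp : ∀ x, p {x} = 0) {ι : Type*} [Fintype ι] {Q : MvPolynomial ι ℝ}
    (hQ : Q ≠ 0) : Measure.pi (fun _ : ι => p) {x | MvPolynomial.eval x Q = 0} = 0 := by
  let e := Fintype.equivFin ι
  have hQ' : MvPolynomial.rename e Q ≠ 0 := fun h =>
    hQ (MvPolynomial.rename_injective e e.injective (by rw [h, map_zero]))
  have h0 := measure_pi_fin_zero_set hp hQ'
  have hmeas : MeasurableSet {x : Fin (Fintype.card ι) → ℝ |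
      MvPolynomial.eval x (MvPolynomial.rename e Q) = 0} :=
    (isClosed_eq (MvPolynomial.continuous_eval _) continuous_const).measurableSet
  have hmp := measurePreserving_piCongrLeft (fun _ : Fin (Fintype.card ι) => p) e
  rw [← hmp.measure_preimage hmeas.nullMeasurableSet] at h0
  refine measure_mono_null (fun x hx => ?_) h0
  simp only [Set.mem_preimage, Set.mem_ofPred_eq, MvPolynomial.eval_rename]
  have : (MeasurableEquiv.piCongrLeft (fun _ : Fin (Fintype.card ι) => ℝ) e) x ∘ e = x := by
    funext i
    exact MeasurableEquiv.piCongrLeft_apply_apply (β := fun _ => ℝ) e x i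
  rw [this]
  exact hx

end Polynomial

/-! ### Absence of eigenvalue atoms under the invariant distribution. -/

section Spectrum

variable {d N : ℕ} {γ b B : ℝ} {p : Measure ℝ}
  {Ω : Type*} [MeasurableSpace Ω] {P : Measure Ω}
  {X : Matrix (Fin d) (Fin N) ℝ} {W : ℕ → Ω → Matrix (Fin d) (Fin d) ℝ}
  {E : Set (Matrix (Fin d) (Fin N) ℝ)} {ν : Measure (Matrix (Fin d) (Fin N) ℝ)}

/-- `det (G - τ diag G)` for the matrix `G` before normalization, as a polynomial in the weights. -/
def spectralPolynomial (γ τ : ℝ) (M : Matrix (Fin d) (Fin d) ℝ) :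
    MvPolynomial (Fin d × Fin d) ℝ :=
  let A : Matrix (Fin d) (Fin d) (MvPolynomial (Fin d × Fin d) ℝ) :=
    1 + Matrix.of fun i j => MvPolynomial.C γ * MvPolynomial.X (i, j)
  let G := A * M.map MvPolynomial.C * A.transpose
  (G - Matrix.diagonal fun i => MvPolynomial.C τ * G i i).det

lemma eval_spectralPolynomial (γ τ : ℝ) (M : Matrix (Fin d) (Fin d) ℝ) (w : Fin d × Fin d → ℝ) :
    MvPolynomial.eval w (spectralPolynomial γ τ M)
      = (gram γ (Matrix.of fun i j => w (i, j)) M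
        - Matrix.diagonal fun i => τ * gram γ (Matrix.of fun i j => w (i, j)) M i i).det := by
  have hA : (1 + Matrix.of fun i j => MvPolynomial.C γ * MvPolynomial.X (i, j) :
      Matrix (Fin d) (Fin d) (MvPolynomial (Fin d × Fin d) ℝ)).map (MvPolynomial.eval w)
      = 1 + γ • Matrix.of fun i j => w (i, j) := by
    ext i j
    simp [Matrix.one_apply, apply_ite (MvPolynomial.eval w)]
  have hM : (M.map (MvPolynomial.C (σ := Fin d × Fin d))).map (MvPolynomial.eval w) = M := by
    ext i j
    simp
  have hG : ((1 + Matrix.of fun i j => MvPolynomial.C γ * MvPolynomial.X (i, j) :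
      Matrix (Fin d) (Fin d) (MvPolynomial (Fin d × Fin d) ℝ)) * M.map MvPolynomial.C
      * (1 + Matrix.of fun i j => MvPolynomial.C γ * MvPolynomial.X (i, j) :
      Matrix (Fin d) (Fin d) (MvPolynomial (Fin d × Fin d) ℝ)).transpose).map (MvPolynomial.eval w)
      = gram γ (Matrix.of fun i j => w (i, j)) M := by
    rw [Matrix.map_mul, Matrix.map_mul, Matrix.transpose_map, hA, hM, gram]
  have hGij := fun i j => congrFun (congrFun hG i) j
  simp only [Matrix.map_apply] at hGij
  simp only [spectralPolynomial, RingHom.map_det]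
  congr 1
  ext i j
  simp only [RingHom.mapMatrix_apply, Matrix.map_apply, Matrix.sub_apply, Matrix.diagonal_apply,
    map_sub, apply_ite (MvPolynomial.eval w), map_mul, map_zero, hGij, MvPolynomial.eval_C]
  rw [Matrix.transpose_map, hA, hM, gram]

/-- A rank-one perturbation of -τ times the identity has determinant (-τ)^d(1 - d/τ), nonzero as d >
τ. For d = 1 and τ = 1 it would vanish. -/
lemma det_ones_sub_ne_zero {τ : ℝ} (hd : 2 ≤ d) (hτ0 : 0 < τ) (hτ1 : τ ≤ 1) :
    ((Matrix.of fun _ _ => 1 : Matrix (Fin d) (Fin d) ℝ) - Matrix.diagonal fun _ => τ).det ≠ 0 := by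
  have hd2 : (2 : ℝ) ≤ d := by exact_mod_cast hd
  have e : (Matrix.of fun _ _ => 1 : Matrix (Fin d) (Fin d) ℝ) - Matrix.diagonal (fun _ => τ)
      = (-τ) • (1 + Matrix.replicateCol Unit (fun _ : Fin d => -τ⁻¹)
        * Matrix.replicateRow Unit (fun _ : Fin d => (1 : ℝ))) := by
    ext i j
    simp [Matrix.mul_apply, Matrix.one_apply, Matrix.diagonal_apply]
    split_ifs <;> field_simp <;> ring
  rw [e, Matrix.det_smul, Matrix.det_one_add_replicateCol_mul_replicateRow]
  refine mul_ne_zero (pow_ne_zero _ (by linarith)) ?_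
  simp only [dotProduct, one_mul, Finset.sum_const, Finset.card_univ, Fintype.card_fin,
    nsmul_eq_mul]
  have : 1 < d * τ⁻¹ := by
    rw [← div_eq_mul_inv, one_lt_div hτ0]; linarith
  linarith

/-- Weights are chosen so that every row of A = 1 + γW is the same basis vector. Then AMAᵀ is the
all-ones matrix, because M has unit diagonal, and the polynomial takes a nonzero value. These
weights need not lie in the support of the law. -/
lemma spectralPolynomial_ne_zero {τ : ℝ} {M : Matrix (Fin d) (Fin d) ℝ} (hM : ∀ i, M i i = 1)
    (hγ : 0 < γ) (hd : 2 ≤ d) (hτ0 : 0 < τ) (hτ1 : τ ≤ 1) : spectralPolynomial γ τ M ≠ 0 := by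
  intro h
  let i₀ : Fin d := ⟨0, by omega⟩
  let A : Matrix (Fin d) (Fin d) ℝ := Matrix.of fun _ j => if j = i₀ then 1 else 0
  have h1 := eval_spectralPolynomial γ τ M fun q => γ⁻¹ * (A - 1) q.1 q.2
  have hA : (1 + γ • (Matrix.of fun i j => γ⁻¹ * (A - 1) i j) : Matrix (Fin d) (Fin d) ℝ) = A := by
    ext i j
    simp only [Matrix.add_apply, Matrix.smul_apply, Matrix.of_apply, smul_eq_mul,
      Matrix.sub_apply]
    field_simp
    ring
  have hG : gram γ (Matrix.of fun i j => γ⁻¹ * (A - 1) i j) M = Matrix.of fun _ _ => 1 := by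
    rw [gram, hA]
    ext i j
    simp [A, Matrix.mul_apply, hM]
  rw [h, map_zero, hG] at h1
  simp only [Matrix.of_apply, mul_one] at h1
  exact det_ones_sub_ne_zero hd hτ0 hτ1 h1.symm

/-- With D = diag(G)^(-1/2), the normalized matrix minus τ equals D(G - τ diag G)D. Dropping the
invertible factors D clears the square roots and leaves a polynomial in the weights. -/
lemma det_secondMoment_layer_sub {W : Matrix (Fin d) (Fin d) ℝ} {H : Matrix (Fin d) (Fin N) ℝ}
    (τ : ℝ) (hG : ∀ i, 0 < gram γ W (secondMoment H) i i)
    (h0 : (secondMoment (layer γ W H) - Matrix.diagonal fun _ => τ).det = 0) :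
    (gram γ W (secondMoment H)
      - Matrix.diagonal fun i => τ * gram γ W (secondMoment H) i i).det = 0 := by
  set G := gram γ W (secondMoment H) with hGdef
  set D := Matrix.diagonal fun i => G i i ^ (-(1 / 2) : ℝ) with hD
  have e : secondMoment (layer γ W H) - Matrix.diagonal (fun _ => τ)
      = D * (G - Matrix.diagonal fun i => τ * G i i) * D := by
    rw [secondMoment_layer, ← hGdef, ← hD, Matrix.mul_sub, Matrix.sub_mul]
    congr 1
    rw [hD, Matrix.diagonal_mul_diagonal, Matrix.diagonal_mul_diagonal]
    congr 1
    funext i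
    have := rpow_neg_half_sq (hG i)
    have hne := (hG i).ne'
    calc τ = τ * (G i i * (G i i)⁻¹) := by rw [mul_inv_cancel₀ hne, mul_one]
      _ = _ := by rw [← this]; ring
  have hDne : D.det ≠ 0 := by
    rw [hD, Matrix.det_diagonal]
    exact (Finset.prod_pos fun i _ => Real.rpow_pos_of_pos (hG i) _).ne'
  rw [e, Matrix.det_mul, Matrix.det_mul] at h0
  simpa [hDne] using h0

lemma IsWeightLaw.ae_ne_zero (hp : IsWeightLaw B p) {f : Matrix (Fin d) (Fin d) ℝ → ℝ}
    (hf : Continuous f) {Q : MvPolynomial (Fin d × Fin d) ℝ} (hQ : Q ≠ 0)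
    (hfQ : ∀ w, MvPolynomial.eval w Q = f (Matrix.of fun i j => w (i, j))) :
    ∀ᵐ V ∂(weightMatrixLaw d p), f V ≠ 0 := by
  have hpp := hp.prob
  have hm : MeasurableSet {V | f V ≠ 0} := (isClosed_eq hf continuous_const).measurableSet.compl
  rw [weightMatrixLaw]
  refine (ae_map_iff measurable_of_prod.aemeasurable hm).2 ?_
  rw [ae_iff]
  refine measure_mono_null (fun w hw => ?_) (measure_pi_zero_set (p := p) hp.noAtoms hQ)
  rw [Set.mem_ofPred_eq, hfQ]
  simpa using hw

/-- The spectrum of the second moment matrix has no atoms in `(0, 1]` under the invariant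
distribution. -/
lemma IsSetting.ae_det_sub_ne_zero (hγ : IsSmallStep d b γ) (hBb : B ≤ b) (hd : 2 ≤ d)
    (hS : IsSetting B p γ X P W E ν) {τ : ℝ} (hτ0 : 0 < τ) (hτ1 : τ ≤ 1) :
    ∀ᵐ H ∂ν, (secondMoment H - Matrix.diagonal fun _ => τ).det ≠ 0 := by
  have hN := hS.ne_zero hd
  have hp := hS.law
  have hprob := hp.isProbabilityMeasure_weightMatrixLaw (d := d)
  have hνp := hS.uniqueInvariant.isInvariant.prob
  have hc : Continuous fun H : Matrix (Fin d) (Fin N) ℝ =>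
      (secondMoment H - Matrix.diagonal fun _ => τ).det :=
    (continuous_secondMoment.sub continuous_const).matrix_det
  set Z : Set (Matrix (Fin d) (Fin N) ℝ) :=
    {H | (secondMoment H - Matrix.diagonal fun _ => τ).det = 0} with hZ
  have hZm : MeasurableSet Z := (isClosed_eq hc continuous_const).measurableSet
  -- By invariance ν Z is the probability that one layer from a stationary state lands in Z; by
  -- Fubini it is enough to fix the state and vary the weights.
  have hnull : ν Z = 0 := by
    have hZm' : MeasurableSet ((fun q : Matrix (Fin d) (Fin N) ℝ × Matrix (Fin d) (Fin d) ℝ =>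
        layer γ q.2 q.1) ⁻¹' Z) := measurable_layer γ hZm
    rw [← hS.uniqueInvariant.isInvariant.invariant, Measure.map_apply (measurable_layer γ) hZm,
      Measure.measure_prod_null hZm']
    filter_upwards [hS.ae_mem_normalized] with H hH
    have hM := isCorrelation_secondMoment hN hH
    have hcg : Continuous fun V => gram γ V (secondMoment H) := by
      unfold gram
      fun_prop
    have hcont : Continuous fun V => (gram γ V (secondMoment H)
        - Matrix.diagonal fun i => τ * gram γ V (secondMoment H) i i).det :=
      (hcg.sub (Continuous.matrix_diagonal (continuous_pi fun i =>
        continuous_const.mul (hcg.matrix_elem i i)))).matrix_det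
    have hpoly := hp.ae_ne_zero hcont
      (spectralPolynomial_ne_zero (M := secondMoment H) hM.diag hγ.pos hd hτ0 hτ1)
      fun w => eval_spectralPolynomial γ τ _ w
    have hsub : ∀ᵐ V ∂(weightMatrixLaw d p), ¬ layer γ V H ∈ Z := by
      filter_upwards [hpoly, hp.ae_mem_box hBb] with V hV hbox h
      rw [hZ, Set.mem_ofPred_eq] at h
      exact hV (det_secondMoment_layer_sub τ
        (fun i => by linarith [hγ.gram_diag_pos hN hbox hH i]) h)
    exact measure_eq_zero_iff_ae_notMem.2 hsub
  rw [ae_iff]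
  simpa using hnull

end Spectrum

/-! ### The soft rank: comparison with the stable rank and convergence of its averages. -/

section SoftRank

variable {d N : ℕ}

/-- The eigenvalues of the second moment matrix. -/
def momentEigenvalue (H : Matrix (Fin d) (Fin N) ℝ) (i : Fin d) : ℝ :=
  (Matrix.isHermitian_mul_conjTranspose_self H).eigenvalues i / (N : ℝ)

lemma momentEigenvalue_nonneg (H : Matrix (Fin d) (Fin N) ℝ) (i : Fin d) :
    0 ≤ momentEigenvalue H i :=
  div_nonneg ((Matrix.posSemidef_self_mul_conjTranspose H).eigenvalues_nonneg i) (Nat.cast_nonneg _)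

open Classical in
lemma softRank_eq (τ : ℝ) (H : Matrix (Fin d) (Fin N) ℝ) :
    softRank τ H = (Finset.univ.filter fun i => τ ≤ momentEigenvalue H i).card := by
  have h : ∀ i, singularValue H i ^ 2 / (N : ℝ) = momentEigenvalue H i := fun i => by
    rw [singularValue, Real.sq_sqrt
      ((Matrix.posSemidef_self_mul_conjTranspose H).eigenvalues_nonneg i), momentEigenvalue]
  simp only [softRank, h]

lemma secondMoment_eq (H : Matrix (Fin d) (Fin N) ℝ) :
    secondMoment H = (1 / (N : ℝ)) • (H * H.conjTranspose) := by
  rw [secondMoment, Matrix.conjTranspose_eq_transpose_of_trivial]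

lemma trace_pow_eq_sum (H : Matrix (Fin d) (Fin N) ℝ) (n : ℕ) :
    (secondMoment H ^ n).trace = ∑ i, momentEigenvalue H i ^ n := by
  set hA := Matrix.isHermitian_mul_conjTranspose_self H
  have h : ((H * H.conjTranspose) ^ n).trace = ∑ i, hA.eigenvalues i ^ n := by
    conv_lhs => rw [hA.spectral_theorem]
    rw [← map_pow, Matrix.diagonal_pow, Unitary.conjStarAlgAut_apply, Matrix.trace_mul_cycle,
      Unitary.star_mul_self_of_mem (SetLike.coe_mem _), Matrix.one_mul, Matrix.trace_diagonal]
    simp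
  rw [secondMoment_eq, smul_pow, Matrix.trace_smul, h, smul_eq_mul, Finset.mul_sum]
  refine Finset.sum_congr rfl fun i _ => ?_
  have e : momentEigenvalue H i = 1 / (N : ℝ) * hA.eigenvalues i := by
    rw [one_div_mul_eq_div, momentEigenvalue]
  rw [e, mul_pow]

/-- It turns polynomial sums over the spectrum into continuous functions of M, so no continuity of
individual eigenvalues is needed. -/
lemma trace_aeval_eq_sum (H : Matrix (Fin d) (Fin N) ℝ) (Q : Polynomial ℝ) :
    (Polynomial.aeval (secondMoment H) Q).trace = ∑ i, Q.eval (momentEigenvalue H i) := by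
  simp only [Polynomial.aeval_eq_sum_range, Polynomial.eval_eq_sum_range, Matrix.trace_sum,
    Matrix.trace_smul, trace_pow_eq_sum, smul_eq_mul, Finset.mul_sum]
  rw [Finset.sum_comm]

lemma abs_det_sub_eq_prod (hN : N ≠ 0) (H : Matrix (Fin d) (Fin N) ℝ) (τ : ℝ) :
    |(secondMoment H - Matrix.diagonal fun _ => τ).det| = ∏ i, |momentEigenvalue H i - τ| := by
  have hN' : (N : ℝ) ≠ 0 := by exact_mod_cast hN
  set hA := Matrix.isHermitian_mul_conjTranspose_self H with hAdef
  have h1 := Matrix.eval_charpoly (H * H.conjTranspose) ((N : ℝ) * τ)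
  rw [hA.charpoly_eq, Polynomial.eval_prod] at h1
  simp only [Polynomial.eval_sub, Polynomial.eval_X, Polynomial.eval_C] at h1
  have e : secondMoment H - Matrix.diagonal (fun _ => τ)
      = (-(1 / (N : ℝ))) • (Matrix.scalar (Fin d) ((N : ℝ) * τ) - H * H.conjTranspose) := by
    rw [secondMoment_eq]
    ext i j
    simp only [Matrix.sub_apply, Matrix.smul_apply, Matrix.scalar_apply, Matrix.diagonal_apply,
      smul_eq_mul]
    split_ifs <;> field_simp <;> ring
  rw [e, Matrix.det_smul, ← h1, Fintype.card_fin, abs_mul, abs_pow, Finset.abs_prod]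
  have hcard : |(-(1 / (N : ℝ)))| ^ d = ∏ _i : Fin d, |(-(1 / (N : ℝ)))| := by simp
  rw [hcard, ← Finset.prod_mul_distrib]
  refine Finset.prod_congr rfl fun i _ => ?_
  rw [← abs_mul, momentEigenvalue]
  congr 1
  simp only [RCLike.ofReal_real_eq_id, id]
  field_simp
  ring

section Normalized

variable {H : Matrix (Fin d) (Fin N) ℝ}

lemma sum_momentEigenvalue (hN : N ≠ 0) (hH : H ∈ normalized d N) :
    ∑ i, momentEigenvalue H i = d := by
  have h := trace_pow_eq_sum H 1
  simp only [pow_one] at h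
  rw [← h, (isCorrelation_secondMoment hN hH).trace_eq]

lemma momentEigenvalue_le (hN : N ≠ 0) (hH : H ∈ normalized d N) (i : Fin d) :
    momentEigenvalue H i ≤ d := by
  rw [← sum_momentEigenvalue hN hH]
  exact Finset.single_le_sum (fun j _ => momentEigenvalue_nonneg H j) (Finset.mem_univ i)

lemma stableRank_eq (hN : N ≠ 0) (hH : H ∈ normalized d N) :
    stableRank H = (d : ℝ) ^ 2 / frobSq (secondMoment H) := by
  rw [stableRank, (isCorrelation_secondMoment hN hH).trace_eq]

/-- The soft rank dominates the stable rank. -/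
lemma stableRank_le_softRank (hd : 0 < d) (hN : N ≠ 0) (hH : H ∈ normalized d N) {τ : ℝ}
    (hτ0 : 0 ≤ τ) (hτ1 : τ ≤ 1) : (1 - τ) ^ 2 * stableRank H ≤ softRank τ H := by
  classical
  have hM := isCorrelation_secondMoment hN hH
  have hd0 : (0 : ℝ) < d := by exact_mod_cast hd
  have hfrob : 0 < frobSq (secondMoment H) := by linarith [hM.le_frobSq]
  have hsq : ∑ i, momentEigenvalue H i ^ 2 = frobSq (secondMoment H) := by
    rw [← trace_pow_eq_sum, hM.frobSq_eq]; rfl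
  rw [softRank_eq, stableRank_eq hN hH, ← mul_div_assoc, div_le_iff₀ hfrob]
  set A := Finset.univ.filter fun i => τ ≤ momentEigenvalue H i
  set A' := Finset.univ.filter fun i => ¬ τ ≤ momentEigenvalue H i
  have hsplit : ∑ i ∈ A, momentEigenvalue H i + ∑ i ∈ A', momentEigenvalue H i = d := by
    rw [Finset.sum_filter_add_sum_filter_not, sum_momentEigenvalue hN hH]
  have hA' : ∑ i ∈ A', momentEigenvalue H i ≤ d * τ := by
    have h1 : ∑ i ∈ A', momentEigenvalue H i ≤ ∑ i ∈ A', τ :=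
      Finset.sum_le_sum fun i hi => (not_le.1 (Finset.mem_filter.1 hi).2).le
    refine h1.trans ?_
    rw [Finset.sum_const, nsmul_eq_mul]
    gcongr
    exact (Finset.card_le_univ _).trans_eq (Fintype.card_fin d)
  -- The eigenvalues sum to d and those below τ account for at most dτ; Cauchy–Schwarz on the others
  -- then bounds their number from below.
  have hA : (1 - τ) * d ≤ ∑ i ∈ A, momentEigenvalue H i := by linarith
  have hcs : (∑ i ∈ A, momentEigenvalue H i) ^ 2 ≤ A.card * ∑ i ∈ A, momentEigenvalue H i ^ 2 :=
    sq_sum_le_card_mul_sum_sq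
  calc (1 - τ) ^ 2 * (d : ℝ) ^ 2 = ((1 - τ) * d) ^ 2 := by ring
    _ ≤ (∑ i ∈ A, momentEigenvalue H i) ^ 2 := by
      have : 0 ≤ (1 - τ) * d := mul_nonneg (by linarith) hd0.le
      gcongr
    _ ≤ A.card * ∑ i ∈ A, momentEigenvalue H i ^ 2 := hcs
    _ ≤ A.card * frobSq (secondMoment H) := by
      rw [← hsq]
      gcongr
      exact Finset.subset_univ A

/-- All factors |λ - τ| are at most d, so one eigenvalue close to τ forces the determinant to be
small. The event can thus be measured by a continuous function of M. -/
lemma abs_det_sub_lt (hd : 1 ≤ d) (hN : N ≠ 0) (hH : H ∈ normalized d N) {τ δ : ℝ}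
    (hτ0 : 0 ≤ τ) (hτ1 : τ ≤ 1) {i : Fin d} (hi : |momentEigenvalue H i - τ| < δ) :
    |(secondMoment H - Matrix.diagonal fun _ => τ).det| < δ * (d : ℝ) ^ d := by
  have hd1 : (1 : ℝ) ≤ d := by exact_mod_cast hd
  have hδ : 0 < δ := (abs_nonneg _).trans_lt hi
  have hall : ∀ j, |momentEigenvalue H j - τ| ≤ d := fun j => by
    have h1 := momentEigenvalue_nonneg H j
    have h2 := momentEigenvalue_le hN hH j
    rw [abs_le]
    constructor <;> linarith
  rw [abs_det_sub_eq_prod hN, ← Finset.mul_prod_erase _ _ (Finset.mem_univ i)]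
  have h1 : ∏ j ∈ Finset.univ.erase i, |momentEigenvalue H j - τ| ≤ (d : ℝ) ^ d := by
    refine (Finset.prod_le_prod (fun _ _ => abs_nonneg _) fun j _ => hall j).trans ?_
    rw [Finset.prod_const]
    exact pow_le_pow_right₀ hd1 ((Finset.card_le_univ _).trans_eq (Fintype.card_fin d))
  calc _ ≤ |momentEigenvalue H i - τ| * (d : ℝ) ^ d := by gcongr
    _ < δ * (d : ℝ) ^ d := by gcongr

end Normalized

/-- Polynomials approximate the indicator of `[τ, ∞)` from both sides. -/
lemma exists_polynomial_sandwich (R τ : ℝ) {δ η : ℝ} (hδ : 0 < δ) (hη : 0 < η) :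
    ∃ Q₁ Q₂ : Polynomial ℝ, ∀ x ∈ Set.Icc 0 R,
      Q₁.eval x ≤ (if τ ≤ x then 1 else 0) ∧ (if τ ≤ x then 1 else 0) ≤ Q₂.eval x ∧
      Q₂.eval x - Q₁.eval x ≤ 4 * η + (if |x - τ| < δ then 1 else 0) := by
  -- Ramps of slope 1/δ: `f 0` rises on [τ, τ+δ] and `f 1` on [τ-δ, τ], so they enclose the
  -- indicator and differ only within δ of τ. Approximating each within η and shifting by η costs 4η
  -- in all.
  let f : ℝ → ℝ → ℝ := fun c x => max 0 (min 1 ((x - τ) / δ + c))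
  have hf : ∀ c, Continuous (f c) := fun c => by fun_prop
  obtain ⟨q₁, h₁⟩ := exists_polynomial_near_of_continuousOn 0 R (f 0) (hf 0).continuousOn η hη
  obtain ⟨q₂, h₂⟩ := exists_polynomial_near_of_continuousOn 0 R (f 1) (hf 1).continuousOn η hη
  refine ⟨q₁ - Polynomial.C η, q₂ + Polynomial.C η, fun x hx => ?_⟩
  have a₁ := abs_lt.1 (h₁ x hx)
  have a₂ := abs_lt.1 (h₂ x hx)
  simp only [Polynomial.eval_sub, Polynomial.eval_add, Polynomial.eval_C]
  have b0 : ∀ c, 0 ≤ f c x := fun c => le_max_left _ _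
  have b1 : ∀ c, f c x ≤ 1 := fun c => max_le zero_le_one (min_le_left _ _)
  have c1 : f 0 x ≤ if τ ≤ x then 1 else 0 := by
    split_ifs with h
    · exact b1 0
    · refine max_le le_rfl ((min_le_right _ _).trans ?_)
      rw [add_zero]
      exact div_nonpos_of_nonpos_of_nonneg (by linarith) hδ.le
  have c2 : (if τ ≤ x then 1 else 0) ≤ f 1 x := by
    split_ifs with h
    · refine le_max_of_le_right (le_min le_rfl ?_)
      have : 0 ≤ (x - τ) / δ := div_nonneg (by linarith) hδ.le
      linarith
    · exact b0 1
  have c3 : f 1 x - f 0 x ≤ if |x - τ| < δ then 1 else 0 := by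
    split_ifs with h
    · linarith [b0 0, b1 1]
    · rcases le_abs.1 (not_lt.1 h) with h' | h'
      · have : 1 ≤ f 0 x := by
          refine le_max_of_le_right (le_min le_rfl ?_)
          rw [add_zero, le_div_iff₀ hδ]; linarith
        linarith [b1 1]
      · have : f 1 x ≤ 0 := by
          refine max_le le_rfl ((min_le_right _ _).trans ?_)
          have : (x - τ) / δ ≤ -1 := by rw [div_le_iff₀ hδ]; linarith
          linarith
        linarith [b0 0]
  refine ⟨by linarith, by linarith, by linarith⟩

/-- The sets {|g| < 1/(n+1)} decrease to the null set {g = 0}. -/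
lemma exists_measure_lt {α : Type*} [MeasurableSpace α] {ν : Measure α} [IsProbabilityMeasure ν]
    {g : α → ℝ} (hg : Measurable g) (h0 : ∀ᵐ a ∂ν, g a ≠ 0) {ε : ℝ} (hε : 0 < ε) :
    ∃ δ : ℝ, 0 < δ ∧ ν.real {a | |g a| < δ} ≤ ε := by
  let S : ℕ → Set α := fun n => {a | |g a| < 1 / ((n : ℝ) + 1)}
  have hS : ∀ n, MeasurableSet (S n) := fun n => measurableSet_lt hg.norm measurable_const
  have hanti : Antitone S := fun m n hmn a ha =>
    lt_of_lt_of_le ha (one_div_le_one_div_of_le (by positivity : (0 : ℝ) < m + 1)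
      (by exact_mod_cast Nat.succ_le_succ hmn))
  have h := tendsto_measure_iInter_atTop (μ := ν) (fun n => (hS n).nullMeasurableSet) hanti
    ⟨0, measure_ne_top _ _⟩
  have hnull : ν (⋂ n, S n) = 0 := by
    refine measure_mono_null (t := {a | ¬ g a ≠ 0}) (fun a ha hne => ?_) (ae_iff.1 h0)
    have hpos : 0 < |g a| := abs_pos.2 hne
    obtain ⟨n, hn⟩ := exists_nat_one_div_lt hpos
    exact lt_asymm hn (Set.mem_iInter.1 ha n)
  rw [hnull] at h
  obtain ⟨n, hn⟩ := (h.eventually (gt_mem_nhds (ENNReal.ofReal_pos.2 hε))).exists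
  exact ⟨1 / ((n : ℝ) + 1), by positivity,
    (ENNReal.toReal_mono ENNReal.ofReal_ne_top hn.le).trans_eq (ENNReal.toReal_ofReal hε.le)⟩

/-- A sequence squeezed between convergent sequences with arbitrarily close limits converges. -/
lemma exists_tendsto_of_sandwich {a : ℕ → ℝ}
    (h : ∀ ε : ℝ, 0 < ε → ∃ (u v : ℕ → ℝ) (s t : ℝ), Tendsto u atTop (𝓝 s) ∧
      Tendsto v atTop (𝓝 t) ∧ t - s ≤ ε ∧ ∀ n, u n ≤ a n ∧ a n ≤ v n) :
    ∃ s, Tendsto a atTop (𝓝 s) := by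
  refine cauchySeq_tendsto_of_complete (Metric.cauchySeq_iff'.2 fun ε hε => ?_)
  obtain ⟨u, v, s, t, hu, hv, hst, ha⟩ := h (ε / 4) (by positivity)
  obtain ⟨n₁, h₁⟩ := Metric.tendsto_atTop.1 hu (ε / 4) (by positivity)
  obtain ⟨n₂, h₂⟩ := Metric.tendsto_atTop.1 hv (ε / 4) (by positivity)
  have key : ∀ n ≥ max n₁ n₂, s - ε / 4 < a n ∧ a n < t + ε / 4 := fun n hn => by
    have e1 := abs_lt.1 (h₁ n (le_of_max_le_left hn))
    have e2 := abs_lt.1 (h₂ n (le_of_max_le_right hn))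
    constructor
    · linarith [(ha n).1]
    · linarith [(ha n).2]
  refine ⟨max n₁ n₂, fun n hn => ?_⟩
  have k1 := key n hn
  have k2 := key _ le_rfl
  rw [Real.dist_eq, abs_lt]
  constructor <;> linarith

/-- The averages of the soft rank converge along a sequence that equidistributes for continuous
functions of the second moment matrix, if the limit does not charge the threshold. -/
theorem exists_tendsto_average_softRank (hd : 1 ≤ d) (hN : N ≠ 0)
    {ν : Measure (Matrix (Fin d) (Fin N) ℝ)} [IsProbabilityMeasure ν]
    (hν : ∀ᵐ H ∂ν, H ∈ normalized d N)
    (hint : ∀ f : Matrix (Fin d) (Fin N) ℝ → ℝ, Continuous f → Integrable f ν)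
    {H : ℕ → Matrix (Fin d) (Fin N) ℝ} (hH : ∀ l, H (l + 1) ∈ normalized d N)
    (havg : ∀ F : C(Matrix (Fin d) (Fin d) ℝ, ℝ), Tendsto (fun L : ℕ => (1 / (L : ℝ)) *
      ∑ l ∈ Finset.Icc 1 L, F (secondMoment (H l))) atTop (𝓝 (∫ H, F (secondMoment H) ∂ν)))
    {τ : ℝ} (hτ0 : 0 ≤ τ) (hτ1 : τ ≤ 1)
    (hdet : ∀ᵐ H ∂ν, (secondMoment H - Matrix.diagonal fun _ => τ).det ≠ 0) :
    ∃ s, Tendsto (fun L : ℕ => (1 / (L : ℝ)) * ∑ l ∈ Finset.Icc 1 L, (softRank τ (H l) : ℝ))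
      atTop (𝓝 s) := by
  classical
  have hd0 : (0 : ℝ) < d := by exact_mod_cast hd
  have hg : Continuous fun H : Matrix (Fin d) (Fin N) ℝ =>
      (secondMoment H - Matrix.diagonal fun _ => τ).det :=
    (continuous_secondMoment.sub continuous_const).matrix_det
  let F : Polynomial ℝ → C(Matrix (Fin d) (Fin d) ℝ, ℝ) := fun Q =>
    ⟨fun M => (Polynomial.aeval M Q).trace, (Polynomial.continuous_aeval Q).matrix_trace⟩
  have hF : ∀ Q (H : Matrix (Fin d) (Fin N) ℝ), F Q (secondMoment H)
      = ∑ i, Q.eval (momentEigenvalue H i) := fun Q H => trace_aeval_eq_sum H Q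
  have hmem : ∀ {H : Matrix (Fin d) (Fin N) ℝ}, H ∈ normalized d N → ∀ i,
      momentEigenvalue H i ∈ Set.Icc (0 : ℝ) d := fun hH i =>
    ⟨momentEigenvalue_nonneg _ i, momentEigenvalue_le hN hH i⟩
  have hsoft : ∀ H : Matrix (Fin d) (Fin N) ℝ, (softRank τ H : ℝ)
      = ∑ i, if τ ≤ momentEigenvalue H i then (1 : ℝ) else 0 := fun H => by
    rw [softRank_eq, Finset.card_filter]; push_cast; rfl
  refine exists_tendsto_of_sandwich fun ε hε => ?_
  -- The gap ε has two halves: up to d eigenvalues near τ on an event of probability ε/(2d), and an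
  -- approximation error 4·ε/(8d) for each of the d eigenvalues.
  obtain ⟨δ', hδ'0, hδ'⟩ := exists_measure_lt hg.measurable hdet
    (by positivity : 0 < ε / (2 * d))
  set δ := δ' / (d : ℝ) ^ d with hδ
  have hδ0 : 0 < δ := by positivity
  have hδd : δ * (d : ℝ) ^ d = δ' := by rw [hδ]; field_simp
  obtain ⟨Q₁, Q₂, hQ⟩ := exists_polynomial_sandwich (d : ℝ) τ hδ0
    (by positivity : 0 < ε / (8 * d))
  refine ⟨_, _, _, _, havg (F Q₁), havg (F Q₂), ?_, fun L => ⟨?_, ?_⟩⟩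
  · have hFi : ∀ Q, Integrable (fun H => F Q (secondMoment H)) ν := fun Q =>
      hint _ ((F Q).continuous.comp continuous_secondMoment)
    rw [← integral_sub (hFi Q₂) (hFi Q₁)]
    set S : Set (Matrix (Fin d) (Fin N) ℝ) :=
      {H | |(secondMoment H - Matrix.diagonal fun _ => τ).det| < δ'} with hS
    have hSm : MeasurableSet S := measurableSet_lt hg.measurable.norm measurable_const
    have hind : Integrable (S.indicator fun _ => (d : ℝ)) ν :=
      (integrable_const _).indicator hSm
    have hle : ∫ H, (F Q₂ (secondMoment H) - F Q₁ (secondMoment H)) ∂ν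
        ≤ ∫ H, (ε / 2 + S.indicator (fun _ => (d : ℝ)) H) ∂ν := by
      refine integral_mono_ae ((hFi Q₂).sub (hFi Q₁)) ((integrable_const _).add hind) ?_
      filter_upwards [hν] with H hH
      rw [hF, hF, ← Finset.sum_sub_distrib]
      have h1 : ∀ i, Q₂.eval (momentEigenvalue H i) - Q₁.eval (momentEigenvalue H i)
          ≤ ε / (2 * d) + S.indicator (fun _ => (1 : ℝ)) H := fun i => by
        refine ((hQ _ (hmem hH i)).2.2).trans (add_le_add (le_of_eq (by field_simp; ring)) ?_)
        split_ifs with hi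
        · rw [Set.indicator_of_mem]
          have := abs_det_sub_lt hd hN hH hτ0 hτ1 hi
          rwa [hδd] at this
        · exact Set.indicator_nonneg (fun _ _ => zero_le_one) _
      refine (Finset.sum_le_sum fun i _ => h1 i).trans_eq ?_
      rw [Finset.sum_const, Finset.card_univ, Fintype.card_fin, nsmul_eq_mul, mul_add]
      congr 1
      · field_simp
      · by_cases hHS : H ∈ S <;> simp [hHS]
    refine hle.trans ?_
    rw [integral_add (integrable_const _) hind, integral_indicator_const _ hSm]
    simp only [integral_const, probReal_univ, smul_eq_mul]
    have : ν.real S * d ≤ ε / (2 * d) * d := by gcongr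
    have e : ε / (2 * d) * d = ε / 2 := by field_simp
    linarith
  all_goals
    simp only [sum_Icc_one_eq_sum_range]
    gcongr with l hl
    rw [hF, hsoft]
    refine Finset.sum_le_sum fun i _ => ?_
  · exact (hQ _ (hmem (hH l) i)).1
  · exact (hQ _ (hmem (hH l) i)).2.1

lemma softRank_zero (H : Matrix (Fin d) (Fin N) ℝ) : softRank 0 H = d := by
  classical
  rw [softRank_eq]
  simp [momentEigenvalue_nonneg]

end SoftRank

/-! ### Assembly of the almost sure limits. -/

section Limits

variable {d N : ℕ} {γ b B : ℝ} {p : Measure ℝ}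
  {Ω : Type*} [MeasurableSpace Ω] {P : Measure Ω} [IsProbabilityMeasure P]
  {X : Matrix (Fin d) (Fin N) ℝ} {W : ℕ → Ω → Matrix (Fin d) (Fin d) ℝ}
  {E : Set (Matrix (Fin d) (Fin N) ℝ)} {ν : Measure (Matrix (Fin d) (Fin N) ℝ)}

/-- The maximum with 1 makes the quotient continuous on all matrices and changes nothing on
normalized states, where ‖M‖_F² ≥ d. -/
lemma exists_continuous_eq_stableRank (hd : 2 ≤ d) (hN : N ≠ 0) :
    ∃ F : C(Matrix (Fin d) (Fin d) ℝ, ℝ),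
      ∀ H ∈ normalized d N, F (secondMoment H) = stableRank H := by
  have hf : Continuous fun M : Matrix (Fin d) (Fin d) ℝ => max (frobSq M) 1 := by
    unfold frobSq
    fun_prop
  refine ⟨⟨fun M => (d : ℝ) ^ 2 / max (frobSq M) 1, continuous_const.div hf fun M =>
    (zero_lt_one.trans_le (le_max_right _ _)).ne'⟩, fun H hH => ?_⟩
  have h1 := (isCorrelation_secondMoment hN hH).le_frobSq
  have hd2 : (2 : ℝ) ≤ d := by exact_mod_cast hd
  rw [stableRank_eq hN hH, ContinuousMap.coe_mk, max_eq_left (by linarith)]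

/-- Along almost every trajectory the averages of the soft rank and of the stable rank converge,
and the limits are bounded below in terms of the regularity constant. -/
theorem IsSetting.ae_exists_tendsto (hγ : IsAdmissibleStep d b γ) (hBb : B ≤ b) (hd : 2 ≤ d)
    (hS : IsSetting B p γ X P W E ν) :
    ∀ᵐ ω ∂P, ∀ τ ∈ Set.Icc (0 : ℝ) 1, ∃ s t : ℝ,
      Tendsto (fun L : ℕ => (1 / (L : ℝ)) * ∑ l ∈ Finset.Icc 1 L,
        (softRank τ (hidden γ X (fun k => W k ω) l) : ℝ)) atTop (𝓝 s) ∧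
      Tendsto (fun L : ℕ => ((1 - τ) ^ 2 / (L : ℝ)) * ∑ l ∈ Finset.Icc 1 L,
        stableRank (hidden γ X (fun k => W k ω) l)) atTop (𝓝 t) ∧
      t ≤ s ∧ (1 - τ) ^ 2 * √(1 - regularity ν) * √(d : ℝ) ≤ t := by
  have hN := hS.ne_zero hd
  have hνp := hS.uniqueInvariant.isInvariant.prob
  have hs := hγ.toIsSmallStep
  obtain ⟨W', hS', hm, hW⟩ := hS.exists_measurable
  obtain ⟨F, hF⟩ := exists_continuous_eq_stableRank hd hN
  filter_upwards [hW, hS'.weights.ae_mem_box hS.law hBb hm, hS'.ae_tendsto_average hs hBb hN hm]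
    with ω hω hbox havg τ hτ
  rw [hω]
  have hmem : ∀ l, hidden γ X (fun k => W' k ω) (l + 1) ∈ normalized d N := fun l =>
    (hidden_mem_normalized_and_det_pos hs hN hS.fullRank hbox l).1
  obtain ⟨s, hsoft⟩ : ∃ s, Tendsto (fun L : ℕ => (1 / (L : ℝ)) * ∑ l ∈ Finset.Icc 1 L,
      (softRank τ (hidden γ X (fun k => W' k ω) l) : ℝ)) atTop (𝓝 s) := by
    -- The absence of atoms is known only for τ > 0; at τ = 0 the soft rank is constantly d.
    rcases hτ.1.eq_or_lt with rfl | hτ0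
    · refine ⟨d, tendsto_const_nhds.congr' ?_⟩
      filter_upwards [eventually_ne_atTop 0] with L hL
      have hL' : (L : ℝ) ≠ 0 := by exact_mod_cast hL
      simp only [softRank_zero, Finset.sum_const, Nat.card_Icc, add_tsub_cancel_right,
        nsmul_eq_mul]
      field_simp
    · exact exists_tendsto_average_softRank (by omega) hN hS.ae_mem_normalized
        (fun f hf => hS.integrable_of_continuous hf) hmem havg hτ.1 hτ.2
        (hS.ae_det_sub_ne_zero hs hBb hd hτ0 hτ.2)
  have hstable : Tendsto (fun L : ℕ => ((1 - τ) ^ 2 / (L : ℝ)) * ∑ l ∈ Finset.Icc 1 L,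
      stableRank (hidden γ X (fun k => W' k ω) l)) atTop
      (𝓝 ((1 - τ) ^ 2 * ∫ H, F (secondMoment H) ∂ν)) := by
    refine ((havg F).const_mul ((1 - τ) ^ 2)).congr fun L => ?_
    rw [← mul_assoc, mul_one_div, sum_Icc_one_eq_sum_range, sum_Icc_one_eq_sum_range]
    congr 1
    exact Finset.sum_congr rfl fun l _ => hF _ (hmem l)
  refine ⟨s, _, hsoft, hstable, le_of_tendsto_of_tendsto' hstable hsoft fun L => ?_, ?_⟩
  · rw [div_eq_mul_one_div, mul_comm ((1 - τ) ^ 2), mul_assoc]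
    refine mul_le_mul_of_nonneg_left ?_ (by positivity)
    rw [Finset.mul_sum, sum_Icc_one_eq_sum_range, sum_Icc_one_eq_sum_range]
    exact Finset.sum_le_sum fun l _ =>
      stableRank_le_softRank (by omega) hN (hmem l) hτ.1 hτ.2
  · rw [mul_assoc]
    exact mul_le_mul_of_nonneg_left (hS.sqrt_le_integral hγ hBb hd F.continuous hF) (sq_nonneg _)

end Limits

end BNNet

end

/-! ### The main theorem. -/

theorem mainTheorem1 (B : ℝ) :
    ∃ γ₀ : ℕ → ℝ, (∀ d, 0 < γ₀ d) ∧
      (∀ (d N : ℕ) (p : Measure ℝ) (γ : ℝ) (X : Matrix (Fin d) (Fin N) ℝ)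
        (Ω : Type*) [MeasurableSpace Ω] (P : Measure Ω) [IsProbabilityMeasure P]
        (W : ℕ → Ω → Matrix (Fin d) (Fin d) ℝ)
        (E : Set (Matrix (Fin d) (Fin N) ℝ)) (ν : Measure (Matrix (Fin d) (Fin N) ℝ)),
        2 ≤ d → 0 < γ → γ < γ₀ d → BNNet.IsSetting B p γ X P W E ν →
          0 < BNNet.regularity ν ∧ BNNet.regularity ν < 1 ∧
          ∀ᵐ ω ∂P, ∀ τ ∈ Set.Icc (0 : ℝ) 1, ∃ s t : ℝ,
            Tendsto (fun L : ℕ => (1 / (L : ℝ)) * ∑ l ∈ Finset.Icc 1 L,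
              (BNNet.softRank τ (BNNet.hidden γ X (fun k => W k ω) l) : ℝ)) atTop (𝓝 s) ∧
            Tendsto (fun L : ℕ => ((1 - τ) ^ 2 / (L : ℝ)) * ∑ l ∈ Finset.Icc 1 L,
              BNNet.stableRank (BNNet.hidden γ X (fun k => W k ω) l)) atTop (𝓝 t) ∧
            t ≤ s ∧
            (1 - τ) ^ 2 * √(1 - BNNet.regularity ν) * √(d : ℝ) ≤ t) ∧
      (∀ (D : Set ℕ) (N : ℕ → ℕ) (p : ℕ → Measure ℝ) (γ : ℕ → ℝ)
        (X : (d : ℕ) → Matrix (Fin d) (Fin (N d)) ℝ)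
        (Ω : ℕ → Type*) [∀ d, MeasurableSpace (Ω d)] (P : (d : ℕ) → Measure (Ω d))
        [∀ d, IsProbabilityMeasure (P d)]
        (W : (d : ℕ) → ℕ → Ω d → Matrix (Fin d) (Fin d) ℝ)
        (E : (d : ℕ) → Set (Matrix (Fin d) (Fin (N d)) ℝ))
        (ν : (d : ℕ) → Measure (Matrix (Fin d) (Fin (N d)) ℝ)),
        (∀ d ∈ D, 2 ≤ d ∧ 0 < γ d ∧ γ d < γ₀ d ∧
          BNNet.IsSetting B (p d) (γ d) (X d) (P d) (W d) (E d) (ν d)) →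
        AntitoneOn (fun d => BNNet.regularity (ν d)) D →
          ∃ c : ℝ, 0 < c ∧ ∀ d ∈ D, ∀ᵐ ω ∂(P d), ∀ τ ∈ Set.Icc (0 : ℝ) 1, ∃ s t : ℝ,
            Tendsto (fun L : ℕ => (1 / (L : ℝ)) * ∑ l ∈ Finset.Icc 1 L,
              (BNNet.softRank τ (BNNet.hidden (γ d) (X d) (fun k => W d k ω) l) : ℝ))
              atTop (𝓝 s) ∧
            Tendsto (fun L : ℕ => ((1 - τ) ^ 2 / (L : ℝ)) * ∑ l ∈ Finset.Icc 1 L,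
              BNNet.stableRank (BNNet.hidden (γ d) (X d) (fun k => W d k ω) l)) atTop (𝓝 t) ∧
            t ≤ s ∧ c * (1 - τ) ^ 2 * √(d : ℝ) ≤ t) := by
  -- The bound max B 1 meets the requirement b ≥ 1 of the expansions and keeps the threshold
  -- dependent on d and B only.
  choose γ₀ hγ₀ hadm using fun d => BNNet.exists_isAdmissibleStep d (le_max_right B 1)
  have hB : B ≤ max B 1 := le_max_left B 1
  refine ⟨γ₀, hγ₀, ?_, ?_⟩
  · intro d N p γ X Ω _ P _ W E ν hd hγ0 hγ hS
    have h := hadm d γ hγ0 hγ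
    obtain ⟨h0, h1, -⟩ := hS.regularity_bounds h hB hd
    exact ⟨h0, h1, hS.ae_exists_tendsto h hB hd⟩
  · intro D N p γ X Ω _ P _ W E ν hS hanti
    rcases D.eq_empty_or_nonempty with rfl | hD
    · exact ⟨1, one_pos, fun d hd => hd.elim⟩
    have hmin := Nat.sInf_mem hD
    obtain ⟨hd₀, hγ0₀, hγ₀₀, hS₀⟩ := hS _ hmin
    obtain ⟨-, h1, -⟩ := hS₀.regularity_bounds (hadm _ _ hγ0₀ hγ₀₀) hB hd₀
    -- The smallest width has the largest regularity constant, which is still below 1, so it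
    -- provides c for all widths.
    refine ⟨√(1 - BNNet.regularity (ν (sInf D))), Real.sqrt_pos.2 (sub_pos.2 h1),
      fun d hdD => ?_⟩
    obtain ⟨hd, hγ0, hγ, hSd⟩ := hS d hdD
    filter_upwards [hSd.ae_exists_tendsto (hadm d _ hγ0 hγ) hB hd] with ω hω τ hτ
    obtain ⟨s, t, hs, ht, hts, hle⟩ := hω τ hτ
    refine ⟨s, t, hs, ht, hts, le_trans ?_ hle⟩
    have hα : BNNet.regularity (ν d) ≤ BNNet.regularity (ν (sInf D)) :=
      hanti hmin hdD (Nat.sInf_le hdD)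
    rw [mul_comm (√(1 - BNNet.regularity (ν (sInf D))))]
    gcongr
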